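/- For a graph $G$ and $r,k\in\mathbb{N}$, the instance $(G,k)$ of $K_r$-Cover is positive if there is a set $X\subseteq V(G)$ with $|X|\le k$ such that $G-X$ has no clique on $r$ vertices. All graphs are finite, and a graph class is hereditary if it is closed under isomorphism and induced subgraphs. Algorithms are programs of a unit-cost random access machine with addition and subtraction, whose input is $n$, $k$ and the adjacency matrix of an $n$-vertex graph. **Theorem.** For every $r\in\mathbb{N}$ there is a constant $c=c(r)\in\mathbb{N}$ such that the following holds. Let $\alpha\in(0,1)$, $\mu\in\mathbb{R}_{>0}$, and let $\mathcal{G}$ be a hereditary graph class for which there are constants $A,B$ such that every $G\in\mathcal{G}$ with $n\ge 1$ vertices and clique number $\omega$ has at most $A\,\omega^{\mu}n$ cliques on fewer than $r$ vertices and treewidth at most $B\,\omega^{\mu}n^{\alpha}$. Then there exist $\varepsilon\in(0,1)$, a constant $C$ and an algorithm that, given any $G\in\mathcal{G}$ with $n$ vertices and any $k\in\mathbb{N}$, decides whether $(G,k)$ is a positive instance of $K_r$-Cover in at most $$C\cdot 2^{k^{\varepsilon}}\cdot (n+1)^{c}$$ steps. (Here $\varepsilon$, $C$ and the algorithm may depend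 on $r,\alpha,\mu,\mathcal{G}$, whereas $c$ depends only on $r$.) -/

import Mathlib

/-! ### Finite graphs and graph classes -/

/-- A class of finite graphs. Every finite graph is isomorphic to a graph on some `Fin n`, so a
class is given by the set of its members on `Fin n`, for every `n`. -/
abbrev GraphClass : Type := ∀ n : ℕ, Set (SimpleGraph (Fin n))

/-- A graph class is hereditary if it is closed under taking induced subgraphs; since `H ↪g G` says
that `H` is isomorphic to an induced subgraph of `G`, closure under isomorphism is included. -/
def GraphClass.Hereditary (𝒢 : GraphClass) : Prop :=
  ∀ ⦃m n : ℕ⦄ (H : SimpleGraph (Fin m)) (G : SimpleGraph (Fin n)),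
    G ∈ 𝒢 n → Nonempty (H ↪g G) → H ∈ 𝒢 m

/-- The number of cliques on fewer than `r` vertices. -/
noncomputable def numCliquesLT {V : Type*} (G : SimpleGraph V) (r : ℕ) : ℕ :=
  {s : Finset V | G.IsClique (s : Set V) ∧ s.card < r}.ncard

/-- A tree decomposition of `G`, with tree `tree` on the node set `Fin nodes`. -/
structure TreeDecomposition {V : Type*} (G : SimpleGraph V) where
  nodes : ℕ
  tree : SimpleGraph (Fin nodes)
  isTree : tree.IsTree
  bag : Fin nodes → Finset V
  exists_mem_bag : ∀ v : V, ∃ t, v ∈ bag t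
  exists_edge_bag : ∀ u v : V, G.Adj u v → ∃ t, u ∈ bag t ∧ v ∈ bag t
  connected_bags : ∀ v : V, (tree.induce {t | v ∈ bag t}).Preconnected

/-- The width of a tree decomposition: the largest size of a bag, minus one. (A tree has at least
one node; the truncated subtraction matters only if all bags, hence the graph, are empty.) -/
def TreeDecomposition.width {V : Type*} {G : SimpleGraph V} (D : TreeDecomposition G) : ℕ :=
  (Finset.univ.sup fun t => (D.bag t).card) - 1

/-- The treewidth: the least width of a tree decomposition. -/
noncomputable def treewidth {V : Type*} (G : SimpleGraph V) : ℕ :=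
  sInf (Set.range fun D : TreeDecomposition G => D.width)

/-- `(G, k)` is a positive instance of `K_r`-Cover: there is a set `X` of at most `k` vertices such
that `G - X` is `K_r`-free. -/
def HasCliqueCover {V : Type*} (r : ℕ) (G : SimpleGraph V) (k : ℕ) : Prop :=
  ∃ X : Finset V, X.card ≤ k ∧ (G.induce {v | v ∉ X}).CliqueFree r

/-! ### Random access machines -/

namespace RAM

/-- Memory contents of a random access machine: registers, named by numbers, and an array of memory
cells with indirect addressing; each holds a natural number. (A program names only finitely many
registers.) -/
structure State where
  reg : ℕ → ℕ
  mem : ℕ → ℕ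

/-- Write the value `v` into register `x`. -/
def State.setReg (s : State) (x v : ℕ) : State :=
  { s with reg := Function.update s.reg x v }

/-- Write the value `v` into the memory cell with address `a`. -/
def State.setMem (s : State) (a v : ℕ) : State :=
  { s with mem := Function.update s.mem a v }

/-- Programs of a random access machine, with structured control flow. The arithmetic instructions
are addition and (truncated) subtraction only, so that in `t` steps the length of the numbers in
memory grows by at most `t` bits (up to a constant depending on the program), and the unit-cost
measure below is polynomially equivalent to the running time of Turing machines. -/
inductive Prog : Type
  /-- do nothing -/
  | skip : Prog
  /-- `reg x := c`, for a constant `c` of the program -/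
  | const (x c : ℕ) : Prog
  /-- `reg x := reg y` -/
  | move (x y : ℕ) : Prog
  /-- `reg x := reg y + reg z` -/
  | add (x y z : ℕ) : Prog
  /-- `reg x := reg y - reg z`, truncated at `0` -/
  | sub (x y z : ℕ) : Prog
  /-- `reg x := mem (reg y)` -/
  | load (x y : ℕ) : Prog
  /-- `mem (reg x) := reg y` -/
  | store (x y : ℕ) : Prog
  /-- first `p`, then `q` -/
  | seq (p q : Prog) : Prog
  /-- if `reg x ≠ 0` then `p` else `q` -/
  | ite (x : ℕ) (p q : Prog) : Prog
  /-- while `reg x ≠ 0` do `p` -/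
  | loop (x : ℕ) (p : Prog) : Prog

/-- `Exec p s t s'`: the program `p`, started in the state `s`, halts after exactly `t` steps in the
state `s'`. Every instruction and every test of a register costs one step. -/
inductive Exec : Prog → State → ℕ → State → Prop
  | skip (s : State) : Exec .skip s 1 s
  | const (x c : ℕ) (s : State) : Exec (.const x c) s 1 (s.setReg x c)
  | move (x y : ℕ) (s : State) : Exec (.move x y) s 1 (s.setReg x (s.reg y))
  | add (x y z : ℕ) (s : State) : Exec (.add x y z) s 1 (s.setReg x (s.reg y + s.reg z))
  | sub (x y z : ℕ) (s : State) : Exec (.sub x y z) s 1 (s.setReg x (s.reg y - s.reg z))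
  | load (x y : ℕ) (s : State) : Exec (.load x y) s 1 (s.setReg x (s.mem (s.reg y)))
  | store (x y : ℕ) (s : State) : Exec (.store x y) s 1 (s.setMem (s.reg x) (s.reg y))
  | seq {p q : Prog} {s s₁ s₂ : State} {t₁ t₂ : ℕ} :
      Exec p s t₁ s₁ → Exec q s₁ t₂ s₂ → Exec (.seq p q) s (t₁ + t₂) s₂
  | ite_true {x : ℕ} {p q : Prog} {s s' : State} {t : ℕ} :
      s.reg x ≠ 0 → Exec p s t s' → Exec (.ite x p q) s (t + 1) s'
  | ite_false {x : ℕ} {p q : Prog} {s s' : State} {t : ℕ} :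
      s.reg x = 0 → Exec q s t s' → Exec (.ite x p q) s (t + 1) s'
  | loop_done {x : ℕ} {p : Prog} {s : State} :
      s.reg x = 0 → Exec (.loop x p) s 1 s
  | loop_step {x : ℕ} {p : Prog} {s s₁ s₂ : State} {t₁ t₂ : ℕ} :
      s.reg x ≠ 0 → Exec p s t₁ s₁ → Exec (.loop x p) s₁ t₂ s₂ →
        Exec (.loop x p) s (t₁ + t₂ + 1) s₂

open Classical in
/-- The initial state for the instance `(G, k)`: register `0` holds the number `n` of vertices,
register `1` holds `k`, and the memory cells `0, …, n ^ 2 - 1` hold the adjacency matrix of `G` row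
by row. All other registers and cells are `0`. -/
noncomputable def input {n : ℕ} (G : SimpleGraph (Fin n)) (k : ℕ) : State where
  reg x := if x = 0 then n else if x = 1 then k else 0
  mem a := if ∃ i j : Fin n, G.Adj i j ∧ a = (i : ℕ) * n + (j : ℕ) then 1 else 0

/-- The program `p` solves the problem `Q` (a property of a graph and a number) on the graph class
`𝒢` in time `T`: on every instance `(G, k)` with `G ∈ 𝒢`, where `G` has `n` vertices, it halts after
at most `T n k` steps, and it accepts (register `0` holds `1`) if and only if `Q G k`. -/
def SolvesInTime (p : Prog) (Q : ∀ n : ℕ, SimpleGraph (Fin n) → ℕ → Prop) (𝒢 : GraphClass)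
    (T : ℕ → ℕ → ℝ) : Prop :=
  ∀ (n : ℕ) (G : SimpleGraph (Fin n)), G ∈ 𝒢 n → ∀ k : ℕ,
    ∃ (t : ℕ) (s : State), Exec p (input G k) t s ∧ (t : ℝ) ≤ T n k ∧ (s.reg 0 = 1 ↔ Q n G k)

end RAM

/-!
The algorithm branches, and finishes every branch with a dynamic program along a linear order of a
small set of vertices, the core. It accepts only if it has found a set of at most `k` vertices that
meets all cliques on `r` vertices, so that only the running time and the acceptance of positive
instances need an argument. All sizes are measured by `w`, about `k ^ (1 / q)` for a large constant
`q`.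

*Large cliques.* A solution contains all but `r - 1` vertices of any clique. As long as the vertices of
a maximal packing of cliques on `r` vertices span a clique on `τ ≈ w ^ 2` vertices, the algorithm
guesses the at most `r - 1` vertices of it that are left out. Each branch spends at least `w ^ 2` of the
budget, so that `w ^ (q - 2)` rounds suffice (`exists_mem_phase₁`). Afterwards the clique number is at
most `τ + r` outside the set `Z` of chosen vertices, hence the number of small cliques is linear and the
treewidth sublinear in the number of vertices, up to factors polynomial in `w`.

*The core.* For a set `X` in the current core consider the petals `t \ X` of the sets `t` that have to
be hit and satisfy `t ∩ core = X`. If the petals of `X` contain a packing of more than `τ` sets, then a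
solution hits `X`, or it contains a vertex of each petal; in the second case the packing of sets known
to be hit grows by more than `w ^ 2`, which can happen only `w ^ (q - 2)` times. In the first case `X`
becomes a set that has to be hit. All small petal packings are put into the core. After `r` rounds
without a branch of the second kind every clique that has to be hit contains such a set inside the core
(`exists_mem_phase₂`). Since only small cliques of the core have petals, the core keeps a size of at
most `k` times a power of `w` that does not depend on `q`.

*The dynamic program.* Some bag of a tree decomposition is a balanced separator
(`TreeDecomposition.exists_balanced_bag`). As the treewidth of an induced subgraph on part of the core
is at most a multiple of `w ^ (q - 4)`, recursive splitting orders the core such that at most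
`w ^ (q - 3)` vertices of any initial segment, up to a constant factor, have neighbours after it
(`order_spec`). All sets that have to be hit are cliques, so that a partial solution matters only
through its size and its trace on these vertices (`exists_mem_dp`).

All search trees and tables have size `2 ^ O(w ^ (q - 1))`, and `w ^ (q - 1)` is about
`k ^ (1 - 1 / q)` (`exists_fits`, `exists_two_pow_le`). The number `fuel = 2 ^ e` of this order is passed
to the algorithm, which discards everything beyond it; therefore the algorithm is a polynomial-time
function of the instance and the parameters in unary (`polyTime_answer`), and the degree of the
polynomial depends on `r` only. To turn this into a program, data are encoded as binary trees on a heap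
(`RAM.Realizes`), and the functions computable in polynomial time are shown to be closed under the usual
operations on lists (`PolyTime`).
-/

/-! ### S-expressions on a random access machine -/

/-- Binary trees without labels; every finite piece of data is encoded as such a tree. -/
inductive SExp : Type
  | nil : SExp
  | cons (x y : SExp) : SExp

/-- The number of nodes and leaves of a tree. -/
def SExp.size : SExp → ℕ
  | .nil => 1
  | .cons x y => x.size + y.size + 1

lemma SExp.one_le_size (x : SExp) : 1 ≤ x.size := by
  cases x <;> simp [SExp.size]

namespace RAM

/-- `Rep m h x a`: in the memory `m`, the pointer `a` represents the tree `x`, all of whose cells lie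
below the address `h`. The pointer `0` represents the empty tree; a pointer `a ≠ 0` represents the
tree whose two subtrees are represented by the contents of the cells `a` and `a + 1`. -/
def Rep (m : ℕ → ℕ) (h : ℕ) : SExp → ℕ → Prop
  | .nil, a => a = 0
  | .cons x y, a => a ≠ 0 ∧ a + 1 < h ∧ Rep m h x (m a) ∧ Rep m h y (m (a + 1))

lemma Rep.mono {m m' : ℕ → ℕ} {h h' : ℕ} (hh : h ≤ h') (hm : ∀ a < h, m' a = m a) :
    ∀ {x : SExp} {a : ℕ}, Rep m h x a → Rep m' h' x a
  | .nil, _, hx => hx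
  | .cons x y, a, hx => by
    obtain ⟨h1, h2, h3, h4⟩ := hx
    refine ⟨h1, by omega, ?_, ?_⟩
    · rw [hm a (by omega)]; exact Rep.mono hh hm h3
    · rw [hm (a + 1) (by omega)]; exact Rep.mono hh hm h4

/-- The program `p`, started in `s`, halts after at most `T` steps in a state satisfying `Q`. -/
def Runs (p : Prog) (s : State) (T : ℕ) (Q : State → Prop) : Prop :=
  ∃ t s', Exec p s t s' ∧ t ≤ T ∧ Q s'

lemma Runs.mono {p : Prog} {s : State} {T T' : ℕ} {Q Q' : State → Prop} (h : Runs p s T Q)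
    (hT : T ≤ T') (hQ : ∀ s', Q s' → Q' s') : Runs p s T' Q' := by
  obtain ⟨t, s', h1, h2, h3⟩ := h
  exact ⟨t, s', h1, h2.trans hT, hQ _ h3⟩

lemma Runs.seq {p q : Prog} {s : State} {T₁ T₂ : ℕ} {Q : State → Prop}
    (h : Runs p s T₁ fun s₁ => Runs q s₁ T₂ Q) : Runs (.seq p q) s (T₁ + T₂) Q := by
  obtain ⟨t, s', h1, h2, t', s'', h3, h4, h5⟩ := h
  exact ⟨_, _, .seq h1 h3, by omega, h5⟩

lemma Runs.skip {s : State} {Q : State → Prop} (h : Q s) : Runs .skip s 1 Q :=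
  ⟨_, _, .skip s, le_rfl, h⟩

lemma Runs.const {x c : ℕ} {s : State} {Q : State → Prop} (h : Q (s.setReg x c)) :
    Runs (.const x c) s 1 Q := ⟨_, _, .const x c s, le_rfl, h⟩

lemma Runs.move {x y : ℕ} {s : State} {Q : State → Prop} (h : Q (s.setReg x (s.reg y))) :
    Runs (.move x y) s 1 Q := ⟨_, _, .move x y s, le_rfl, h⟩

lemma Runs.add {x y z : ℕ} {s : State} {Q : State → Prop}
    (h : Q (s.setReg x (s.reg y + s.reg z))) :
    Runs (.add x y z) s 1 Q := ⟨_, _, .add x y z s, le_rfl, h⟩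

lemma Runs.sub {x y z : ℕ} {s : State} {Q : State → Prop}
    (h : Q (s.setReg x (s.reg y - s.reg z))) :
    Runs (.sub x y z) s 1 Q := ⟨_, _, .sub x y z s, le_rfl, h⟩

lemma Runs.load {x y : ℕ} {s : State} {Q : State → Prop} (h : Q (s.setReg x (s.mem (s.reg y)))) :
    Runs (.load x y) s 1 Q := ⟨_, _, .load x y s, le_rfl, h⟩

lemma Runs.store {x y : ℕ} {s : State} {Q : State → Prop}
    (h : Q (s.setMem (s.reg x) (s.reg y))) :
    Runs (.store x y) s 1 Q := ⟨_, _, .store x y s, le_rfl, h⟩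

lemma Runs.ite {x : ℕ} {p q : Prog} {s : State} {T : ℕ} {Q : State → Prop}
    (h1 : s.reg x ≠ 0 → Runs p s T Q) (h2 : s.reg x = 0 → Runs q s T Q) :
    Runs (.ite x p q) s (T + 1) Q := by
  by_cases hx : s.reg x = 0
  · obtain ⟨t, s', h3, h4, h5⟩ := h2 hx
    exact ⟨_, _, .ite_false hx h3, by omega, h5⟩
  · obtain ⟨t, s', h3, h4, h5⟩ := h1 hx
    exact ⟨_, _, .ite_true hx h3, by omega, h5⟩

lemma Runs.loop_done {x : ℕ} {p : Prog} {s : State} {Q : State → Prop} (hx : s.reg x = 0)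
    (h : Q s) : Runs (.loop x p) s 1 Q := ⟨_, _, .loop_done hx, le_rfl, h⟩

lemma Runs.loop_step {x : ℕ} {p : Prog} {s : State} {T₁ T₂ : ℕ} {Q : State → Prop}
    (hx : s.reg x ≠ 0) (h : Runs p s T₁ fun s₁ => Runs (.loop x p) s₁ T₂ Q) :
    Runs (.loop x p) s (T₁ + T₂ + 1) Q := by
  obtain ⟨t, s', h1, h2, t', s'', h3, h4, h5⟩ := h
  exact ⟨_, _, .loop_step hx h1 h3, by omega, h5⟩

/-- A loop that counts register `x` down to `0`, with an invariant `I` indexed by the value of the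
register `x`. -/
lemma Runs.loop_count {x : ℕ} {p : Prog} {T : ℕ} (I : ℕ → State → Prop)
    (hp : ∀ i s, s.reg x = i + 1 → I (i + 1) s → Runs p s T fun s' => s'.reg x = i ∧ I i s') :
    ∀ (i : ℕ) (s : State), s.reg x = i → I i s →
      Runs (.loop x p) s (i * (T + 1) + 1) fun s' => s'.reg x = 0 ∧ I 0 s'
  | 0, s, hx, hI => (Runs.loop_done hx ⟨hx, hI⟩).mono (by omega) fun _ h => h
  | i + 1, s, hx, hI => by
    refine (Runs.loop_step (T₁ := T) (T₂ := i * (T + 1) + 1) (by omega)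
      ((hp i s hx hI).mono le_rfl fun s' hs' => Runs.loop_count I hp i s' hs'.1 hs'.2)).mono
      (by ring_nf; omega) fun _ h => h

/-- Sequential composition of programs. -/
infixr:60 " ;; " => Prog.seq

/-- Allocates a new cell for the pair of pointers in the registers `a` and `b` at the top of the heap,
and writes its address into register `d`. Register `3` holds the top of the heap; register `5` is
scratch. -/
def consProg (d a b : ℕ) : Prog :=
  .store 3 a ;; .const 5 1 ;; .add 3 3 5 ;; .store 3 b ;; .add 3 3 5 ;; .const 5 2 ;; .sub d 3 5

lemma runs_consProg {d a b : ℕ} {s : State} (hd : d ≠ 3)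
    (hb : b ≠ 3) (hb5 : b ≠ 5) {Q : State → Prop}
    (hQ : ∀ s' : State, s'.reg d = s.reg 3 → s'.reg 3 = s.reg 3 + 2 →
      (∀ x, x ≠ 3 → x ≠ 5 → x ≠ d → s'.reg x = s.reg x) →
      (∀ i < s.reg 3, s'.mem i = s.mem i) → s'.mem (s.reg 3) = s.reg a →
      s'.mem (s.reg 3 + 1) = s.reg b → Q s') :
    Runs (consProg d a b) s 7 Q := by
  refine Runs.mono (T := 1 + (1 + (1 + (1 + (1 + (1 + 1)))))) (Q := Q) ?_ le_rfl fun _ h => h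
  refine .seq (.store (.seq (.const (.seq (.add (.seq (.store (.seq (.add (.seq (.const
    (.sub ?_))))))))))))
  apply hQ
  · simp [State.setReg, State.setMem, Function.update_apply]
  · simp [State.setReg, State.setMem, Function.update_apply, hd.symm]
  · intro x h1 h2 h3
    simp [State.setReg, State.setMem, Function.update_apply, h1, h2, h3]
  · intro i hi
    simp [State.setReg, State.setMem, Function.update_apply, show i ≠ s.reg 3 + 1 by omega,
      show i ≠ s.reg 3 by omega]
  · simp [State.setReg, State.setMem, Function.update_apply]
  · simp [State.setReg, State.setMem, hb, hb5]

/-- The program `p` computes the tree `y` from the tree `x` in at most `T` steps. The argument and the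
result are represented by register `2`. Register `3` is the top of the heap, which is never
overwritten below; register `4` points to the stack and is preserved. -/
def Realizes (p : Prog) (x y : SExp) (T : ℕ) : Prop :=
  ∀ s : State, s.reg 3 ≠ 0 → Rep s.mem (s.reg 3) x (s.reg 2) →
    Runs p s T fun s' => Rep s'.mem (s'.reg 3) y (s'.reg 2) ∧ s.reg 3 ≤ s'.reg 3 ∧
      (∀ a < s.reg 3, s'.mem a = s.mem a) ∧ s'.reg 4 = s.reg 4

lemma Realizes.mono {p : Prog} {x y : SExp} {T T' : ℕ} (h : Realizes p x y T) (hT : T ≤ T') :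
    Realizes p x y T' := fun s h1 h2 => (h s h1 h2).mono hT fun _ h => h

lemma realizes_skip (x : SExp) : Realizes .skip x x 1 := fun _ _ h2 =>
  .skip ⟨h2, le_rfl, fun _ _ => rfl, rfl⟩

lemma realizes_nil (x : SExp) : Realizes (.const 2 0) x .nil 1 := fun s _ _ =>
  .const ⟨by simp [State.setReg, Rep], by simp [State.setReg], fun _ _ => rfl,
    by simp [State.setReg]⟩

lemma realizes_fst (x y : SExp) : Realizes (.load 2 2) (.cons x y) x 1 := fun s _ h2 =>
  .load ⟨by simpa [State.setReg] using h2.2.2.1, by simp [State.setReg], fun _ _ => rfl,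
    by simp [State.setReg]⟩

/-- The second component of a pair. -/
def sndProg : Prog := .const 5 1 ;; .add 2 2 5 ;; .load 2 2

lemma realizes_snd (x y : SExp) : Realizes sndProg (.cons x y) y 3 := fun s _ h2 =>
  Runs.mono (T := 1 + (1 + 1)) (.seq (.const (.seq (.add (.load
    ⟨by simpa [State.setReg] using h2.2.2.2, by simp [State.setReg], fun _ _ => rfl,
    by simp [State.setReg]⟩))))) le_rfl fun _ h => h

lemma Realizes.seq {p q : Prog} {x y z : SExp} {T₁ T₂ : ℕ} (hp : Realizes p x y T₁)
    (hq : Realizes q y z T₂) : Realizes (p ;; q) x z (T₁ + T₂) := fun s h1 h2 => by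
  refine .seq ((hp s h1 h2).mono le_rfl ?_)
  rintro s₁ ⟨h3, h4, h5, h6⟩
  refine (hq s₁ (by omega) h3).mono le_rfl ?_
  rintro s₂ ⟨h7, h8, h9, h10⟩
  exact ⟨h7, h4.trans h8, fun a ha => (h9 a (by omega)).trans (h5 a ha), h10.trans h6⟩

/-- Computes the pair of the results of `p` and `q` on the same argument: the argument is kept on the
stack while `p` runs, the result of `p` while `q` runs. -/
def pairProg (p q : Prog) : Prog :=
  consProg 4 2 4 ;; p ;;
  .load 7 4 ;; .const 5 1 ;; .add 5 4 5 ;; .load 4 5 ;; consProg 4 2 4 ;; .move 2 7 ;; q ;;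
  .load 7 4 ;; .const 5 1 ;; .add 5 4 5 ;; .load 4 5 ;; consProg 2 7 2

lemma Realizes.pair {p q : Prog} {x y z : SExp} {T₁ T₂ : ℕ} (hp : Realizes p x y T₁)
    (hq : Realizes q x z T₂) : Realizes (pairProg p q) x (.cons y z) (T₁ + T₂ + 30) := by
  intro s h1 h2
  refine Runs.mono (T := 7 + (T₁ + (1 + (1 + (1 + (1 + (7 + (1 + (T₂ + (1 + (1 + (1 + (1 + 7)))))))))))))
    (.seq ?_) (by omega) fun _ h => h
  refine runs_consProg (by decide) (by decide) (by decide) ?_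
  intro s₁ r4 r3 ro mo m0 m1
  have e2 : s₁.reg 2 = s.reg 2 := ro 2 (by decide) (by decide) (by decide)
  have hx₁ : Rep s₁.mem (s₁.reg 3) x (s₁.reg 2) := by
    rw [e2]; exact h2.mono (by omega) mo
  refine .seq ((hp s₁ (by omega) hx₁).mono le_rfl ?_)
  rintro s₂ ⟨hy₂, h3₂, hm₂, h4₂⟩
  refine .seq (.load (.seq (.const (.seq (.add (.seq (.load (.seq ?_))))))))
  refine runs_consProg (by decide) (by decide) (by decide) ?_
  intro s₃ r4' r3' ro' mo' m0' m1'
  simp only [State.setReg, Function.update_apply] at r4' r3' ro' mo' m0' m1'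
  simp only [Nat.reduceEqDiff, if_true, if_false] at r4' r3' ro' mo' m0' m1'
  have e7 : s₃.reg 7 = s.reg 2 := by
    rw [ro' 7 (by decide) (by decide) (by decide)]
    simp only [Nat.reduceEqDiff, reduceIte]
    rw [h4₂, r4, hm₂ _ (by omega), m0]
  have em : ∀ a < s₁.reg 3, s₃.mem a = s₁.mem a := fun a ha => by
    rw [mo' a (by omega), hm₂ a ha]
  have e1 : s₃.mem (s₃.reg 4 + 1) = s.reg 4 := by
    rw [r4', m1', h4₂, r4, hm₂ _ (by omega), m1]
  have e0 : s₃.mem (s₃.reg 4) = s₂.reg 2 := by rw [r4', m0']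
  refine .seq (.move (.seq ?_))
  have hx₃ : Rep s₃.mem (s₃.reg 3) x (s.reg 2) :=
    h2.mono (by omega) fun a ha => by rw [em a (by omega), mo a ha]
  refine (hq (s₃.setReg 2 (s₃.reg 7)) ?_ ?_).mono le_rfl ?_
  · simp [State.setReg]; omega
  · simpa [State.setReg, e7] using hx₃
  rintro s₄ ⟨hz, h3₄, hm₄, h4₄⟩
  simp only [State.setReg, Function.update_apply, Nat.reduceEqDiff,
    if_false] at h3₄ hm₄ h4₄
  refine .seq (.load (.seq (.const (.seq (.add (.seq (.load ?_)))))))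
  refine runs_consProg (by decide) (by decide) (by decide) ?_
  intro s₅ r2'' r3'' ro'' mo'' m0'' m1''
  simp only [State.setReg, Function.update_apply] at r2'' r3'' ro'' mo'' m0'' m1''
  simp only [Nat.reduceEqDiff, if_true, if_false] at r2'' r3'' ro'' mo'' m0'' m1''
  have e4 : s₅.reg 4 = s.reg 4 := by
    rw [ro'' 4 (by decide) (by decide) (by decide)]
    simp only [if_true]
    rw [h4₄, hm₄ _ (by omega), e1]
  have hy : Rep s₅.mem (s₅.reg 3) y (s₂.reg 2) :=
    hy₂.mono (by omega) fun a ha => by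
      rw [mo'' a (by omega), hm₄ a (by omega), mo' a ha]
  have hz' : Rep s₅.mem (s₅.reg 3) z (s₄.reg 2) :=
    hz.mono (by omega) mo''
  refine ⟨⟨by omega, by omega, ?_, ?_⟩, by omega, ?_, e4⟩
  · rw [r2'', m0'', h4₄, hm₄ _ (by omega), e0]; exact hy
  · rw [r2'', m1'']; exact hz'
  · intro a ha
    rw [mo'' a (by omega), hm₄ a (by omega), em a (by omega), mo a ha]

/-- Runs `p` or `q`, according to whether the result of `c` is a pair or empty. -/
def condProg (c p q : Prog) : Prog :=
  pairProg c .skip ;; .load 7 2 ;; sndProg ;; .ite 7 p q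

lemma Realizes.cond_cons {c p q : Prog} {x y u v : SExp} {T₁ T₂ : ℕ}
    (hc : Realizes c x (.cons u v) T₁) (hp : Realizes p x y T₂) :
    Realizes (condProg c p q) x y (T₁ + T₂ + 50) := by
  intro s h1 h2
  refine Runs.mono (T := (T₁ + 1 + 30) + (1 + ((1 + (1 + 1)) + (T₂ + 1)))) (.seq ?_) (by omega)
    fun _ h => h
  refine (hc.pair (realizes_skip x) s h1 h2).mono le_rfl ?_
  rintro s₁ ⟨⟨h3, h4, h5, h6⟩, h7, h8, h9⟩
  refine .seq (.load (.seq (.seq (.const (.seq (.add (.load (.ite (fun _ => ?_) fun h => ?_))))))))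
  · refine (hp _ ?_ ?_).mono le_rfl ?_
    · simp [State.setReg]; omega
    · simpa [State.setReg] using h6
    · simp only [State.setReg, Function.update_apply, Nat.reduceEqDiff,
        if_false]
      rintro s₂ ⟨h10, h11, h12, h13⟩
      exact ⟨h10, by omega, fun a ha => by rw [h12 a (by omega), h8 a ha], by omega⟩
  · simp [State.setReg] at h
    exact absurd h h5.1

lemma Realizes.cond_nil {c p q : Prog} {x y : SExp} {T₁ T₂ : ℕ}
    (hc : Realizes c x .nil T₁) (hq : Realizes q x y T₂) :
    Realizes (condProg c p q) x y (T₁ + T₂ + 50) := by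
  intro s h1 h2
  refine Runs.mono (T := (T₁ + 1 + 30) + (1 + ((1 + (1 + 1)) + (T₂ + 1)))) (.seq ?_) (by omega)
    fun _ h => h
  refine (hc.pair (realizes_skip x) s h1 h2).mono le_rfl ?_
  rintro s₁ ⟨⟨h3, h4, h5, h6⟩, h7, h8, h9⟩
  refine .seq (.load (.seq (.seq (.const (.seq (.add (.load (.ite (fun h => ?_) fun _ => ?_))))))))
  · simp [State.setReg] at h
    exact absurd h5 h
  · refine (hq _ ?_ ?_).mono le_rfl ?_
    · simp [State.setReg]; omega
    · simpa [State.setReg] using h6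
    · simp only [State.setReg, Function.update_apply, Nat.reduceEqDiff,
        if_false]
      rintro s₂ ⟨h10, h11, h12, h13⟩
      exact ⟨h10, by omega, fun a ha => by rw [h12 a (by omega), h8 a ha], by omega⟩

/-- Repeats `p` as long as the first component of the current pair is not empty. -/
def whileProg (p : Prog) : Prog := .load 7 2 ;; .loop 7 (p ;; .load 7 2)

/-- The loop of `whileProg` along a sequence of pairs `(x 0, y 0), …, (x m, y m)` in which only the
last first component is empty. -/
lemma realizes_whileProg {p : Prog} {T : ℕ} (m : ℕ) (x y : ℕ → SExp)
    (hx : ∀ i < m, x i ≠ .nil) (hm : x m = .nil)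
    (hp : ∀ i < m, Realizes p (.cons (x i) (y i)) (.cons (x (i + 1)) (y (i + 1))) T) :
    Realizes (whileProg p) (.cons (x 0) (y 0)) (.cons (x m) (y m)) (m * (T + 2) + 2) := by
  have key : ∀ j ≤ m, ∀ s : State, s.reg 3 ≠ 0 →
      Rep s.mem (s.reg 3) (.cons (x (m - j)) (y (m - j))) (s.reg 2) →
      s.reg 7 = s.mem (s.reg 2) →
      Runs (.loop 7 (p ;; .load 7 2)) s (j * (T + 2) + 1) fun s' =>
        Rep s'.mem (s'.reg 3) (.cons (x m) (y m)) (s'.reg 2) ∧ s.reg 3 ≤ s'.reg 3 ∧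
        (∀ a < s.reg 3, s'.mem a = s.mem a) ∧ s'.reg 4 = s.reg 4 := by
    intro j
    induction j with
    | zero =>
      intro _ s h1 h2 h3
      rw [Nat.sub_zero] at h2
      refine (Runs.loop_done ?_ ⟨h2, le_rfl, fun _ _ => rfl, rfl⟩).mono (by omega) fun _ h => h
      rw [h3]
      have := h2.2.2.1
      rwa [hm] at this
    | succ j ih =>
      intro hj s h1 h2 h3
      refine (Runs.loop_step (T₁ := T + 1) (T₂ := j * (T + 2) + 1) ?_ ?_).mono
        (by ring_nf; omega) fun _ h => h
      · rw [h3]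
        have h5 := h2.2.2.1
        have := hx (m - (j + 1)) (by omega)
        cases hxx : x (m - (j + 1)) with
        | nil => exact absurd hxx this
        | cons u v => rw [hxx] at h5; exact h5.1
      · refine .seq ((hp (m - (j + 1)) (by omega) s h1 h2).mono le_rfl ?_)
        rintro s₁ ⟨h4, h5, h6, h7⟩
        refine .load ?_
        rw [show m - (j + 1) + 1 = m - j by omega] at h4
        refine (ih (by omega) (s₁.setReg 7 (s₁.mem (s₁.reg 2))) ?_ ?_ ?_).mono le_rfl ?_
        · simp [State.setReg]; omega
        · simpa [State.setReg] using h4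
        · simp [State.setReg]
        · simp only [State.setReg, Function.update_apply, Nat.reduceEqDiff,
            if_false]
          rintro s₂ ⟨h10, h11, h12, h13⟩
          exact ⟨h10, by omega, fun a ha => by rw [h12 a (by omega), h6 a ha], by omega⟩
  intro s h1 h2
  refine Runs.mono (T := 1 + (m * (T + 2) + 1)) (.seq (.load ?_)) (by omega) fun _ h => h
  refine (key m le_rfl (s.setReg 7 (s.mem (s.reg 2))) ?_ ?_ ?_).mono le_rfl ?_
  · simpa [State.setReg] using h1
  · simpa [State.setReg] using h2
  · simp [State.setReg]
  · simp only [State.setReg, Function.update_apply, Nat.reduceEqDiff,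
      if_false]
    exact fun _ h => h

end RAM

/-! ### Functions computable in polynomial time -/

/-- An encoding of the elements of a type by trees. -/
class Enc (α : Type) where
  /-- the tree that encodes an element -/
  enc : α → SExp

open Enc RAM

/-- The encoding of a list: a chain of pairs ending in the empty tree. -/
def encList {α : Type} (f : α → SExp) : List α → SExp
  | [] => .nil
  | a :: l => .cons (f a) (encList f l)

instance : Enc Unit := ⟨fun _ => .nil⟩

instance {α : Type} [Enc α] : Enc (List α) := ⟨encList enc⟩

instance {α β : Type} [Enc α] [Enc β] : Enc (α × β) := ⟨fun x => .cons (enc x.1) (enc x.2)⟩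

/-- Natural numbers are encoded in unary. -/
instance : Enc ℕ := ⟨fun n => enc (List.replicate n ())⟩

open Classical in
/-- Truth values are encoded by the empty and by a nonempty tree. With this encoding, a decision
procedure for a predicate is a function with values in `Prop` that can be computed. -/
noncomputable instance : Enc Prop := ⟨fun p => if p then .cons .nil .nil else .nil⟩

/-- The size of the encoding of `a`. -/
def esize {α : Type} [Enc α] (a : α) : ℕ := (enc a).size

section PolyBound

variable {α β γ δ : Type} [Enc α] [Enc β] [Enc γ] [Enc δ]

lemma one_le_esize (a : α) : 1 ≤ esize a := SExp.one_le_size _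

lemma esize_pair (a : α) (b : β) : esize (a, b) = esize a + esize b + 1 := rfl

lemma esize_nil : esize ([] : List α) = 1 := rfl

lemma esize_cons (a : α) (l : List α) : esize (a :: l) = esize a + esize l + 1 := rfl

lemma esize_nat (n : ℕ) : esize n = 2 * n + 1 := by
  induction n with
  | zero => rfl
  | succ n ih =>
    have : esize (n + 1) = 1 + esize n + 1 := rfl
    omega

lemma esize_prop (p : Prop) : esize p ≤ 3 := by
  simp only [esize, enc]
  split_ifs <;> simp [SExp.size]

lemma length_le_esize (l : List α) : l.length ≤ esize l := by
  induction l with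
  | nil => simp
  | cons a l ih => rw [esize_cons, List.length_cons]; omega

lemma esize_le_of_mem {l : List α} {a : α} (h : a ∈ l) : esize a ≤ esize l := by
  induction l with
  | nil => simp at h
  | cons b l ih =>
    rw [esize_cons]
    rcases List.mem_cons.1 h with rfl | h
    · omega
    · have := ih h; omega

lemma esize_list_le {l : List α} {B : ℕ} (h : ∀ a ∈ l, esize a ≤ B) :
    esize l ≤ l.length * (B + 1) + 1 := by
  induction l with
  | nil => simp [esize_nil]
  | cons a l ih =>
    rw [esize_cons, List.length_cons]
    have h1 := ih fun a ha => h a (List.mem_cons_of_mem _ ha)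
    have h2 := h a List.mem_cons_self
    ring_nf at h1 ⊢
    omega

lemma esize_append (l l' : List α) : esize (l ++ l') + 1 = esize l + esize l' := by
  induction l with
  | nil => rw [List.nil_append, esize_nil]; omega
  | cons a l ih => rw [List.cons_append, esize_cons, esize_cons]; omega

lemma esize_sublist {l l' : List α} (h : l.Sublist l') : esize l ≤ esize l' := by
  induction h with
  | slnil => exact le_rfl
  | cons a _ ih => rw [esize_cons]; omega
  | cons_cons a _ ih => rw [esize_cons, esize_cons]; omega

lemma esize_reverse (l : List α) : esize l.reverse = esize l := by
  induction l with
  | nil => rfl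
  | cons a l ih =>
    have := esize_append l.reverse [a]
    rw [List.reverse_cons, esize_cons]
    rw [esize_cons, esize_nil] at this
    omega

/-- `f` is bounded by a polynomial in the size of the argument. -/
def PolyBound (f : α → ℕ) : Prop := ∃ c, ∀ x, f x ≤ (esize x + 2) ^ c

lemma PolyBound.mono {f g : α → ℕ} (hg : PolyBound g) (h : ∀ x, f x ≤ g x) : PolyBound f := by
  obtain ⟨c, hc⟩ := hg
  exact ⟨c, fun x => (h x).trans (hc x)⟩

lemma PolyBound.const (k : ℕ) : PolyBound fun _ : α => k :=
  ⟨k, fun x => Nat.lt_two_pow_self.le.trans (Nat.pow_le_pow_left (by omega) k)⟩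

lemma PolyBound.add {f g : α → ℕ} (hf : PolyBound f) (hg : PolyBound g) :
    PolyBound fun x => f x + g x := by
  obtain ⟨a, ha⟩ := hf
  obtain ⟨b, hb⟩ := hg
  refine ⟨max a b + 1, fun x => ?_⟩
  have h1 := (ha x).trans (Nat.pow_le_pow_right (by omega) (le_max_left a b))
  have h2 := (hb x).trans (Nat.pow_le_pow_right (by omega) (le_max_right a b))
  calc f x + g x ≤ (esize x + 2) ^ max a b * 2 := by omega
    _ ≤ (esize x + 2) ^ (max a b + 1) := by
      rw [pow_succ]; exact Nat.mul_le_mul_left _ (by omega)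

lemma PolyBound.mul {f g : α → ℕ} (hf : PolyBound f) (hg : PolyBound g) :
    PolyBound fun x => f x * g x := by
  obtain ⟨a, ha⟩ := hf
  obtain ⟨b, hb⟩ := hg
  exact ⟨a + b, fun x => by rw [pow_add]; exact Nat.mul_le_mul (ha x) (hb x)⟩

lemma PolyBound.pow {f : α → ℕ} (hf : PolyBound f) (k : ℕ) : PolyBound fun x => f x ^ k := by
  obtain ⟨a, ha⟩ := hf
  exact ⟨a * k, fun x => by rw [pow_mul]; exact Nat.pow_le_pow_left (ha x) k⟩

lemma PolyBound.esize : PolyBound fun x : α => esize x :=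
  ⟨1, fun x => by rw [pow_one]; exact Nat.le_add_right _ 2⟩

lemma PolyBound.comp {g : β → ℕ} {f : α → β} (hg : PolyBound g)
    (hf : PolyBound fun x => _root_.esize (f x)) : PolyBound fun x => g (f x) := by
  obtain ⟨c, hc⟩ := hg
  exact ((hf.add (.const 2)).pow c).mono fun x => hc (f x)

end PolyBound

section PolyTime

variable {α β γ δ : Type} [Enc α] [Enc β] [Enc γ] [Enc δ]

/-- `f` can be computed in polynomial time, and its values have polynomial size. (As subtrees are
shared in memory, the second condition does not follow from the first.) -/
@[fun_prop]
def PolyTime (f : α → β) : Prop :=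
  ∃ (p : Prog) (T : α → ℕ), PolyBound T ∧ (∀ x, Realizes p (enc x) (enc (f x)) (T x)) ∧
    PolyBound fun x => esize (f x)

lemma PolyTime.polyBound {f : α → β} (hf : PolyTime f) : PolyBound fun x => esize (f x) :=
  let ⟨_, _, _, _, h⟩ := hf; h

lemma PolyTime.congr {f g : α → β} (hf : PolyTime f) (h : ∀ x, f x = g x) : PolyTime g :=
  (funext h : f = g) ▸ hf

@[fun_prop]
lemma PolyTime.id : PolyTime fun x : α => x :=
  ⟨_, _, .const 1, fun _ => realizes_skip _, .esize⟩

@[fun_prop]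
lemma PolyTime.comp {g : β → γ} {f : α → β} (hg : PolyTime g) (hf : PolyTime f) :
    PolyTime fun x => g (f x) := by
  obtain ⟨p, T, hT, hp, hs⟩ := hf
  obtain ⟨q, U, hU, hq, hr⟩ := hg
  exact ⟨p ;; q, _, hT.add (hU.comp hs), fun x => (hp x).seq (hq (f x)), hr.comp hs⟩

lemma exists_realizes_const (y : SExp) : ∃ p T, ∀ x, Realizes p x y T := by
  induction y with
  | nil => exact ⟨_, _, realizes_nil⟩
  | cons y z ihy ihz =>
    obtain ⟨p, T, hp⟩ := ihy
    obtain ⟨q, U, hq⟩ := ihz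
    exact ⟨_, _, fun x => (hp x).pair (hq x)⟩

@[fun_prop]
lemma PolyTime.const (b : β) : PolyTime fun _ : α => b := by
  obtain ⟨p, T, hp⟩ := exists_realizes_const (enc b)
  exact ⟨p, _, .const T, fun _ => hp _, .const _⟩

@[fun_prop]
lemma PolyTime.pair {f : α → β} {g : α → γ} (hf : PolyTime f) (hg : PolyTime g) :
    PolyTime fun x => (f x, g x) := by
  obtain ⟨p, T, hT, hp, hs⟩ := hf
  obtain ⟨q, U, hU, hq, hr⟩ := hg
  exact ⟨_, _, (hT.add hU).add (.const 30), fun x => (hp x).pair (hq x),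
    (hs.add hr).add (.const 1)⟩

@[fun_prop]
lemma PolyTime.fst {f : α → β × γ} (hf : PolyTime f) : PolyTime fun x => (f x).1 :=
  .comp (g := fun x : β × γ => x.1) (hg := ⟨_, _, .const 1, fun _ => realizes_fst _ _,
    PolyBound.esize.mono fun x => by
      have : esize x = esize x.1 + esize x.2 + 1 := rfl
      dsimp only; omega⟩) hf

@[fun_prop]
lemma PolyTime.snd {f : α → β × γ} (hf : PolyTime f) : PolyTime fun x => (f x).2 :=
  .comp (g := fun x : β × γ => x.2) (hg := ⟨_, _, .const 3, fun _ => realizes_snd _ _,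
    PolyBound.esize.mono fun x => by
      have : esize x = esize x.1 + esize x.2 + 1 := rfl
      dsimp only; omega⟩) hf

lemma enc_of {p : Prop} (h : p) : enc p = .cons .nil .nil := if_pos h

lemma enc_of_not {p : Prop} (h : ¬p) : enc p = .nil := if_neg h

@[fun_prop]
lemma PolyTime.ite {p : α → Prop} [∀ x, Decidable (p x)] {f g : α → β} (hp : PolyTime p)
    (hf : PolyTime f) (hg : PolyTime g) : PolyTime fun x => if p x then f x else g x := by
  obtain ⟨a, T, hT, ha, -⟩ := hp
  obtain ⟨b, U, hU, hb, hs⟩ := hf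
  obtain ⟨c, V, hV, hc, hr⟩ := hg
  refine ⟨condProg a b c, _, ((hT.add hU).add hV).add (.const 50), fun x => ?_,
    (hs.add hr).mono fun x => ?_⟩
  · have h1 := ha x
    by_cases h : p x
    · rw [enc_of h] at h1
      simp only [if_pos h]
      exact (h1.cond_cons (hb x)).mono (by omega)
    · rw [enc_of_not h] at h1
      simp only [if_neg h]
      exact (h1.cond_nil (hc x)).mono (by omega)
  · dsimp only; split_ifs <;> omega

/-- Case distinction on a list. -/
lemma PolyTime.listCases {l : α → List β} {f : α → γ} {g : α → β → List β → γ} (hl : PolyTime l)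
    (hf : PolyTime f) (hg : PolyTime fun x : α × (β × List β) => g x.1 x.2.1 x.2.2) :
    PolyTime fun x => (match l x with | [] => f x | b :: t => g x b t : γ) := by
  obtain ⟨a, T, hT, ha, hla⟩ := hl
  obtain ⟨b, U, hU, hb, hs⟩ := hf
  obtain ⟨c, V, ⟨k, hV⟩, hc, ⟨k', hr⟩⟩ := hg
  have key : PolyBound fun x => esize x + esize (l x) + 3 :=
    (PolyBound.esize.add hla).add (.const 3)
  refine ⟨condProg a (pairProg .skip a ;; c) b, _,
    ((hT.add hT).add (hU.add (key.pow k))).add (.const 100), fun x => ?_,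
    (hs.add (key.pow k')).mono fun x => ?_⟩
  · have h1 := ha x
    dsimp only
    cases hlx : l x with
    | nil =>
      rw [hlx] at h1
      exact (Realizes.cond_nil h1 (hb x)).mono (by omega)
    | cons d t =>
      have h2 := (realizes_skip (enc x)).pair h1
      rw [hlx] at h1 h2
      -- a nonempty list is encoded in the same way as the pair of its head and its tail
      have h3 := h2.seq (hc (x, (d, t)))
      have h4 := hV (x, (d, t))
      have h5 : esize (x, (d, t)) + 2 = esize x + esize (d :: t) + 3 := rfl
      rw [h5] at h4
      exact (Realizes.cond_cons h1 h3).mono (by omega)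
  · dsimp only
    cases hlx : l x with
    | nil => dsimp only; omega
    | cons d t =>
      have h4 := hr (x, (d, t))
      have h5 : esize (x, (d, t)) + 2 = esize x + esize (d :: t) + 3 := rfl
      rw [h5] at h4
      dsimp only at h4 ⊢; omega

@[fun_prop]
lemma PolyTime.tail {l : α → List β} (hl : PolyTime l) : PolyTime fun x => (l x).tail :=
  (hl.listCases (g := fun _ _ t => t) (.const []) (by fun_prop)).congr fun x => by
    cases l x <;> rfl

@[fun_prop]
lemma PolyTime.headD {l : α → List β} {d : α → β} (hl : PolyTime l) (hd : PolyTime d) :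
    PolyTime fun x => (l x).headD (d x) :=
  (hl.listCases (g := fun _ b _ => b) hd (by fun_prop)).congr fun x => by
    cases l x <;> rfl

@[fun_prop]
lemma PolyTime.eq_nil {l : α → List β} (hl : PolyTime l) : PolyTime fun x => l x = [] :=
  (hl.listCases (g := fun _ _ _ => False) (.const True) (.const _)).congr fun x => by
    cases l x <;> simp

@[fun_prop]
lemma PolyTime.cons {f : α → β} {l : α → List β} (hf : PolyTime f) (hl : PolyTime l) :
    PolyTime fun x => f x :: l x :=
  let ⟨p, T, h1, h2, h3⟩ := hf.pair hl; ⟨p, T, h1, h2, h3⟩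

/-- The loop over a list `l` that updates an accumulator with `p`; the argument is the triple of `l`, a
parameter and the initial value of the accumulator. -/
def foldProg (p : Prog) : Prog :=
  whileProg (pairProg (.load 2 2 ;; sndProg) (pairProg (sndProg ;; .load 2 2)
    (pairProg (sndProg ;; .load 2 2) (pairProg (sndProg ;; sndProg) (.load 2 2 ;; .load 2 2)) ;; p)))
  ;; sndProg ;; sndProg

/-- The left fold of `f` along a list, where `T` bounds the time of every single step. -/
lemma Realizes.foldl {p : Prog} {x : γ} {l : List α} {f : β → α → β} {b : β} {T : ℕ}
    (hp : ∀ l₁ a l₂, l = l₁ ++ a :: l₂ →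
      Realizes p (enc (x, (l₁.foldl f b, a))) (enc (f (l₁.foldl f b) a)) T) :
    Realizes (foldProg p) (enc (l, (x, b))) (enc (l.foldl f b)) (l.length * (T + 150) + 20) := by
  have h := realizes_whileProg (p := pairProg (.load 2 2 ;; sndProg) (pairProg (sndProg ;; .load 2 2)
    (pairProg (sndProg ;; .load 2 2) (pairProg (sndProg ;; sndProg) (.load 2 2 ;; .load 2 2)) ;; p)))
    (T := T + 140) l.length (fun i => enc (l.drop i)) (fun i => enc (x, (l.take i).foldl f b))
    ?_ ?_ ?_
  · simp only [List.drop_zero, List.take_zero, List.drop_length, List.take_length] at h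
    exact ((h.seq ((realizes_snd _ _).seq (realizes_snd _ _)))).mono (by ring_nf; omega)
  · intro i hi
    simp only [List.drop_eq_getElem_cons hi]
    exact SExp.noConfusion
  · simp only [List.drop_length]; rfl
  · intro i hi
    have h1 := hp (l.take i) l[i] (l.drop (i + 1)) (by
      rw [← List.drop_eq_getElem_cons hi, List.take_append_drop])
    have e1 : (l.take (i + 1)).foldl f b = f ((l.take i).foldl f b) l[i] := by
      rw [List.take_add_one, List.getElem?_eq_getElem hi, Option.toList_some, List.foldl_append]; rfl
    simp only [List.drop_eq_getElem_cons hi, e1]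
    refine Realizes.mono (((realizes_fst _ _).seq (realizes_snd _ _)).pair
      (((realizes_snd _ _).seq (realizes_fst _ _)).pair ((Realizes.pair
        ((realizes_snd _ _).seq (realizes_fst _ _)) (((realizes_snd _ _).seq (realizes_snd _ _)).pair
          ((realizes_fst _ _).seq (realizes_fst _ _)))).seq h1))) (by omega)

/-- A left fold is computed in polynomial time if its intermediate values have polynomial size. -/
lemma PolyTime.foldl {l : γ → List α} {b : γ → β} {f : γ → β → α → β} {B : γ → ℕ}
    (hl : PolyTime l) (hb : PolyTime b) (hf : PolyTime fun x : γ × (β × α) => f x.1 x.2.1 x.2.2)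
    (hB : PolyBound B)
    (hfB : ∀ x l₁ l₂, l x = l₁ ++ l₂ → esize (l₁.foldl (f x) (b x)) ≤ B x) :
    PolyTime fun x => (l x).foldl (f x) (b x) := by
  obtain ⟨pl, Tl, hTl, hpl, hsl⟩ := hl
  obtain ⟨pb, Tb, hTb, hpb, hsb⟩ := hb
  obtain ⟨p, T, ⟨c, hT⟩, hp, -⟩ := hf
  have key : PolyBound fun x => esize x + B x + esize (l x) + 4 :=
    ((PolyBound.esize.add hB).add hsl).add (.const 4)
  refine ⟨pairProg pl (pairProg .skip pb) ;; foldProg p, _,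
    ((hTl.add hTb).add (hsl.mul ((key.pow c).add (.const 150)))).add (.const 100), fun x => ?_,
    hB.mono fun x => hfB x (l x) [] (by simp)⟩
  have h1 : ∀ l₁ a l₂, l x = l₁ ++ a :: l₂ →
      Realizes p (enc (x, (l₁.foldl (f x) (b x), a))) (enc (f x (l₁.foldl (f x) (b x)) a))
        ((esize x + B x + esize (l x) + 4) ^ c) := by
    intro l₁ a l₂ h
    refine (hp (x, (l₁.foldl (f x) (b x), a))).mono ((hT _).trans (Nat.pow_le_pow_left ?_ c))
    have h2 := hfB x l₁ (a :: l₂) h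
    have h3 : esize a ≤ esize (l x) := esize_le_of_mem (by simp [h])
    rw [esize_pair, esize_pair]
    omega
  refine Realizes.mono (Realizes.seq ((hpl x).pair ((realizes_skip (enc x)).pair (hpb x)))
    (Realizes.foldl (x := x) h1)) ?_
  have := Nat.mul_le_mul_right ((esize x + B x + esize (l x) + 4) ^ c + 150)
    (length_le_esize (l x))
  omega

@[fun_prop]
lemma PolyTime.reverse {l : γ → List α} (hl : PolyTime l) : PolyTime fun x => (l x).reverse :=
  (hl.foldl (f := fun _ acc a => a :: acc) (.const []) (by fun_prop) hl.polyBound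
    fun x l₁ l₂ h => by
      rw [List.foldl_flip_cons_eq_append', List.append_nil, esize_reverse, h]
      exact esize_sublist (List.sublist_append_left _ _)).congr fun x => by simp

/-- A right fold is computed in polynomial time if its intermediate values have polynomial size. -/
lemma PolyTime.foldr {l : γ → List α} {b : γ → β} {f : γ → α → β → β} {B : γ → ℕ}
    (hl : PolyTime l) (hb : PolyTime b) (hf : PolyTime fun x : γ × (α × β) => f x.1 x.2.1 x.2.2)
    (hB : PolyBound B)
    (hfB : ∀ x l₁ l₂, l x = l₁ ++ l₂ → esize (l₂.foldr (f x) (b x)) ≤ B x) :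
    PolyTime fun x => (l x).foldr (f x) (b x) :=
  (hl.reverse.foldl (f := fun x b a => f x a b) hb
    (hf.comp (f := fun x : γ × (β × α) => (x.1, (x.2.2, x.2.1))) (by fun_prop)) hB
    fun x l₁ l₂ h => by
      have := hfB x l₂.reverse l₁.reverse (by
        rw [← List.reverse_append, ← h, List.reverse_reverse])
      rwa [List.foldr_reverse] at this).congr fun x => by
    rw [List.foldl_reverse]

@[fun_prop]
lemma PolyTime.append {l l' : γ → List α} (hl : PolyTime l) (hl' : PolyTime l') :
    PolyTime fun x => l x ++ l' x :=
  (hl.foldr (f := fun _ a acc => a :: acc) hl' (by fun_prop) (hl.polyBound.add hl'.polyBound)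
    fun x l₁ l₂ h => by
      rw [List.foldr_cons_eq_append, List.map_id']
      have h1 := esize_append l₂ (l' x)
      have h2 : esize l₂ ≤ esize (l x) := h ▸ esize_sublist (List.sublist_append_right _ _)
      omega).congr fun x => by rw [List.foldr_cons_eq_append, List.map_id']

@[fun_prop]
lemma PolyTime.map {l : γ → List α} {f : γ → α → β} (hl : PolyTime l)
    (hf : PolyTime fun x : γ × α => f x.1 x.2) : PolyTime fun x => (l x).map fun a => f x a := by
  obtain ⟨c, hc⟩ := hf.polyBound
  have key : PolyBound fun x => esize x + esize (l x) + 3 :=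
    (PolyBound.esize.add hl.polyBound).add (.const 3)
  refine (hl.foldr (f := fun x a acc => f x a :: acc) (.const [])
    (B := fun x => esize (l x) * ((esize x + esize (l x) + 3) ^ c + 1) + 1) ?_
    ((hl.polyBound.mul ((key.pow c).add (.const 1))).add (.const 1)) ?_).congr fun x => by
      rw [← List.map_eq_foldr]
  · exact (hf.comp (f := fun x : γ × (α × List β) => (x.1, x.2.1)) (by fun_prop)).cons
      (by fun_prop)
  · intro x l₁ l₂ h
    rw [← List.map_eq_foldr]
    refine (esize_list_le (B := (esize x + esize (l x) + 3) ^ c) ?_).trans ?_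
    · intro b hb
      obtain ⟨a, ha, rfl⟩ := List.mem_map.1 hb
      refine (hc (x, a)).trans (Nat.pow_le_pow_left ?_ c)
      have : esize a ≤ esize (l x) := esize_le_of_mem (by simp [h, ha])
      rw [esize_pair]; omega
    · have h1 : l₂.length ≤ esize (l x) := by
        refine le_trans ?_ (length_le_esize _); simp [h]
      rw [List.length_map]
      have := Nat.mul_le_mul_right ((esize x + esize (l x) + 3) ^ c + 1) h1
      omega

@[fun_prop]
lemma PolyTime.flatten {l : γ → List (List α)} (hl : PolyTime l) :
    PolyTime fun x => (l x).flatten := by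
  have aux : ∀ l : List (List α), esize l.flatten ≤ esize l := by
    intro l
    induction l with
    | nil => exact le_rfl
    | cons a l ih =>
      have := esize_append a l.flatten
      rw [List.flatten_cons, esize_cons]; omega
  have aux2 : ∀ l : List (List α), l.foldr (fun a acc => a ++ acc) [] = l.flatten := by
    intro l
    induction l with
    | nil => rfl
    | cons a l ih => rw [List.foldr_cons, ih, List.flatten_cons]
  exact (hl.foldr (f := fun _ a acc => a ++ acc) (.const []) (by fun_prop) hl.polyBound
    fun x l₁ l₂ h => by
      rw [aux2, h]
      exact (aux l₂).trans (esize_sublist (List.sublist_append_right _ _))).congr fun x => aux2 _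

@[fun_prop]
lemma PolyTime.flatMap {l : γ → List α} {f : γ → α → List β} (hl : PolyTime l)
    (hf : PolyTime fun x : γ × α => f x.1 x.2) :
    PolyTime fun x => (l x).flatMap fun a => f x a :=
  (hl.map hf).flatten.congr fun x => by rw [List.flatMap_def]

@[fun_prop]
lemma PolyTime.filter {l : γ → List α} {p : γ → α → Prop} [∀ x a, Decidable (p x a)]
    (hl : PolyTime l) (hp : PolyTime fun x : γ × α => p x.1 x.2) :
    PolyTime fun x => (l x).filter fun a => p x a := by
  have : PolyTime fun x : γ × α => if p x.1 x.2 then [x.2] else [] :=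
    hp.ite (by fun_prop) (by fun_prop)
  exact (hl.flatMap (f := fun x a => if p x a then [a] else []) this).congr fun x => by
    induction l x with
    | nil => rfl
    | cons a l ih =>
      rw [List.flatMap_cons, ih, List.filter_cons]
      by_cases h : p x a <;> simp [h]

@[fun_prop]
lemma PolyTime.and {p q : α → Prop} (hp : PolyTime p) (hq : PolyTime q) :
    PolyTime fun x => p x ∧ q x := by
  classical
  exact (hp.ite hq (.const False)).congr fun x => by by_cases h : p x <;> simp [h]

@[fun_prop]
lemma PolyTime.not {p : α → Prop} (hp : PolyTime p) : PolyTime fun x => ¬p x := by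
  classical
  exact (hp.ite (.const False) (.const True)).congr fun x => by by_cases h : p x <;> simp [h]

@[fun_prop]
lemma PolyTime.or {p q : α → Prop} (hp : PolyTime p) (hq : PolyTime q) :
    PolyTime fun x => p x ∨ q x := by
  classical
  exact (hp.ite (.const True) hq).congr fun x => by by_cases h : p x <;> simp [h]

@[fun_prop]
lemma PolyTime.imp {p q : α → Prop} (hp : PolyTime p) (hq : PolyTime q) :
    PolyTime fun x => p x → q x := by
  classical
  exact (hp.ite hq (.const True)).congr fun x => by by_cases h : p x <;> simp [h]

@[fun_prop]
lemma PolyTime.iff {p q : α → Prop} (hp : PolyTime p) (hq : PolyTime q) :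
    PolyTime fun x => (p x ↔ q x) := by
  classical
  exact (hp.ite hq hq.not).congr fun x => by by_cases h : p x <;> simp [h]

@[fun_prop]
lemma PolyTime.bex {l : γ → List α} {p : γ → α → Prop} (hl : PolyTime l)
    (hp : PolyTime fun x : γ × α => p x.1 x.2) : PolyTime fun x => ∃ a ∈ l x, p x a := by
  classical
  exact (hl.filter hp).eq_nil.not.congr fun x => by simp

@[fun_prop]
lemma PolyTime.ball {l : γ → List α} {p : γ → α → Prop} (hl : PolyTime l)
    (hp : PolyTime fun x : γ × α => p x.1 x.2) : PolyTime fun x => ∀ a ∈ l x, p x a := by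
  classical
  exact (hl.filter (p := fun x a => ¬p x a) hp.not).eq_nil.congr fun x => by simp

/-- Natural numbers are encoded like lists without information. -/
@[fun_prop]
lemma PolyTime.replicate {f : α → ℕ} (hf : PolyTime f) :
    PolyTime fun x => List.replicate (f x) () :=
  let ⟨p, T, h1, h2, h3⟩ := hf; ⟨p, T, h1, h2, h3⟩

lemma PolyTime.length_unit {f : α → List Unit} (hf : PolyTime f) :
    PolyTime fun x => (f x).length := by
  have : ∀ l : List Unit, enc l.length = enc l := fun l =>
    congrArg (enc (α := List Unit)) (List.eq_replicate_iff.2 ⟨rfl, fun _ _ => rfl⟩).symm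
  obtain ⟨p, T, h1, h2, h3⟩ := hf
  refine ⟨p, T, h1, fun x => ?_, ?_⟩
  · rw [this]; exact h2 x
  · simpa only [esize, this] using h3

@[fun_prop]
lemma PolyTime.length {l : γ → List α} (hl : PolyTime l) : PolyTime fun x => (l x).length :=
  (hl.map (f := fun _ _ => ()) (.const ())).length_unit.congr fun x => by simp

@[fun_prop]
lemma PolyTime.add {f g : α → ℕ} (hf : PolyTime f) (hg : PolyTime g) :
    PolyTime fun x => f x + g x :=
  (hf.replicate.append hg.replicate).length_unit.congr fun x => by simp

/-- Iteration is computed in polynomial time if the intermediate values have polynomial size. -/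
lemma PolyTime.iterate {n : γ → ℕ} {b : γ → β} {f : γ → β → β} {B : γ → ℕ}
    (hn : PolyTime n) (hb : PolyTime b) (hf : PolyTime fun x : γ × β => f x.1 x.2)
    (hB : PolyBound B) (hfB : ∀ x, ∀ i ≤ n x, esize ((f x)^[i] (b x)) ≤ B x) :
    PolyTime fun x => (f x)^[n x] (b x) := by
  have aux : ∀ x (l : List Unit) b, l.foldl (fun acc _ => f x acc) b = (f x)^[l.length] b := by
    intro x l
    induction l with
    | nil => intro b; rfl
    | cons a l ih => intro b; rw [List.foldl_cons, ih, List.length_cons, Function.iterate_succ_apply]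
  refine (hn.replicate.foldl (f := fun x acc _ => f x acc) hb
    (hf.comp (f := fun x : γ × (β × Unit) => (x.1, x.2.1)) (by fun_prop)) hB ?_).congr fun x => by
      rw [aux, List.length_replicate]
  intro x l₁ l₂ h
  rw [aux]
  apply hfB
  have := congrArg List.length h
  simp at this; omega

@[fun_prop]
lemma PolyTime.drop {n : γ → ℕ} {l : γ → List α} (hn : PolyTime n) (hl : PolyTime l) :
    PolyTime fun x => (l x).drop (n x) := by
  have aux : ∀ i (l : List α), List.tail^[i] l = l.drop i := by
    intro i
    induction i with
    | zero => intro l; rfl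
    | succ i ih => intro l; rw [Function.iterate_succ_apply, ih, List.drop_tail]
  exact (hn.iterate (f := fun _ => List.tail) hl (by fun_prop) hl.polyBound fun x i _ => by
    rw [aux]; exact esize_sublist (List.drop_sublist _ _)).congr fun x => aux _ _

@[fun_prop]
lemma PolyTime.take {n : γ → ℕ} {l : γ → List α} (hn : PolyTime n) (hl : PolyTime l) :
    PolyTime fun x => (l x).take (n x) :=
  (((hn.drop hl).length.drop hl.reverse).reverse).congr fun x => by
    rw [List.length_drop, List.reverse_drop, List.reverse_reverse, List.length_reverse]
    rcases le_total (n x) (l x).length with h | h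
    · congr 1; omega
    · rw [List.take_of_length_le h, List.take_of_length_le (by omega)]

@[fun_prop]
lemma PolyTime.le {f g : α → ℕ} (hf : PolyTime f) (hg : PolyTime g) :
    PolyTime fun x => f x ≤ g x :=
  (hg.drop hf.replicate).eq_nil.congr fun x => by simp [Nat.sub_eq_zero_iff_le]

@[fun_prop]
lemma PolyTime.lt {f g : α → ℕ} (hf : PolyTime f) (hg : PolyTime g) :
    PolyTime fun x => f x < g x :=
  (hg.le hf).not.congr fun x => by simp

@[fun_prop]
lemma PolyTime.mul {f g : α → ℕ} (hf : PolyTime f) (hg : PolyTime g) :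
    PolyTime fun x => f x * g x :=
  (hf.replicate.flatMap (f := fun x _ => List.replicate (g x) ())
    (hg.comp (.fst .id)).replicate).length_unit.congr fun x => by simp [List.length_flatMap]

@[fun_prop]
lemma PolyTime.pow {f : α → ℕ} (hf : PolyTime f) (k : ℕ) : PolyTime fun x => f x ^ k := by
  induction k with
  | zero => simpa using PolyTime.const 1
  | succ k ih => simpa only [pow_succ] using ih.mul hf

@[fun_prop]
lemma PolyTime.range {f : α → ℕ} (hf : PolyTime f) : PolyTime fun x => List.range (f x) := by
  have aux : ∀ i, (fun l : List ℕ => l ++ [l.length])^[i] [] = List.range i := by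
    intro i
    induction i with
    | zero => rfl
    | succ i ih => rw [Function.iterate_succ_apply', ih, List.range_succ, List.length_range]
  refine (hf.iterate (f := fun _ l => l ++ [l.length]) (.const []) (by fun_prop)
    (B := fun x => esize (f x) * (esize (f x) + 1) + 1)
    ((hf.polyBound.mul (hf.polyBound.add (.const 1))).add (.const 1)) ?_).congr fun x => aux _
  intro x i hi
  rw [aux]
  refine (esize_list_le (B := esize (f x)) fun a ha => ?_).trans ?_
  · rw [List.mem_range] at ha
    rw [esize_nat, esize_nat]; omega
  · rw [List.length_range]
    have := Nat.mul_le_mul_right (esize (f x) + 1) (hi.trans (by rw [esize_nat]; omega : f x ≤ esize (f x)))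
    omega

/-- Equality of elements of `α` is decided in polynomial time. -/
class PolyEq (α : Type) [Enc α] : Prop where
  eq : PolyTime fun x : α × α => x.1 = x.2

@[fun_prop]
lemma PolyTime.eq [PolyEq β] {f g : α → β} (hf : PolyTime f) (hg : PolyTime g) :
    PolyTime fun x => f x = g x :=
  PolyEq.eq.comp (hf.pair hg)

instance : PolyEq ℕ := ⟨by simp only [le_antisymm_iff]; fun_prop⟩

@[fun_prop]
lemma PolyTime.mem [PolyEq β] {f : α → β} {l : α → List β} (hf : PolyTime f) (hl : PolyTime l) :
    PolyTime fun x => f x ∈ l x :=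
  (hl.bex (p := fun x a => f x = a) (by fun_prop)).congr fun x => by simp

instance [PolyEq α] : PolyEq (List α) := by
  classical
  -- the first list is compared element by element with what remains of the second one
  have aux : ∀ (l₁ l : List α) (P : Prop),
      l₁.foldl (fun (s : List α × Prop) a => (s.1.tail, s.2 ∧ s.1 ≠ [] ∧ s.1.headD a = a)) (l, P) =
        (l.drop l₁.length, P ∧ l₁ <+: l) := by
    intro l₁
    induction l₁ with
    | nil => simp
    | cons a l₁ ih =>
      intro l P
      rw [List.foldl_cons, ih]
      cases l with
      | nil => simp
      | cons b l => simp [List.cons_prefix_cons, eq_comm, and_assoc]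
  have h : PolyTime fun x : List α × List α => x.1.foldl (fun (s : List α × Prop) a =>
      (s.1.tail, s.2 ∧ s.1 ≠ [] ∧ s.1.headD a = a)) (x.2, True) := by
    refine PolyTime.foldl (B := fun x => esize x + 10) (f := fun _ (s : List α × Prop) a =>
      (s.1.tail, s.2 ∧ s.1 ≠ [] ∧ s.1.headD a = a)) (by fun_prop) (by fun_prop) (by fun_prop)
      (PolyBound.esize.add (.const 10)) ?_
    intro x l₁ l₂ _
    rw [aux, esize_pair]
    have h1 : esize (x.2.drop l₁.length) ≤ esize x.2 := esize_sublist (List.drop_sublist _ _)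
    have h2 := esize_prop (True ∧ l₁ <+: x.2)
    have h3 : esize x = esize x.1 + esize x.2 + 1 := rfl
    omega
  refine ⟨(h.snd.and h.fst.eq_nil).congr fun x => ?_⟩
  rw [aux]
  simp only [true_and, List.drop_eq_nil_iff, eq_iff_iff]
  exact ⟨fun ⟨h1, h2⟩ => h1.eq_of_length_le h2, fun h => h ▸ ⟨List.prefix_rfl, le_rfl⟩⟩

end PolyTime

/-! ### Two generic search procedures -/

section Search

variable {α β γ σ : Type}

/-- The leaves of the branching process of depth `T` started in `s`, where `B` lists the children. In
every level only the first `fuel` nodes are kept. -/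
def grow (B : σ → List σ) (fuel T : ℕ) (s : σ) : List σ :=
  (fun L => (L.flatMap B).take fuel)^[T] [s]

open Classical in
/-- A sublist of `l`, chosen greedily, without two elements in the relation `R`. -/
noncomputable def greedy (R : α → α → Prop) (l : List α) : List α :=
  l.foldl (fun acc a => if ∃ b ∈ acc, R b a then acc else a :: acc) []

lemma grow_invariant {B : σ → List σ} {fuel : ℕ} {s : σ} (I : ℕ → σ → Prop) :
    ∀ T, I 0 s → (∀ i < T, ∀ a, I i a → ∀ b ∈ B a, I (i + 1) b) → ∀ a ∈ grow B fuel T s, I T a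
  | 0, h0, _, a, ha => by
    rw [grow, Function.iterate_zero, id, List.mem_singleton] at ha
    exact ha ▸ h0
  | T + 1, h0, hI, a, ha => by
    rw [grow, Function.iterate_succ_apply'] at ha
    obtain ⟨b, hb, hab⟩ := List.mem_flatMap.1 (List.mem_of_mem_take ha)
    exact hI T (by omega) b
      (grow_invariant I T h0 (fun i hi => hI i (by omega)) b hb) a hab

lemma length_grow_le (B : σ → List σ) (fuel T : ℕ) (s : σ) :
    (grow B fuel T s).length ≤ fuel + 1 := by
  cases T with
  | zero => simp [grow]
  | succ T =>
    rw [grow, Function.iterate_succ_apply']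
    exact (List.length_take_le _ _).trans (by omega)

/-- If every node has at most `L` children and `L ^ T ≤ fuel`, then no node is discarded, and a path of
good nodes leads to a good leaf. -/
lemma exists_mem_grow {B : σ → List σ} {fuel L : ℕ} {s : σ} (I : σ → Prop) (good : ℕ → σ → Prop)
    (hs : I s) (hI : ∀ a, I a → ∀ b ∈ B a, I b) (hB : ∀ a, I a → (B a).length ≤ L)
    (h0 : good 0 s) (hL : 1 ≤ L) :
    ∀ T, L ^ T ≤ fuel → (∀ i < T, ∀ a, I a → good i a → ∃ b ∈ B a, good (i + 1) b) →
      ∃ a ∈ grow B fuel T s, good T a := by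
  have key : ∀ T, L ^ T ≤ fuel → (∀ i < T, ∀ a, I a → good i a → ∃ b ∈ B a, good (i + 1) b) →
      (grow B fuel T s).length ≤ L ^ T ∧ (∀ a ∈ grow B fuel T s, I a) ∧
        ∃ a ∈ grow B fuel T s, good T a := by
    intro T
    induction T with
    | zero => intro _ _; simp [grow, hs, h0]
    | succ T ih =>
      intro hT hgood
      have hT' : L ^ T ≤ fuel := (Nat.pow_le_pow_right hL (by omega)).trans hT
      obtain ⟨h1, h2, a, ha, ha'⟩ := ih hT' fun i hi => hgood i (by omega)
      have h3 : ((grow B fuel T s).flatMap B).length ≤ L ^ (T + 1) := by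
        rw [List.length_flatMap, pow_succ]
        refine (List.sum_le_card_nsmul _ L ?_).trans ?_
        · intro x hx
          obtain ⟨b, hb, rfl⟩ := List.mem_map.1 hx
          exact hB b (h2 b hb)
        · rw [List.length_map, smul_eq_mul]; exact Nat.mul_le_mul_right L h1
      have h4 : grow B fuel (T + 1) s = (grow B fuel T s).flatMap B := by
        rw [grow, Function.iterate_succ_apply']
        exact List.take_of_length_le (h3.trans hT)
      rw [h4]
      refine ⟨h3, fun b hb => ?_, ?_⟩
      · obtain ⟨a, ha, hab⟩ := List.mem_flatMap.1 hb
        exact hI a (h2 a ha) b hab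
      · obtain ⟨b, hb, hb'⟩ := hgood T (by omega) a (h2 a ha) ha'
        exact ⟨b, List.mem_flatMap.2 ⟨a, ha, hb⟩, hb'⟩
  exact fun T h1 h2 => (key T h1 h2).2.2

/-- The greedy choice is a sublist without two elements in the relation `R`, and every element of `l`
that is not chosen is in the relation `R` to a chosen one. -/
lemma greedy_spec (R : α → α → Prop) (l : List α) :
    (greedy R l).reverse.Sublist l ∧ (greedy R l).reverse.Pairwise (fun a b => ¬R a b) ∧
      ∀ a ∈ l, a ∈ greedy R l ∨ ∃ b ∈ greedy R l, R b a := by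
  induction l using List.reverseRecOn with
  | nil => simp [greedy]
  | append_singleton l a ih =>
    obtain ⟨h1, h2, h3⟩ := ih
    by_cases h : ∃ b ∈ greedy R l, R b a
    · have e : greedy R (l ++ [a]) = greedy R l := by
        rw [greedy, List.foldl_append, List.foldl_cons, List.foldl_nil]
        exact if_pos h
      rw [e]
      refine ⟨h1.trans (List.sublist_append_left _ _), h2, fun b hb => ?_⟩
      rcases List.mem_append.1 hb with hb | hb
      · exact h3 b hb
      · rw [List.mem_singleton] at hb; exact .inr (hb ▸ h)
    · have e : greedy R (l ++ [a]) = a :: greedy R l := by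
        rw [greedy, List.foldl_append, List.foldl_cons, List.foldl_nil]
        exact if_neg h
      rw [e]
      refine ⟨?_, ?_, fun b hb => ?_⟩
      · rw [List.reverse_cons]; exact h1.append_right [a]
      · rw [List.reverse_cons, List.pairwise_append]
        refine ⟨h2, by simp, fun b hb c hc => ?_⟩
        rw [List.mem_singleton] at hc
        exact fun hR => h ⟨b, by simpa using hb, hc ▸ hR⟩
      · rcases List.mem_append.1 hb with hb | hb
        · rcases h3 b hb with h4 | ⟨d, h4, h5⟩
          · exact .inl (List.mem_cons_of_mem _ h4)
          · exact .inr ⟨d, List.mem_cons_of_mem _ h4, h5⟩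
        · rw [List.mem_singleton] at hb; exact .inl (hb ▸ List.mem_cons_self)

lemma mem_of_mem_greedy {R : α → α → Prop} {l : List α} {a : α} (h : a ∈ greedy R l) : a ∈ l :=
  (greedy_spec R l).1.subset (List.mem_reverse.2 h)

lemma length_greedy_le (R : α → α → Prop) (l : List α) : (greedy R l).length ≤ l.length := by
  simpa using (greedy_spec R l).1.length_le

variable [Enc α] [Enc β] [Enc γ] [Enc σ]

@[fun_prop]
lemma PolyTime.greedy {R : γ → α → α → Prop} {l : γ → List α} (hl : PolyTime l)
    (hR : PolyTime fun x : γ × (α × α) => R x.1 x.2.1 x.2.2) :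
    PolyTime fun x => greedy (R x) (l x) := by
  classical
  refine (hl.foldl (f := fun x acc a => if ∃ b ∈ acc, R x b a then acc else a :: acc)
    (.const []) ?_ hl.polyBound ?_)
  · have : PolyTime fun x : (γ × (List α × α)) × α => R x.1.1 x.2 x.1.2.2 :=
      hR.comp (f := fun x : (γ × (List α × α)) × α => (x.1.1, (x.2, x.1.2.2))) (by fun_prop)
    fun_prop
  · intro x l₁ l₂ h
    have h1 := esize_sublist (greedy_spec (R x) l₁).1
    rw [esize_reverse] at h1
    refine le_trans (le_of_eq ?_) (h1.trans (h ▸ esize_sublist (List.sublist_append_left _ _)))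
    rw [_root_.greedy]

/-- The branching process is computed in polynomial time if the nodes have polynomial size. -/
lemma PolyTime.grow {B : γ → σ → List σ} {fuel T : γ → ℕ} {s : γ → σ} {S : γ → ℕ}
    (hB : PolyTime fun x : γ × σ => B x.1 x.2) (hfuel : PolyTime fuel) (hT : PolyTime T)
    (hs : PolyTime s) (hS : PolyBound S) (I : γ → ℕ → σ → Prop) (h0 : ∀ x, I x 0 (s x))
    (hI : ∀ x, ∀ i < T x, ∀ a, I x i a → ∀ b ∈ B x a, I x (i + 1) b)
    (hIS : ∀ x, ∀ i ≤ T x, ∀ a, I x i a → esize a ≤ S x) :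
    PolyTime fun x => grow (B x) (fuel x) (T x) (s x) := by
  refine hT.iterate (f := fun x (L : List σ) => (L.flatMap (B x)).take (fuel x))
    (B := fun x => (esize (fuel x) + 1) * (S x + 1) + 1) (hs.cons (.const [])) ?_
    (((hfuel.polyBound.add (.const 1)).mul (hS.add (.const 1))).add (.const 1)) ?_
  · have : PolyTime fun x : (γ × List σ) × σ => B x.1.1 x.2 :=
      hB.comp (f := fun x : (γ × List σ) × σ => (x.1.1, x.2)) (by fun_prop)
    fun_prop
  · intro x i hi
    refine (esize_list_le (B := S x) fun a ha => hIS x i hi a ?_).trans ?_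
    · exact grow_invariant (I x) i (h0 x) (fun j hj => hI x j (by omega)) a ha
    · have h1 := length_grow_le (B x) (fuel x) i (s x)
      have h2 : fuel x ≤ esize (fuel x) := by rw [esize_nat]; omega
      have := Nat.mul_le_mul_right (S x + 1) (h1.trans (Nat.add_le_add_right h2 1))
      rw [_root_.grow] at this
      omega

end Search

/-! ### The algorithm -/

/-- An instance `(G, k)` of the problem together with the parameters of the algorithm. -/
structure Inst where
  /-- the number of vertices; the vertices are `0, …, n - 1` -/
  n : ℕ
  /-- the budget -/
  k : ℕ
  /-- the adjacency matrix, row by row -/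
  bits : List Prop
  /-- the size from which on cliques and packings are branched on -/
  τ : ℕ
  /-- the size of separators -/
  s : ℕ
  /-- the number of rounds in which parts of the core are split -/
  R : ℕ
  /-- the depth of the branching on large cliques -/
  T₁ : ℕ
  /-- the depth of the branching on large packings -/
  T₂ : ℕ
  /-- the bound on the number of objects of any kind that are stored -/
  fuel : ℕ

/-- A node of the branching on large packings. -/
structure Node where
  /-- the number of rounds since the last branch -/
  stage : ℕ
  /-- the cliques that the solution is assumed to hit -/
  hit : List (List ℕ)
  /-- disjoint cliques that the solution is assumed to hit -/
  pack : List (List ℕ)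
  /-- the vertices among which the solution will be sought -/
  core : List ℕ

noncomputable instance : Enc Inst :=
  ⟨fun c => enc (c.n, c.k, c.bits, c.τ, c.s, c.R, c.T₁, c.T₂, c.fuel)⟩

instance : Enc Node := ⟨fun x => enc (x.stage, x.hit, x.pack, x.core)⟩

section Algorithm

/-- Two lists have an element in common. -/
def Meets (a b : List ℕ) : Prop := ∃ v ∈ a, v ∈ b

open Classical in
/-- The increasing lists with at most `j` elements, all from `l`. -/
noncomputable def incr (l : List ℕ) : ℕ → List (List ℕ)
  | 0 => [[]]
  | j + 1 => [] :: l.flatMap fun v => ((incr l j).filter fun t => ∀ u ∈ t, v < u).map (v :: ·)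

/-- Adjacency of two vertices. -/
def Inst.Adj (c : Inst) (u v : ℕ) : Prop := (c.bits.drop (u * c.n + v)).headD False

/-- The elements of `t` are pairwise adjacent. -/
def Inst.Clique (c : Inst) (t : List ℕ) : Prop := ∀ u ∈ t, ∀ v ∈ t, u = v ∨ c.Adj u v

/-- The sets of at most `r` vertices. -/
noncomputable def Inst.sets (r : ℕ) (c : Inst) : List (List ℕ) := incr (List.range c.n) r

open Classical in
/-- The cliques on `r` vertices that avoid `Z`. -/
noncomputable def Inst.targets (r : ℕ) (c : Inst) (Z : List ℕ) : List (List ℕ) :=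
  (c.sets r).filter fun t => t.length = r ∧ c.Clique t ∧ ∀ v ∈ t, v ∉ Z

/-- A maximal packing of cliques on `r` vertices in the complement of `Z`. -/
noncomputable def Inst.packing (r : ℕ) (c : Inst) (Z : List ℕ) : List (List ℕ) :=
  greedy Meets (c.targets r Z)

open Classical in
/-- The cliques on `τ` vertices in `V`. -/
noncomputable def Inst.bigCliques (c : Inst) (V : List ℕ) : List (List ℕ) :=
  grow (fun t => (V.filter fun v => ∀ u ∈ t, c.Adj v u).map (· :: t)) c.fuel c.τ []

open Classical in
/-- Branching on a large clique `q`: a solution contains all but at most `r - 1` of its vertices. -/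
noncomputable def Inst.branchClique (r : ℕ) (Z q : List ℕ) : List (List ℕ) :=
  (incr q (r - 1)).map fun X => Z ++ q.filter (· ∉ X)

open Classical in
/-- The children of the node `Z` in the branching on large cliques, where `Z` is the set of vertices
that have been put into the solution. -/
noncomputable def Inst.step₁ (r : ℕ) (c : Inst) (Z : List ℕ) : List (List ℕ) :=
  if c.k < (c.packing r Z).length then [] else
    if c.bigCliques (c.packing r Z).flatten = [] then [Z] else
      branchClique r Z ((c.bigCliques (c.packing r Z).flatten).headD [])

/-- The leaves of the branching on large cliques. -/
noncomputable def Inst.phase₁ (r : ℕ) (c : Inst) : List (List ℕ) :=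
  grow (c.step₁ r) c.fuel c.T₁ []

open Classical in
/-- The petals of `X`: the sets `t \ M` for those cliques `t ⊈ M` that have to be hit and satisfy
`t ∩ M = X`. -/
noncomputable def petals (H : List (List ℕ)) (M X : List ℕ) : List (List ℕ) :=
  (H.filter fun t => t.filter (· ∈ M) = X ∧ ∃ v ∈ t, v ∉ M).map fun t => t.filter (· ∉ M)

/-- A maximal packing of petals of `X`. -/
noncomputable def petalPacking (H : List (List ℕ)) (M X : List ℕ) : List (List ℕ) :=
  greedy Meets (petals H M X)

open Classical in
/-- The child of a node in which `X` is assumed not to be hit; then all petals of `X` are. -/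
noncomputable def Inst.child (r : ℕ) (c : Inst) (x : Node) (X : List ℕ) : Node where
  stage := 0
  hit := (c.sets r).filter fun Y => Y ∈ x.hit ∨ Y ∈ petals x.hit x.core X
  pack := x.pack ++ petalPacking x.hit x.core X
  core := (List.range c.n).filter fun v =>
    ∃ Y ∈ x.pack ++ petalPacking x.hit x.core X, v ∈ Y

open Classical in
/-- The child of a node in which all sets with a large petal packing are assumed to be hit. The
vertices of all small petal packings are added to the core. -/
noncomputable def Inst.next (r : ℕ) (c : Inst) (x : Node) : Node where
  stage := x.stage + 1
  hit := (c.sets r).filter fun Y =>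
    Y ∈ x.hit ∨ c.τ < (petalPacking x.hit x.core Y).length
  pack := x.pack
  core := (List.range c.n).filter fun v => v ∈ x.core ∨
    ∃ X ∈ c.sets r, (petalPacking x.hit x.core X).length ≤ c.τ ∧
      ∃ Y ∈ petalPacking x.hit x.core X, v ∈ Y

open Classical in
/-- The children of a node in the branching on large packings. -/
noncomputable def Inst.step₂ (r : ℕ) (c : Inst) (x : Node) : List Node :=
  if r ≤ x.stage then [x] else
    c.next r x :: ((c.sets r).filter fun X =>
      c.τ < (petalPacking x.hit x.core X).length ∧
        x.pack.length + (petalPacking x.hit x.core X).length ≤ c.k).map fun X => c.child r x X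

/-- The root of the branching on large packings. -/
noncomputable def Inst.root (r : ℕ) (c : Inst) (Z : List ℕ) : Node := ⟨0, c.targets r Z, [], []⟩

/-- The leaves of the branching on large packings. -/
noncomputable def Inst.phase₂ (r : ℕ) (c : Inst) (Z : List ℕ) : List Node :=
  grow (c.step₂ r) c.fuel c.T₂ (c.root r Z)

/-- The candidates for separators: the words of length `s` over `M`. -/
def Inst.words (c : Inst) (M : List ℕ) : List (List ℕ) :=
  grow (fun t => M.map (· :: t)) c.fuel c.s []

open Classical in
/-- The component of `v` in the graph induced by `W`. -/
noncomputable def Inst.component (c : Inst) (W : List ℕ) (v : ℕ) : List ℕ :=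
  (fun A => W.filter fun u => u ∈ A ∨ ∃ a ∈ A, c.Adj a u)^[W.length] [v]

/-- The components of the graph induced by `W`. -/
noncomputable def Inst.components (c : Inst) (W : List ℕ) : List (List ℕ) :=
  greedy (· = ·) (W.map (c.component W))

open Classical in
/-- The components that remain of `U` without `S` contain at most half of the vertices of `U`. -/
def Inst.Balanced (c : Inst) (U S : List ℕ) : Prop :=
  ∀ K ∈ c.components (U.filter (· ∉ S)), 2 * K.length ≤ U.length

open Classical in
/-- The part `U`, split into the elements of `S` and the components that remain. -/
noncomputable def Inst.pieces (c : Inst) (U S : List ℕ) : List (List ℕ) :=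
  (U.filter (· ∈ S)).map ([·]) ++ c.components (U.filter (· ∉ S))

open Classical in
/-- Splits the part `U` along the first balanced separator in the list `Λ`. -/
noncomputable def Inst.split (c : Inst) (Λ : List (List ℕ)) (U : List ℕ) : List (List ℕ) :=
  if U = [] then [] else
    if U.length ≤ 1 ∨ Λ.filter (c.Balanced U) = [] then [U] else
      c.pieces U ((Λ.filter (c.Balanced U)).headD [])

/-- A linear order of `M` in which, for every initial segment, only few vertices have neighbours
outside. -/
noncomputable def Inst.order (c : Inst) (M : List ℕ) : List ℕ :=
  (grow (c.split (c.words M)) c.fuel c.R M).flatten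

/-- `D` hits all sets in `H` that consist of processed vertices. -/
def Ok (H : List (List ℕ)) (done D : List ℕ) : Prop :=
  ∀ t ∈ H, (∀ u ∈ t, u ∈ done) → ∃ u ∈ t, u ∈ D

/-- `D` and `D'` have the same size and contain the same processed vertices among those with a
neighbour that has not been processed. -/
def Inst.SameKey (c : Inst) (ord done D D' : List ℕ) : Prop :=
  D.length = D'.length ∧ ∀ u ∈ done, (∃ v ∈ ord, v ∉ done ∧ c.Adj u v) → (u ∈ D ↔ u ∈ D')

open Classical in
/-- Processing the vertex `v` in the dynamic program, whose states are the list of processed vertices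
and a list of partial solutions. -/
noncomputable def Inst.dpStep (c : Inst) (H : List (List ℕ)) (ord : List ℕ)
    (x : List ℕ × List (List ℕ)) (v : ℕ) : List ℕ × List (List ℕ) :=
  (v :: x.1, (greedy (c.SameKey ord (v :: x.1))
    ((x.2.flatMap fun D => [D, v :: D]).filter (Ok H (v :: x.1)))).take c.fuel)

/-- Sets of vertices in `M` that hit all members of `H` contained in `M`, found by dynamic programming
along `Inst.order`. -/
noncomputable def Inst.dp (c : Inst) (H : List (List ℕ)) (M : List ℕ) : List (List ℕ) :=
  ((c.order M).foldl (c.dpStep H (c.order M)) ([], [[]])).2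

/-- `X` is a solution. -/
def Inst.IsSolution (r : ℕ) (c : Inst) (X : List ℕ) : Prop :=
  X.length ≤ c.k ∧ ∀ t ∈ c.targets r [], Meets t X

/-- The answer of the algorithm: whether one of the candidates is a solution. -/
def Inst.Answer (r : ℕ) (c : Inst) : Prop :=
  ∃ Z ∈ c.phase₁ r, ∃ x ∈ c.phase₂ r Z, ∃ D ∈ c.dp x.hit x.core, c.IsSolution r (Z ++ D)

end Algorithm

/-! ### The algorithm runs in polynomial time -/

section Polynomial

variable {γ : Type} [Enc γ]

lemma polyTime_instProj {β : Type} [Enc β] {g : ℕ × ℕ × List Prop × ℕ × ℕ × ℕ × ℕ × ℕ × ℕ → β}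
    (hg : PolyTime g) {f : γ → Inst} (hf : PolyTime f) :
    PolyTime fun x => g ((f x).n, (f x).k, (f x).bits, (f x).τ, (f x).s, (f x).R, (f x).T₁, (f x).T₂,
      (f x).fuel) :=
  hg.comp (let ⟨p, T, h1, h2, h3⟩ := hf; ⟨p, T, h1, h2, h3⟩ : PolyTime fun x =>
    ((f x).n, (f x).k, (f x).bits, (f x).τ, (f x).s, (f x).R, (f x).T₁, (f x).T₂, (f x).fuel))

lemma polyTime_nodeProj {β : Type} [Enc β] {g : ℕ × List (List ℕ) × List (List ℕ) × List ℕ → β}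
    (hg : PolyTime g) {f : γ → Node} (hf : PolyTime f) :
    PolyTime fun x => g ((f x).stage, (f x).hit, (f x).pack, (f x).core) :=
  hg.comp (let ⟨p, T, h1, h2, h3⟩ := hf; ⟨p, T, h1, h2, h3⟩ : PolyTime fun x =>
    ((f x).stage, (f x).hit, (f x).pack, (f x).core))

section Projections

variable {f : γ → Inst} {g : γ → Node}

@[fun_prop] lemma PolyTime.inst_n (hf : PolyTime f) : PolyTime fun x => (f x).n :=
  polyTime_instProj (g := fun y => y.1) (by fun_prop) hf
@[fun_prop] lemma PolyTime.inst_k (hf : PolyTime f) : PolyTime fun x => (f x).k :=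
  polyTime_instProj (g := fun y => y.2.1) (by fun_prop) hf
@[fun_prop] lemma PolyTime.inst_bits (hf : PolyTime f) : PolyTime fun x => (f x).bits :=
  polyTime_instProj (g := fun y => y.2.2.1) (by fun_prop) hf
@[fun_prop] lemma PolyTime.inst_τ (hf : PolyTime f) : PolyTime fun x => (f x).τ :=
  polyTime_instProj (g := fun y => y.2.2.2.1) (by fun_prop) hf
@[fun_prop] lemma PolyTime.inst_s (hf : PolyTime f) : PolyTime fun x => (f x).s :=
  polyTime_instProj (g := fun y => y.2.2.2.2.1) (by fun_prop) hf
@[fun_prop] lemma PolyTime.inst_R (hf : PolyTime f) : PolyTime fun x => (f x).R :=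
  polyTime_instProj (g := fun y => y.2.2.2.2.2.1) (by fun_prop) hf
@[fun_prop] lemma PolyTime.inst_T₁ (hf : PolyTime f) : PolyTime fun x => (f x).T₁ :=
  polyTime_instProj (g := fun y => y.2.2.2.2.2.2.1) (by fun_prop) hf
@[fun_prop] lemma PolyTime.inst_T₂ (hf : PolyTime f) : PolyTime fun x => (f x).T₂ :=
  polyTime_instProj (g := fun y => y.2.2.2.2.2.2.2.1) (by fun_prop) hf
@[fun_prop] lemma PolyTime.inst_fuel (hf : PolyTime f) : PolyTime fun x => (f x).fuel :=
  polyTime_instProj (g := fun y => y.2.2.2.2.2.2.2.2) (by fun_prop) hf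
@[fun_prop] lemma PolyTime.node_stage (hg : PolyTime g) : PolyTime fun x => (g x).stage :=
  polyTime_nodeProj (g := fun y => y.1) (by fun_prop) hg
@[fun_prop] lemma PolyTime.node_hit (hg : PolyTime g) : PolyTime fun x => (g x).hit :=
  polyTime_nodeProj (g := fun y => y.2.1) (by fun_prop) hg
@[fun_prop] lemma PolyTime.node_pack (hg : PolyTime g) : PolyTime fun x => (g x).pack :=
  polyTime_nodeProj (g := fun y => y.2.2.1) (by fun_prop) hg
@[fun_prop] lemma PolyTime.node_core (hg : PolyTime g) : PolyTime fun x => (g x).core :=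
  polyTime_nodeProj (g := fun y => y.2.2.2) (by fun_prop) hg

end Projections

@[fun_prop]
lemma PolyTime.node_mk {a : γ → ℕ} {b d : γ → List (List ℕ)} {e : γ → List ℕ} (ha : PolyTime a)
    (hb : PolyTime b) (hd : PolyTime d) (he : PolyTime e) :
    PolyTime fun x => Node.mk (a x) (b x) (d x) (e x) :=
  let ⟨p, T, h1, h2, h3⟩ := ha.pair (hb.pair (hd.pair he)); ⟨p, T, h1, h2, h3⟩

@[fun_prop]
lemma PolyTime.meets {a b : γ → List ℕ} (ha : PolyTime a) (hb : PolyTime b) :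
    PolyTime fun x => Meets (a x) (b x) := by
  unfold Meets; fun_prop

@[fun_prop]
lemma PolyTime.incr {l : γ → List ℕ} (hl : PolyTime l) (j : ℕ) : PolyTime fun x => incr (l x) j := by
  induction j with
  | zero => exact .const _
  | succ j ih =>
    simp only [_root_.incr]
    have h : PolyTime fun y : γ × ℕ => _root_.incr (l y.1) j := ih.comp (.fst .id)
    exact PolyTime.cons (.const _) (.flatMap (f := fun x v =>
      ((_root_.incr (l x) j).filter fun t => ∀ u ∈ t, v < u).map (v :: ·)) hl
      (.map (f := fun (y : γ × ℕ) t => y.2 :: t)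
        (.filter (p := fun (y : γ × ℕ) t => ∀ u ∈ t, y.2 < u) h (by fun_prop)) (by fun_prop)))

@[fun_prop]
lemma PolyTime.adj {c : γ → Inst} {u v : γ → ℕ} (hc : PolyTime c) (hu : PolyTime u)
    (hv : PolyTime v) : PolyTime fun x => (c x).Adj (u x) (v x) := by
  unfold Inst.Adj; fun_prop

@[fun_prop]
lemma PolyTime.clique {c : γ → Inst} {t : γ → List ℕ} (hc : PolyTime c) (ht : PolyTime t) :
    PolyTime fun x => (c x).Clique (t x) := by
  unfold Inst.Clique; fun_prop

@[fun_prop]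
lemma PolyTime.sets {c : γ → Inst} (r : ℕ) (hc : PolyTime c) :
    PolyTime fun x => (c x).sets r := by
  unfold Inst.sets; fun_prop

@[fun_prop]
lemma PolyTime.targets {c : γ → Inst} {Z : γ → List ℕ} (r : ℕ) (hc : PolyTime c)
    (hZ : PolyTime Z) : PolyTime fun x => (c x).targets r (Z x) := by
  unfold Inst.targets; fun_prop

@[fun_prop]
lemma PolyTime.packing {c : γ → Inst} {Z : γ → List ℕ} (r : ℕ) (hc : PolyTime c)
    (hZ : PolyTime Z) : PolyTime fun x => (c x).packing r (Z x) := by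
  unfold Inst.packing; fun_prop

lemma mem_incr {l : List ℕ} {j : ℕ} {t : List ℕ} :
    t ∈ incr l j ↔ t.length ≤ j ∧ (∀ v ∈ t, v ∈ l) ∧ t.Pairwise (· < ·) := by
  induction j generalizing t with
  | zero =>
    simp only [incr, List.mem_singleton, Nat.le_zero, List.length_eq_zero_iff]
    exact ⟨fun h => by simp [h], fun h => h.1⟩
  | succ j ih =>
    cases t with
    | nil => simp [incr]
    | cons v t =>
      simp only [incr, List.mem_cons, List.mem_flatMap, List.mem_map, List.mem_filter, ih,
        decide_eq_true_eq, reduceCtorEq, false_or, List.cons.injEq, List.length_cons,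
        Nat.add_le_add_iff_right, List.pairwise_cons, forall_eq_or_imp]
      constructor
      · rintro ⟨a, ha, t', ⟨⟨h1, h2, h3⟩, h4⟩, rfl, rfl⟩
        exact ⟨h1, ⟨ha, h2⟩, h4, h3⟩
      · rintro ⟨h1, ⟨ha, h2⟩, h4, h3⟩
        exact ⟨v, ha, t, ⟨⟨h1, h2, h3⟩, h4⟩, rfl, rfl⟩

lemma mem_sets {c : Inst} {r : ℕ} {t : List ℕ} :
    t ∈ c.sets r ↔ t.length ≤ r ∧ (∀ v ∈ t, v < c.n) ∧ t.Pairwise (· < ·) := by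
  simp [Inst.sets, mem_incr]

lemma bigCliques_length {c : Inst} {V q : List ℕ} (hq : q ∈ c.bigCliques V) :
    q.length ≤ c.τ ∧ ∀ v ∈ q, v ∈ V :=
  grow_invariant (fun i t => t.length ≤ i ∧ ∀ v ∈ t, v ∈ V) c.τ (by simp)
    (fun i _ t ht t' ht' => by
      obtain ⟨v, hv, rfl⟩ := List.mem_map.1 ht'
      have := (List.mem_filter.1 hv).1
      simp only [List.length_cons, List.mem_cons, forall_eq_or_imp]
      exact ⟨by omega, this, ht.2⟩) q hq

/-- Lists of bounded length with elements from a given list have polynomial size. -/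
lemma esize_le_of_length {α : Type} [Enc α] {t l : List α} {m : ℕ} (h1 : t.length ≤ m)
    (h2 : ∀ v ∈ t, v ∈ l) : esize t ≤ m * (esize l + 1) + 1 := by
  refine (esize_list_le fun a ha => esize_le_of_mem (h2 a ha)).trans ?_
  have := Nat.mul_le_mul_right (esize l + 1) h1
  omega

@[fun_prop]
lemma PolyTime.bigCliques {c : γ → Inst} {V : γ → List ℕ} (hc : PolyTime c)
    (hV : PolyTime V) : PolyTime fun x => (c x).bigCliques (V x) := by
  classical
  unfold Inst.bigCliques
  refine PolyTime.grow (S := fun x => esize (c x).τ * (esize (V x) + 1) + 1)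
    (by fun_prop) (by fun_prop) (by fun_prop) (.const _)
    (((hc.inst_τ.polyBound).mul (hV.polyBound.add (.const 1))).add (.const 1))
    (fun x i t => t.length ≤ i ∧ ∀ v ∈ t, v ∈ V x) (by simp) ?_ ?_
  · intro x i _ t ht t' ht'
    obtain ⟨v, hv, rfl⟩ := List.mem_map.1 ht'
    have := (List.mem_filter.1 hv).1
    simp only [List.length_cons, List.mem_cons, forall_eq_or_imp]
    exact ⟨by omega, this, ht.2⟩
  · intro x i hi t ht
    exact esize_le_of_length (ht.1.trans (by rw [esize_nat]; omega)) ht.2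

@[fun_prop]
lemma PolyTime.step₁ {c : γ → Inst} {Z : γ → List ℕ} (r : ℕ) (hc : PolyTime c)
    (hZ : PolyTime Z) : PolyTime fun x => (c x).step₁ r (Z x) := by
  classical
  unfold Inst.step₁ Inst.branchClique
  fun_prop

lemma packing_lt {c : Inst} {r : ℕ} {Z : List ℕ} {v : ℕ} (hv : v ∈ (c.packing r Z).flatten) :
    v < c.n := by
  obtain ⟨t, ht, hv⟩ := List.mem_flatten.1 hv
  exact (mem_sets.1 (List.mem_filter.1 (mem_of_mem_greedy ht)).1).2.1 v hv

@[fun_prop]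
lemma PolyTime.phase₁ {c : γ → Inst} (r : ℕ) (hc : PolyTime c) :
    PolyTime fun x => (c x).phase₁ r := by
  classical
  unfold Inst.phase₁
  refine PolyTime.grow (S := fun x =>
      (esize (c x).T₁ * esize (c x).τ) * (esize (List.range (c x).n) + 1) + 1)
    (by fun_prop) (by fun_prop) (by fun_prop) (.const _) ?_
    (fun x i Z => Z.length ≤ i * (c x).τ ∧ ∀ v ∈ Z, v < (c x).n) (by simp) ?_ ?_
  · exact ((hc.inst_T₁.polyBound.mul hc.inst_τ.polyBound).mul
      (hc.inst_n.range.polyBound.add (.const 1))).add (.const 1)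
  · intro x i _ Z hZ Z' hZ'
    rw [Inst.step₁] at hZ'
    split_ifs at hZ' with h1 h2
    · simp at hZ'
    · rw [List.mem_singleton] at hZ'
      subst hZ'
      exact ⟨hZ.1.trans (Nat.mul_le_mul_right _ (by omega)), hZ.2⟩
    · obtain ⟨X, -, rfl⟩ := List.mem_map.1 hZ'
      have hq : (((c x).bigCliques ((c x).packing r Z).flatten).headD []) ∈
          (c x).bigCliques ((c x).packing r Z).flatten := by
        cases h : (c x).bigCliques ((c x).packing r Z).flatten with
        | nil => exact absurd h h2
        | cons a l => exact List.mem_cons_self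
      obtain ⟨h3, h4⟩ := bigCliques_length hq
      constructor
      · rw [List.length_append, add_mul, one_mul]
        exact Nat.add_le_add hZ.1 ((List.length_filter_le _ _).trans h3)
      · intro v hv
        rcases List.mem_append.1 hv with hv | hv
        · exact hZ.2 v hv
        · exact packing_lt (h4 v (List.mem_filter.1 hv).1)
  · intro x i hi Z hZ
    refine esize_le_of_length (hZ.1.trans (Nat.mul_le_mul ?_ ?_)) fun v hv =>
      List.mem_range.2 (hZ.2 v hv)
    · rw [esize_nat]; omega
    · rw [esize_nat]; omega

@[fun_prop]
lemma PolyTime.petals {H : γ → List (List ℕ)} {M X : γ → List ℕ} (hH : PolyTime H) (hM : PolyTime M)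
    (hX : PolyTime X) : PolyTime fun x => petals (H x) (M x) (X x) := by
  unfold _root_.petals; fun_prop

@[fun_prop]
lemma PolyTime.petalPacking {H : γ → List (List ℕ)} {M X : γ → List ℕ} (hH : PolyTime H)
    (hM : PolyTime M) (hX : PolyTime X) : PolyTime fun x => petalPacking (H x) (M x) (X x) := by
  unfold _root_.petalPacking; fun_prop

@[fun_prop]
lemma PolyTime.step₂ {c : γ → Inst} {y : γ → Node} (r : ℕ) (hc : PolyTime c)
    (hy : PolyTime y) : PolyTime fun x => (c x).step₂ r (y x) := by
  unfold Inst.step₂ Inst.next Inst.child; fun_prop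

lemma sets_sublist {c : Inst} {r : ℕ} {t t' : List ℕ} (h : t ∈ c.sets r) (h' : t'.Sublist t) :
    t' ∈ c.sets r := by
  rw [mem_sets] at h ⊢
  exact ⟨h'.length_le.trans h.1, fun v hv => h.2.1 v (h'.subset hv), h.2.2.sublist h'⟩

lemma petalPacking_subset {c : Inst} {r : ℕ} {H : List (List ℕ)} {M X Y : List ℕ}
    (hH : ∀ t ∈ H, t ∈ c.sets r) (hY : Y ∈ petalPacking H M X) : Y ∈ c.sets r := by
  obtain ⟨t, ht, rfl⟩ := List.mem_map.1 (mem_of_mem_greedy hY)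
  exact sets_sublist (hH t (List.mem_filter.1 ht).1) List.filter_sublist

@[fun_prop]
lemma PolyTime.phase₂ {c : γ → Inst} {Z : γ → List ℕ} (r : ℕ) (hc : PolyTime c)
    (hZ : PolyTime Z) : PolyTime fun x => (c x).phase₂ r (Z x) := by
  classical
  unfold Inst.phase₂ Inst.root
  refine PolyTime.grow (S := fun x => esize r + esize ((c x).sets r) +
      (esize (c x).k * (esize ((c x).sets r) + 1) + 1) + esize (List.range (c x).n) + 3)
    (by fun_prop) (by fun_prop) (by fun_prop) (by fun_prop) ?_
    (fun x _ y => y.stage ≤ r ∧ esize y.hit ≤ esize ((c x).sets r) ∧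
      (∀ t ∈ y.hit, t ∈ (c x).sets r) ∧ (∀ t ∈ y.pack, t ∈ (c x).sets r) ∧
      y.pack.length ≤ (c x).k ∧ esize y.core ≤ esize (List.range (c x).n)) ?_ ?_ ?_
  · exact (((((PolyBound.const _).add (hc.sets r).polyBound).add
      (((hc.inst_k.polyBound).mul ((hc.sets r).polyBound.add (.const 1))).add (.const 1)))).add
      hc.inst_n.range.polyBound).add (.const 3)
  · intro x
    refine ⟨Nat.zero_le _, esize_sublist List.filter_sublist, fun t ht => (List.mem_filter.1 ht).1,
      by simp, by simp, ?_⟩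
    rw [esize_nil]; exact one_le_esize _
  · rintro x i _ y ⟨h1, h2, h3, h4, h5, h6⟩ y' hy'
    rw [Inst.step₂] at hy'
    split_ifs at hy' with h7
    · rw [List.mem_singleton] at hy'
      subst hy'
      exact ⟨h1, h2, h3, h4, h5, h6⟩
    rcases List.mem_cons.1 hy' with rfl | hy'
    · exact ⟨by simp only [Inst.next]; omega, esize_sublist List.filter_sublist,
        fun t ht => (List.mem_filter.1 ht).1, h4, h5, esize_sublist List.filter_sublist⟩
    · obtain ⟨X, hX, rfl⟩ := List.mem_map.1 hy'
      have h8 := (List.mem_filter.1 hX).2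
      simp only [decide_eq_true_eq] at h8
      refine ⟨Nat.zero_le _, esize_sublist List.filter_sublist,
        fun t ht => (List.mem_filter.1 ht).1, fun t ht => ?_, ?_, esize_sublist List.filter_sublist⟩
      · rcases List.mem_append.1 ht with ht | ht
        · exact h4 t ht
        · exact petalPacking_subset h3 ht
      · simp only [Inst.child, List.length_append]; exact h8.2
  · rintro x i _ y ⟨h1, h2, h3, h4, h5, h6⟩
    have e : esize y = esize y.stage + (esize y.hit + (esize y.pack + esize y.core + 1) + 1) + 1 :=
      rfl
    have h7 := esize_le_of_length (h5.trans (by rw [esize_nat]; omega : _ ≤ esize (c x).k)) h4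
    have h8 : esize y.stage ≤ esize r := by rw [esize_nat, esize_nat]; omega
    omega

@[fun_prop]
lemma PolyTime.words {c : γ → Inst} {M : γ → List ℕ} (hc : PolyTime c) (hM : PolyTime M) :
    PolyTime fun x => (c x).words (M x) := by
  unfold Inst.words
  refine PolyTime.grow (S := fun x => esize (c x).s * (esize (M x) + 1) + 1)
    (by fun_prop) (by fun_prop) (by fun_prop) (.const _)
    (((hc.inst_s.polyBound).mul (hM.polyBound.add (.const 1))).add (.const 1))
    (fun x i t => t.length ≤ i ∧ ∀ v ∈ t, v ∈ M x) (by simp) ?_ ?_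
  · intro x i _ t ht t' ht'
    obtain ⟨v, hv, rfl⟩ := List.mem_map.1 ht'
    simp only [List.length_cons, List.mem_cons, forall_eq_or_imp]
    exact ⟨by omega, hv, ht.2⟩
  · intro x i hi t ht
    exact esize_le_of_length (ht.1.trans (by rw [esize_nat]; omega)) ht.2

@[fun_prop]
lemma PolyTime.component {c : γ → Inst} {W : γ → List ℕ} {v : γ → ℕ} (hc : PolyTime c)
    (hW : PolyTime W) (hv : PolyTime v) : PolyTime fun x => (c x).component (W x) (v x) := by
  classical
  unfold Inst.component
  refine PolyTime.iterate (f := fun x A => (W x).filter fun u => u ∈ A ∨ ∃ a ∈ A, (c x).Adj a u)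
    (B := fun x => esize (W x) + (esize (v x) + 2))
    (by fun_prop) (by fun_prop) (by fun_prop)
    (hW.polyBound.add (hv.polyBound.add (.const 2))) ?_
  intro x i _
  cases i with
  | zero =>
    have : esize [v x] = esize (v x) + 1 + 1 := rfl
    rw [Function.iterate_zero, id_eq]; omega
  | succ i =>
    rw [Function.iterate_succ_apply']
    exact (esize_sublist List.filter_sublist).trans (Nat.le_add_right _ _)

@[fun_prop]
lemma PolyTime.components {c : γ → Inst} {W : γ → List ℕ} (hc : PolyTime c)
    (hW : PolyTime W) : PolyTime fun x => (c x).components (W x) := by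
  unfold Inst.components; fun_prop

@[fun_prop]
lemma PolyTime.balanced {c : γ → Inst} {U S : γ → List ℕ} (hc : PolyTime c) (hU : PolyTime U)
    (hS : PolyTime S) : PolyTime fun x => (c x).Balanced (U x) (S x) := by
  unfold Inst.Balanced; fun_prop

@[fun_prop]
lemma PolyTime.split {c : γ → Inst} {Λ : γ → List (List ℕ)} {U : γ → List ℕ} (hc : PolyTime c)
    (hΛ : PolyTime Λ) (hU : PolyTime U) : PolyTime fun x => (c x).split (Λ x) (U x) := by
  unfold Inst.split Inst.pieces; fun_prop

/-- The components are sublists of the vertex list. -/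
lemma sublist_of_mem_components {c : Inst} {W K : List ℕ} (hK : K ∈ c.components W) :
    K.Sublist W := by
  obtain ⟨v, hv, rfl⟩ := List.mem_map.1 (mem_of_mem_greedy hK)
  cases W with
  | nil => simp at hv
  | cons a W =>
    rw [Inst.component, List.length_cons, Function.iterate_succ_apply']
    exact List.filter_sublist

lemma sublist_of_mem_split {c : Inst} {Λ : List (List ℕ)} {U K : List ℕ} (hK : K ∈ c.split Λ U) :
    K.Sublist U := by
  rw [Inst.split] at hK
  split_ifs at hK with h1 h2
  · simp at hK
  · rw [List.mem_singleton] at hK; exact hK ▸ List.Sublist.refl _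
  · rcases List.mem_append.1 hK with hK | hK
    · obtain ⟨v, hv, rfl⟩ := List.mem_map.1 hK
      exact List.singleton_sublist.2 (List.mem_filter.1 hv).1
    · exact (sublist_of_mem_components hK).trans List.filter_sublist

@[fun_prop]
lemma PolyTime.order {c : γ → Inst} {M : γ → List ℕ} (hc : PolyTime c) (hM : PolyTime M) :
    PolyTime fun x => (c x).order (M x) := by
  unfold Inst.order
  refine PolyTime.flatten (PolyTime.grow (S := fun x => esize (M x))
    (by fun_prop) (by fun_prop) (by fun_prop) (by fun_prop) hM.polyBound
    (fun x i U => U.Sublist (M x)) (fun x => List.Sublist.refl _) ?_ ?_)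
  · intro x i _ U hU U' hU'
    exact (sublist_of_mem_split hU').trans hU
  · intro x i _ U hU
    exact esize_sublist hU

lemma foldl_dpStep_spec {c : Inst} {H : List (List ℕ)} {ord l : List ℕ} :
    (l.foldl (c.dpStep H ord) ([], [[]])).1 = l.reverse ∧
    (l.foldl (c.dpStep H ord) ([], [[]])).2.length ≤ c.fuel + 1 ∧
    ∀ D ∈ (l.foldl (c.dpStep H ord) ([], [[]])).2, D.reverse.Sublist l := by
  induction l using List.reverseRecOn with
  | nil => simp
  | append_singleton l a ih =>
    obtain ⟨h1, h2, h3⟩ := ih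
    rw [List.foldl_append, List.foldl_cons, List.foldl_nil]
    refine ⟨by simp [Inst.dpStep, h1], ?_, ?_⟩
    · exact (List.length_take_le _ _).trans (by omega)
    · intro D hD
      have h4 := (List.mem_filter.1 (mem_of_mem_greedy (List.mem_of_mem_take hD))).1
      obtain ⟨D', hD', h5⟩ := List.mem_flatMap.1 h4
      rcases List.mem_cons.1 h5 with rfl | h5
      · exact (h3 _ hD').trans (List.sublist_append_left _ _)
      · rw [List.mem_singleton] at h5
        rw [h5, List.reverse_cons]
        exact (h3 _ hD').append_right [a]

@[fun_prop]
lemma PolyTime.ok {H : γ → List (List ℕ)} {A D : γ → List ℕ} (hH : PolyTime H)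
    (hA : PolyTime A) (hD : PolyTime D) : PolyTime fun x => Ok (H x) (A x) (D x) := by
  unfold Ok; fun_prop

@[fun_prop]
lemma PolyTime.sameKey {c : γ → Inst} {ord A D D' : γ → List ℕ} (hc : PolyTime c)
    (ho : PolyTime ord) (hA : PolyTime A) (hD : PolyTime D) (hD' : PolyTime D') :
    PolyTime fun x => (c x).SameKey (ord x) (A x) (D x) (D' x) := by
  unfold Inst.SameKey; fun_prop

@[fun_prop]
lemma PolyTime.dp {c : γ → Inst} {H : γ → List (List ℕ)} {M : γ → List ℕ} (hc : PolyTime c)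
    (hH : PolyTime H) (hM : PolyTime M) : PolyTime fun x => (c x).dp (H x) (M x) := by
  have ho := hc.order hM
  unfold Inst.dp
  refine PolyTime.snd (PolyTime.foldl
    (f := fun x y v => (c x).dpStep (H x) ((c x).order (M x)) y v)
    (B := fun x => esize ((c x).order (M x)) +
      ((esize (c x).fuel + 1) * (esize ((c x).order (M x)) + 1) + 1) + 1)
    ho (.const _) ?_ ((ho.polyBound.add (((hc.inst_fuel.polyBound.add (.const 1)).mul
      (ho.polyBound.add (.const 1))).add (.const 1))).add (.const 1)) ?_)
  · unfold Inst.dpStep; fun_prop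
  · intro x l₁ l₂ h
    obtain ⟨h1, h2, h3⟩ := foldl_dpStep_spec (c := c x) (H := H x) (ord := (c x).order (M x))
      (l := l₁)
    have h4 : esize l₁ ≤ esize ((c x).order (M x)) := h ▸ esize_sublist (List.sublist_append_left _ _)
    have h0 : ∀ y : List ℕ × List (List ℕ), esize y = esize y.1 + esize y.2 + 1 := fun _ => rfl
    change esize (l₁.foldl ((c x).dpStep (H x) ((c x).order (M x))) ([], [[]])) ≤ _
    rw [h0, h1, esize_reverse]
    have h5 := esize_list_le (l := (l₁.foldl ((c x).dpStep (H x) ((c x).order (M x))) ([], [[]])).2)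
      (B := esize ((c x).order (M x))) fun D hD => by
        rw [← esize_reverse]; exact (esize_sublist (h3 D hD)).trans h4
    have h6 := Nat.mul_le_mul_right (esize ((c x).order (M x)) + 1)
      (h2.trans (by rw [esize_nat]; omega : _ ≤ esize (c x).fuel + 1))
    omega

/-- The algorithm runs in polynomial time. -/
lemma polyTime_answer (r : ℕ) : PolyTime fun c : Inst => c.Answer r := by
  unfold Inst.Answer Inst.IsSolution; fun_prop

end Polynomial

/-! ### Branching on large cliques -/

section CliqueBranching

variable {c : Inst} {r : ℕ}

/-- The adjacency relation of the instance is symmetric and irreflexive. -/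
structure Inst.IsGraph (c : Inst) : Prop where
  symm : ∀ u < c.n, ∀ v < c.n, c.Adj u v → c.Adj v u
  irrefl : ∀ u < c.n, ¬c.Adj u u

/-- The elements of the finite set `K` are pairwise adjacent. -/
def Inst.CliqueSet (c : Inst) (K : Finset ℕ) : Prop := ∀ u ∈ K, ∀ v ∈ K, u = v ∨ c.Adj u v

lemma Meets.symm {a b : List ℕ} (h : Meets a b) : Meets b a :=
  let ⟨v, h1, h2⟩ := h; ⟨v, h2, h1⟩

lemma mem_targets {Z t : List ℕ} :
    t ∈ c.targets r Z ↔ t ∈ c.sets r ∧ t.length = r ∧ c.Clique t ∧ ∀ v ∈ t, v ∉ Z := by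
  simp [Inst.targets]

lemma exists_mem_targets {Z : List ℕ} {K : Finset ℕ} (hK : ∀ v ∈ K, v < c.n ∧ v ∉ Z)
    (hcl : c.CliqueSet K) (hr : r ≤ K.card) : ∃ t ∈ c.targets r Z, ∀ v ∈ t, v ∈ K := by
  obtain ⟨L, hL, hLr⟩ := Finset.exists_subset_card_eq hr
  have hm : ∀ v ∈ L.sort (· ≤ ·), v ∈ K := fun v hv => hL ((Finset.mem_sort _).1 hv)
  refine ⟨L.sort (· ≤ ·), mem_targets.2 ⟨mem_sets.2 ⟨?_, fun v hv => (hK v (hm v hv)).1,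
    (Finset.sortedLT_sort L).pairwise⟩, ?_, fun u hu v hv => hcl u (hm u hu) v (hm v hv),
    fun v hv => (hK v (hm v hv)).2⟩, hm⟩
  · rw [Finset.length_sort, hLr]
  · rw [Finset.length_sort, hLr]

/-- A packing of sets that are hit by `S` has at most `|S|` members. -/
lemma length_le_card_of_pairwise {P : List (List ℕ)} (hP : P.Pairwise fun a b => ¬Meets a b)
    {S : Finset ℕ} (hS : ∀ t ∈ P, ∃ v ∈ t, v ∈ S) : P.length ≤ S.card := by
  induction P generalizing S with
  | nil => simp
  | cons t P ih =>
    obtain ⟨v, hv, hvS⟩ := hS t List.mem_cons_self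
    rw [List.pairwise_cons] at hP
    have := ih hP.2 (S := S.erase v) fun t' ht' => by
      obtain ⟨u, hu, huS⟩ := hS t' (List.mem_cons_of_mem _ ht')
      refine ⟨u, hu, Finset.mem_erase.2 ⟨?_, huS⟩⟩
      rintro rfl
      exact hP.1 t' ht' ⟨u, hv, hu⟩
    rw [Finset.card_erase_of_mem hvS] at this
    have := Finset.card_pos.2 ⟨v, hvS⟩
    rw [List.length_cons]; omega

lemma greedy_meets_pairwise (l : List (List ℕ)) :
    (greedy Meets l).Pairwise fun a b => ¬Meets a b :=
  (List.pairwise_reverse.1 (greedy_spec Meets l).2.1).imp fun h h' => h h'.symm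

lemma length_incr_le (l : List ℕ) (j : ℕ) : (incr l j).length ≤ (l.length + 1) ^ j := by
  induction j with
  | zero => simp [incr]
  | succ j ih =>
    rw [incr, List.length_cons, List.length_flatMap, pow_succ]
    have h1 : (l.map fun v => (((incr l j).filter fun t => ∀ u ∈ t, v < u).map (v :: ·)).length).sum
        ≤ l.length * (l.length + 1) ^ j := by
      refine (List.sum_le_card_nsmul _ ((l.length + 1) ^ j) ?_).trans (by simp)
      intro x hx
      obtain ⟨v, -, rfl⟩ := List.mem_map.1 hx
      rw [List.length_map]
      exact (List.length_filter_le _ _).trans ih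
    have h2 : 1 ≤ (l.length + 1) ^ j := Nat.one_le_pow _ _ (by omega)
    calc _ ≤ l.length * (l.length + 1) ^ j + (l.length + 1) ^ j := by
          convert Nat.add_le_add h1 h2
      _ = _ := by ring

lemma bigCliques_spec (hc : c.IsGraph) {V q : List ℕ} (hV : ∀ v ∈ V, v < c.n)
    (hq : q ∈ c.bigCliques V) :
    q.length = c.τ ∧ (∀ v ∈ q, v ∈ V) ∧ q.Nodup ∧ c.CliqueSet q.toFinset := by
  refine grow_invariant (fun i q => q.length = i ∧ (∀ v ∈ q, v ∈ V) ∧ q.Nodup ∧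
    c.CliqueSet q.toFinset) c.τ (by simp [Inst.CliqueSet]) ?_ q hq
  rintro i _ t ⟨h1, h2, h3, h4⟩ t' ht'
  obtain ⟨v, hv, rfl⟩ := List.mem_map.1 ht'
  obtain ⟨hvV, hvt⟩ := List.mem_filter.1 hv
  simp only [decide_eq_true_eq] at hvt
  refine ⟨by simp [h1], by simpa using ⟨hvV, h2⟩, List.nodup_cons.2 ⟨fun hvt' =>
    hc.irrefl v (hV v hvV) (hvt v hvt'), h3⟩, ?_⟩
  intro a ha b hb
  simp only [List.toFinset_cons, Finset.mem_insert, List.mem_toFinset] at ha hb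
  rcases ha with rfl | ha <;> rcases hb with rfl | hb
  · exact .inl rfl
  · exact .inr (hvt b hb)
  · exact .inr (hc.symm b (hV b hvV) a (hV a (h2 a ha)) (hvt a ha))
  · exact h4 a (List.mem_toFinset.2 ha) b (List.mem_toFinset.2 hb)

lemma bigCliques_ne_nil {V : List ℕ} {L : ℕ} (hL : 1 ≤ L) (hVL : V.length ≤ L)
    (hfuel : L ^ c.τ ≤ c.fuel) {K : Finset ℕ} (hKV : ∀ v ∈ K, v ∈ V) (hK : c.CliqueSet K)
    (hτ : c.τ ≤ K.card) : c.bigCliques V ≠ [] := by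
  classical
  obtain ⟨a, ha, -⟩ := exists_mem_grow
    (B := fun t => (V.filter fun v => ∀ u ∈ t, c.Adj v u).map (· :: t))
    (fun _ => True) (fun i a => a.length = i ∧ ∀ v ∈ a, v ∈ K) (s := []) trivial
    (fun _ _ _ _ => trivial) (fun a _ => by
      rw [List.length_map]; exact (List.length_filter_le _ _).trans hVL)
    (by simp) hL c.τ hfuel (fun i hi a _ ⟨h1, h2⟩ => by
      have h3 : a.toFinset.card < K.card := by
        have := List.toFinset_card_le a; omega
      obtain ⟨v, hv, hva⟩ := Finset.exists_mem_notMem_of_card_lt_card h3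
      rw [List.mem_toFinset] at hva
      refine ⟨v :: a, List.mem_map.2 ⟨v, List.mem_filter.2 ⟨hKV v hv, ?_⟩, rfl⟩, by simp [h1],
        by simpa using ⟨hv, h2⟩⟩
      simp only [decide_eq_true_eq]
      intro u hu
      exact (hK v hv u (h2 u hu)).resolve_left fun h => hva (h ▸ hu))
  exact List.ne_nil_of_mem ha

/-- A solution contains all but fewer than `r` vertices of every clique, so it is consistent with one
of the branches. -/
lemma exists_mem_branchClique {Z q : List ℕ} {S : Finset ℕ} (hr : 1 ≤ r)
    (hS : ∀ t ∈ c.targets r [], ∃ v ∈ t, v ∈ S) (hq : q.Nodup) (hqn : ∀ v ∈ q, v < c.n)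
    (hqc : c.CliqueSet q.toFinset) (hqZ : ∀ v ∈ q, v ∉ Z) (hZ : Z.Nodup) (hZS : ∀ v ∈ Z, v ∈ S) :
    ∃ Z' ∈ Inst.branchClique r Z q, Z'.Nodup ∧ (∀ v ∈ Z', v ∈ S) ∧
      Z.length + (q.length - (r - 1)) ≤ Z'.length := by
  classical
  let K := q.toFinset \ S
  have hK : K.card ≤ r - 1 := by
    by_contra h
    obtain ⟨t, ht, htK⟩ := exists_mem_targets (c := c) (r := r) (Z := []) (K := K)
      (fun v hv => ⟨hqn v (List.mem_toFinset.1 (Finset.mem_sdiff.1 hv).1), by simp⟩)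
      (fun u hu v hv => hqc u (Finset.mem_sdiff.1 hu).1 v (Finset.mem_sdiff.1 hv).1) (by omega)
    obtain ⟨v, hv, hvS⟩ := hS t ht
    exact (Finset.mem_sdiff.1 (htK v hv)).2 hvS
  have hX : ∀ v, v ∈ K.sort (· ≤ ·) ↔ v ∈ q ∧ v ∉ S := fun v => by
    rw [Finset.mem_sort, Finset.mem_sdiff, List.mem_toFinset]
  refine ⟨_, List.mem_map.2 ⟨K.sort (· ≤ ·), mem_incr.2 ⟨?_, fun v hv => ((hX v).1 hv).1,
    (Finset.sortedLT_sort K).pairwise⟩, rfl⟩, ?_, ?_, ?_⟩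
  · rwa [Finset.length_sort]
  · rw [List.nodup_append]
    refine ⟨hZ, hq.filter _, fun a ha b hb => ?_⟩
    rintro rfl
    exact hqZ a (List.mem_filter.1 hb).1 ha
  · intro v hv
    rcases List.mem_append.1 hv with hv | hv
    · exact hZS v hv
    · have h1 := List.mem_filter.1 hv
      simp only [hX, decide_eq_true_eq] at h1
      by_contra h
      exact h1.2 ⟨h1.1, h⟩
  · rw [List.length_append]
    have h1 := List.length_eq_length_filter_add (l := q) (fun v => decide (v ∉ K.sort (· ≤ ·)))
    have h2 : (q.filter fun v => !decide (v ∉ K.sort (· ≤ ·))).length ≤ K.card := by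
      rw [← List.toFinset_card_of_nodup (hq.filter _)]
      refine Finset.card_le_card fun v hv => ?_
      exact (by simpa using hv : v ∈ q ∧ v ∈ K).2
    omega

lemma exists_mem_phase₁ (hc : c.IsGraph) (hr : 1 ≤ r) {S : Finset ℕ} (hSk : S.card ≤ c.k)
    (hS : ∀ t ∈ c.targets r [], ∃ v ∈ t, v ∈ S) (hfuel : (r * c.k + 1) ^ c.τ ≤ c.fuel)
    (hfuel' : ((c.τ + 1) ^ r) ^ c.T₁ ≤ c.fuel)
    (hT : c.k < c.T₁ * (c.τ - (r - 1))) :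
    ∃ Z ∈ c.phase₁ r, Z.Nodup ∧ (∀ v ∈ Z, v ∈ S) ∧
      ∀ K : Finset ℕ, (∀ v ∈ K, v < c.n ∧ v ∉ Z) → c.CliqueSet K → K.card < c.τ + r := by
  classical
  have hpack : ∀ Z, (∀ v ∈ Z, v ∈ S) → (c.packing r Z).length ≤ c.k := fun Z hZ =>
    (length_le_card_of_pairwise (greedy_meets_pairwise _) fun t ht => hS t (by
      have := mem_targets.1 (mem_of_mem_greedy ht)
      exact mem_targets.2 ⟨this.1, this.2.1, this.2.2.1, by simp⟩)).trans hSk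
  have hB : ∀ Z, (c.step₁ r Z).length ≤ (c.τ + 1) ^ r := by
    intro Z
    rw [Inst.step₁]
    have h1 : 1 ≤ (c.τ + 1) ^ r := Nat.one_le_pow _ _ (by omega)
    split_ifs with h2 h3
    · simp
    · simpa using h1
    · rw [Inst.branchClique, List.length_map]
      refine (length_incr_le _ _).trans ?_
      have hq : ((c.bigCliques (c.packing r Z).flatten).headD []).length ≤ c.τ := by
        cases h : c.bigCliques (c.packing r Z).flatten with
        | nil => simp
        | cons a l => exact (bigCliques_length (c := c) (h ▸ List.mem_cons_self)).1
      exact (Nat.pow_le_pow_left (by omega) _).trans (Nat.pow_le_pow_right (by omega) (by omega))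
  have hgood : ∀ i < c.T₁, ∀ Z, True → (Z.Nodup ∧ (∀ v ∈ Z, v ∈ S) ∧
      (i * (c.τ - (r - 1)) ≤ Z.length ∨ c.bigCliques (c.packing r Z).flatten = [])) →
      ∃ Z' ∈ c.step₁ r Z, Z'.Nodup ∧ (∀ v ∈ Z', v ∈ S) ∧
        ((i + 1) * (c.τ - (r - 1)) ≤ Z'.length ∨ c.bigCliques (c.packing r Z').flatten = []) := by
    rintro i hi Z - ⟨hZn, hZS, hZi⟩
    rw [Inst.step₁, if_neg (not_lt.2 (hpack Z hZS))]
    split_ifs with h3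
    · exact ⟨Z, List.mem_singleton_self _, hZn, hZS, .inr h3⟩
    · have hZi' := hZi.resolve_right h3
      have hq : ((c.bigCliques (c.packing r Z).flatten).headD []) ∈
          c.bigCliques (c.packing r Z).flatten := by
        cases h : c.bigCliques (c.packing r Z).flatten with
        | nil => exact absurd h h3
        | cons a l => exact List.mem_cons_self
      obtain ⟨h4, h5, h6, h7⟩ := bigCliques_spec hc (fun v hv => packing_lt hv) hq
      obtain ⟨Z', h8, h9, h10, h11⟩ := exists_mem_branchClique hr hS h6
        (fun v hv => packing_lt (h5 v hv)) h7 (fun v hv => by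
          obtain ⟨t, ht, hvt⟩ := List.mem_flatten.1 (h5 v hv)
          exact (mem_targets.1 (mem_of_mem_greedy ht)).2.2.2 v hvt) hZn hZS
      refine ⟨Z', h8, h9, h10, .inl ?_⟩
      rw [h4] at h11
      rw [add_mul, one_mul]; omega
  obtain ⟨Z, hZ, hZn, hZS, hZ'⟩ := exists_mem_grow (B := c.step₁ r) (fuel := c.fuel)
    (L := (c.τ + 1) ^ r) (s := []) (fun _ => True)
    (fun i Z => Z.Nodup ∧ (∀ v ∈ Z, v ∈ S) ∧ (i * (c.τ - (r - 1)) ≤ Z.length ∨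
      c.bigCliques (c.packing r Z).flatten = []))
    trivial (fun _ _ _ _ => trivial) (fun Z _ => hB Z) (by simp) (Nat.one_le_pow _ _ (by omega))
    c.T₁ hfuel' hgood
  refine ⟨Z, hZ, hZn, hZS, fun K hK hKc => ?_⟩
  have hZk : Z.length ≤ c.k := by
    rw [← List.toFinset_card_of_nodup hZn]
    exact (Finset.card_le_card fun v hv => hZS v (List.mem_toFinset.1 hv)).trans hSk
  have hbig := hZ'.resolve_left (by omega)
  by_contra hcard
  let V := (c.packing r Z).flatten
  have hKV : (K \ V.toFinset).card < r := by
    by_contra h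
    obtain ⟨t, ht, htK⟩ := exists_mem_targets (c := c) (r := r) (Z := Z) (K := K \ V.toFinset)
      (fun v hv => hK v (Finset.mem_sdiff.1 hv).1)
      (fun u hu v hv => hKc u (Finset.mem_sdiff.1 hu).1 v (Finset.mem_sdiff.1 hv).1)
      (Nat.le_of_not_lt h)
    have hVt : ∀ v ∈ t, ∀ t' ∈ c.packing r Z, v ∉ t' := fun v hv t' ht' hvt' =>
      (Finset.mem_sdiff.1 (htK v hv)).2 (List.mem_toFinset.2 (List.mem_flatten.2 ⟨t', ht', hvt'⟩))
    rcases (greedy_spec Meets (c.targets r Z)).2.2 t ht with h1 | ⟨b, hb, v, hvb, hvt⟩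
    · have h2 : t ≠ [] := by
        rintro rfl
        have := (mem_targets.1 ht).2.1
        simp at this; omega
      exact hVt _ (List.head_mem h2) t h1 (List.head_mem h2)
    · exact hVt v hvt b hb hvb
  refine bigCliques_ne_nil (c := c) (V := V) (L := r * c.k + 1) (by omega) ?_ hfuel
    (K := K ∩ V.toFinset) (fun v hv => by simpa using (Finset.mem_inter.1 hv).2)
    (fun u hu v hv => hKc u (Finset.mem_inter.1 hu).1 v (Finset.mem_inter.1 hv).1) ?_ hbig
  · have h1 : V.length ≤ (c.packing r Z).length * r := by
      rw [List.length_flatten]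
      refine (List.sum_le_card_nsmul _ r ?_).trans (by simp)
      intro x hx
      obtain ⟨t, ht, rfl⟩ := List.mem_map.1 hx
      exact (mem_targets.1 (mem_of_mem_greedy ht)).2.1.le
    have h2 := Nat.mul_le_mul_right r (hpack Z hZS)
    rw [mul_comm c.k] at h2; omega
  · have := Finset.card_sdiff_add_card_inter K V.toFinset
    omega

end CliqueBranching

/-! ### Branching on large packings -/

section PackingBranching

variable {c : Inst} {r : ℕ}

lemma nodup_incr {l : List ℕ} (hl : l.Nodup) (j : ℕ) : (incr l j).Nodup := by
  induction j with
  | zero => simp [incr]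
  | succ j ih =>
    rw [incr, List.nodup_cons]
    refine ⟨by simp, List.nodup_flatMap.2 ⟨fun v _ => (ih.filter _).map (List.cons_injective), ?_⟩⟩
    refine hl.imp fun {u v} huv => ?_
    intro t h1 h2
    obtain ⟨a, -, rfl⟩ := List.mem_map.1 h1
    obtain ⟨b, -, h⟩ := List.mem_map.1 h2
    exact huv (List.cons.inj h).1.symm

/-- The properties that all nodes of the branching on large packings have; the core of a node of stage
`j` has at most `r k (1 + N τ r) ^ j` vertices. -/
structure Inst.Inv (r : ℕ) (c : Inst) (Z : List ℕ) (N : ℕ) (x : Node) : Prop where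
  stage_le : x.stage ≤ r
  hit : ∀ t ∈ x.hit, t ∈ c.sets r ∧ c.Clique t ∧ ∀ v ∈ t, v ∉ Z
  pack : ∀ t ∈ x.pack, t ∈ c.sets r ∧ ∀ v ∈ t, v ∉ Z
  pack_le : x.pack.length ≤ c.k
  nodup : x.core.Nodup
  core : ∀ v ∈ x.core, v < c.n ∧ v ∉ Z
  core_le : x.core.length + 1 ≤ (r * c.k + 1) * (1 + N * c.τ * r) ^ x.stage

/-- The properties of the nodes on the branch that is consistent with a solution `S`: all members of
`hit` and `pack` are hit by `S`, and in stage `j` every clique that has to be hit either contains one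
that lies in the core or has at least `j` vertices in the core. The last condition bounds the depth
`i` of the node, since every branch increases the packing by at least `τ + 1` sets. -/
structure Inst.Consistent (r : ℕ) (c : Inst) (Z : List ℕ) (S : Finset ℕ) (i : ℕ) (x : Node) :
    Prop where
  hit : ∀ t ∈ x.hit, ∃ v ∈ t, v ∈ S
  pairwise : x.pack.Pairwise fun a b => ¬Meets a b
  pack : ∀ t ∈ x.pack, ∃ v ∈ t, v ∈ S
  pack_core : ∀ t ∈ x.pack, ∀ v ∈ t, v ∈ x.core
  targets : ∀ t ∈ c.targets r Z, ∃ t' ∈ x.hit, t' ⊆ t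
  progress : ∀ t ∈ x.hit, (∃ t' ∈ x.hit, t' ⊆ t ∧ t' ⊆ x.core) ∨
    ∃ X : List ℕ, X.Sublist t ∧ X ⊆ x.core ∧ x.stage ≤ X.length
  depth : ∃ g, g * (c.τ + 1) ≤ x.pack.length ∧ (x.stage = r ∨ i ≤ (r + 1) * g + x.stage)

lemma mem_petals {H : List (List ℕ)} {M X Y : List ℕ} [∀ v, Decidable (v ∈ M)] :
    Y ∈ petals H M X ↔ ∃ t ∈ H, t.filter (· ∈ M) = X ∧ t.filter (· ∉ M) = Y ∧ Y ≠ [] := by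
  have e : ∀ t : List ℕ, (t.filter fun v => v ∉ M) ≠ [] ↔ ∃ v ∈ t, v ∉ M := by
    intro t; simp
  simp only [petals, List.mem_map, List.mem_filter, decide_eq_true_eq]
  constructor
  · rintro ⟨t, ⟨h1, h2, h3⟩, h4⟩
    refine ⟨t, h1, by convert h2, by convert h4, ?_⟩
    rw [← h4]
    have := (e t).2 h3
    convert this
  · rintro ⟨t, h1, h2, h3, h4⟩
    refine ⟨t, ⟨h1, by convert h2, (e t).1 (h3 ▸ h4)⟩, by convert h3⟩

/-- The sets with a nonempty petal packing are cliques on fewer than `r` vertices in the core. -/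
lemma length_active_le {Z : List ℕ} {N : ℕ} (hN : ∀ W : Finset ℕ, (∀ v ∈ W, v < c.n ∧ v ∉ Z) →
      ∀ F : Finset (Finset ℕ), (∀ X ∈ F, X ⊆ W ∧ c.CliqueSet X ∧ X.card < r) →
        F.card ≤ N * (W.card + 1))
    {x : Node} (hx : c.Inv r Z N x) {l : List (List ℕ)} (hl : l.Nodup)
    (hl' : ∀ X ∈ l, X ∈ c.sets r ∧ petalPacking x.hit x.core X ≠ []) :
    l.length ≤ N * (x.core.length + 1) := by
  classical
  have hsort : ∀ X ∈ l, X.Pairwise (· < ·) := fun X hX => (mem_sets.1 (hl' X hX).1).2.2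
  have h1 : (l.map List.toFinset).Nodup := by
    refine List.Nodup.map_on (fun X hX Y hY h => ?_) hl
    refine List.Perm.eq_of_pairwise (le := (· < ·)) (fun a b _ _ h1 h2 => absurd h1 (lt_asymm h2))
      (hsort X hX) (hsort Y hY) ?_
    exact (List.perm_ext_iff_of_nodup (hsort X hX).nodup (hsort Y hY).nodup).2 fun a => by
      rw [← List.mem_toFinset, h, List.mem_toFinset]
  have h2 := hN x.core.toFinset (fun v hv => hx.core v (List.mem_toFinset.1 hv))
    (l.map List.toFinset).toFinset (fun X hX => by
      obtain ⟨X, hXl, rfl⟩ := List.mem_map.1 (List.mem_toFinset.1 hX)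
      obtain ⟨Y, hY⟩ := List.exists_mem_of_ne_nil _ (hl' X hXl).2
      obtain ⟨t, ht, rfl, rfl, hne⟩ := mem_petals.1 (mem_of_mem_greedy hY)
      obtain ⟨h3, h4, -⟩ := hx.hit t ht
      refine ⟨fun v hv => ?_, fun u hu v hv => ?_, ?_⟩
      · simp only [List.mem_toFinset, List.mem_filter, decide_eq_true_eq] at hv ⊢
        exact hv.2
      · simp only [List.mem_toFinset, List.mem_filter] at hu hv
        exact h4 u hu.1 v hv.1
      · refine (List.toFinset_card_le _).trans_lt ?_
        have h5 := List.length_eq_length_filter_add (l := t) (fun v => decide (v ∈ x.core))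
        have h6 := List.length_pos_iff.2 hne
        have h7 := (mem_sets.1 h3).1
        simp only [decide_not] at h6
        omega)
  rw [List.toFinset_card_of_nodup h1, List.length_map,
    List.toFinset_card_of_nodup hx.nodup] at h2
  exact h2

lemma nodup_sets : (c.sets r).Nodup := nodup_incr List.nodup_range r

lemma petals_avoid {Z : List ℕ} {N : ℕ} {x : Node} (hx : c.Inv r Z N x) {X Y : List ℕ}
    (hY : Y ∈ petalPacking x.hit x.core X) :
    Y ∈ c.sets r ∧ (∀ v ∈ Y, v ∉ Z) ∧ ∀ v ∈ Y, v ∉ x.core := by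
  classical
  obtain ⟨t, ht, rfl, rfl, hne⟩ := mem_petals.1 (mem_of_mem_greedy hY)
  obtain ⟨h3, h4, h5⟩ := hx.hit t ht
  refine ⟨sets_sublist h3 List.filter_sublist, fun v hv => h5 v (List.mem_filter.1 hv).1,
    fun v hv => ?_⟩
  simpa using (List.mem_filter.1 hv).2

lemma inv_step₂ {Z : List ℕ} {N : ℕ} (hN : ∀ W : Finset ℕ, (∀ v ∈ W, v < c.n ∧ v ∉ Z) →
      ∀ F : Finset (Finset ℕ), (∀ X ∈ F, X ⊆ W ∧ c.CliqueSet X ∧ X.card < r) →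
        F.card ≤ N * (W.card + 1))
    {x y : Node} (hx : c.Inv r Z N x) (hy : y ∈ c.step₂ r x) : c.Inv r Z N y := by
  classical
  rw [Inst.step₂] at hy
  split_ifs at hy with h
  · rw [List.mem_singleton] at hy; exact hy ▸ hx
  rcases List.mem_cons.1 hy with rfl | hy
  · refine ⟨?_, ?_, hx.pack, hx.pack_le, List.nodup_range.filter _, ?_, ?_⟩
    · simp only [Inst.next]; omega
    · intro t ht
      obtain ⟨h1, h2⟩ := List.mem_filter.1 ht
      simp only [decide_eq_true_eq] at h2
      rcases h2 with h2 | h2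
      · exact hx.hit t h2
      · obtain ⟨Y, hY⟩ := List.exists_mem_of_length_pos (Nat.zero_lt_of_lt h2)
        obtain ⟨t', ht', rfl, rfl, hne⟩ := mem_petals.1 (mem_of_mem_greedy hY)
        obtain ⟨h3, h4, h5⟩ := hx.hit t' ht'
        exact ⟨h1, fun u hu v hv => h4 u (List.mem_filter.1 hu).1 v (List.mem_filter.1 hv).1,
          fun v hv => h5 v (List.mem_filter.1 hv).1⟩
    · intro v hv
      obtain ⟨h1, h2⟩ := List.mem_filter.1 hv
      simp only [decide_eq_true_eq] at h2
      rcases h2 with h2 | ⟨X, -, -, Y, hY, hvY⟩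
      · exact hx.core v h2
      · exact ⟨List.mem_range.1 h1, (petals_avoid hx hY).2.1 v hvY⟩
    · let l := (c.sets r).filter fun X => petalPacking x.hit x.core X ≠ [] ∧
        (petalPacking x.hit x.core X).length ≤ c.τ
      have h1 := length_active_le hN hx (l := l) (nodup_sets.filter _) fun X hX => by
        have := List.mem_filter.1 hX
        simp only [decide_eq_true_eq] at this
        exact ⟨this.1, this.2.1⟩
      have h2 : (c.next r x).core ⊆
          x.core ++ l.flatMap fun X => (petalPacking x.hit x.core X).flatten := by
        intro v hv
        have h2 := (List.mem_filter.1 hv).2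
        simp only [decide_eq_true_eq] at h2
        rcases h2 with h2 | ⟨X, hX, hXτ, Y, hY, hvY⟩
        · exact List.mem_append_left _ h2
        · refine List.mem_append_right _ (List.mem_flatMap.2 ⟨X, List.mem_filter.2 ⟨hX, ?_⟩,
            List.mem_flatten.2 ⟨Y, hY, hvY⟩⟩)
          simp only [decide_eq_true_eq]
          exact ⟨List.ne_nil_of_mem hY, hXτ⟩
      have h3 := ((List.nodup_range.filter _).subperm h2).length_le
      have h4 : (l.flatMap fun X => (petalPacking x.hit x.core X).flatten).length ≤
          l.length * (c.τ * r) := by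
        rw [List.length_flatMap]
        refine (List.sum_le_card_nsmul _ (c.τ * r) ?_).trans (by simp)
        intro m hm
        obtain ⟨X, hX, rfl⟩ := List.mem_map.1 hm
        have h5 := (List.mem_filter.1 hX).2
        simp only [decide_eq_true_eq] at h5
        rw [List.length_flatten]
        refine (List.sum_le_card_nsmul _ r ?_).trans ?_
        · intro m hm
          obtain ⟨Y, hY, rfl⟩ := List.mem_map.1 hm
          exact (mem_sets.1 (petals_avoid hx hY).1).1
        · rw [List.length_map, smul_eq_mul]; exact Nat.mul_le_mul_right r h5.2
      have h5 := Nat.mul_le_mul_right (c.τ * r) h1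
      rw [List.length_append] at h3
      calc (c.next r x).core.length + 1 ≤ (x.core.length + 1) * (1 + N * c.τ * r) := by
            refine (Nat.add_le_add_right (h3.trans (Nat.add_le_add_left (h4.trans h5) _)) 1).trans
              (le_of_eq (by ring))
        _ ≤ (r * c.k + 1) * (1 + N * c.τ * r) ^ x.stage * (1 + N * c.τ * r) :=
            Nat.mul_le_mul_right _ hx.core_le
        _ = _ := by simp only [Inst.next]; ring
  · obtain ⟨X, hX, rfl⟩ := List.mem_map.1 hy
    obtain ⟨h1, h2⟩ := List.mem_filter.1 hX
    simp only [decide_eq_true_eq] at h2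
    have hp : ∀ t ∈ (c.child r x X).pack, t ∈ c.sets r ∧ ∀ v ∈ t, v ∉ Z := by
      intro t ht
      rcases List.mem_append.1 ht with ht | ht
      · exact hx.pack t ht
      · exact ⟨(petals_avoid hx ht).1, (petals_avoid hx ht).2.1⟩
    refine ⟨Nat.zero_le _, ?_, hp, ?_, List.nodup_range.filter _, ?_, ?_⟩
    · intro t ht
      obtain ⟨h3, h4⟩ := List.mem_filter.1 ht
      simp only [decide_eq_true_eq] at h4
      rcases h4 with h4 | h4
      · exact hx.hit t h4
      · obtain ⟨t', ht', rfl, rfl, hne⟩ := mem_petals.1 h4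
        obtain ⟨h5, h6, h7⟩ := hx.hit t' ht'
        exact ⟨h3, fun u hu v hv => h6 u (List.mem_filter.1 hu).1 v (List.mem_filter.1 hv).1,
          fun v hv => h7 v (List.mem_filter.1 hv).1⟩
    · simp only [Inst.child, List.length_append]; exact h2.2
    · intro v hv
      obtain ⟨h3, h4⟩ := List.mem_filter.1 hv
      simp only [decide_eq_true_eq] at h4
      obtain ⟨Y, hY, hvY⟩ := h4
      exact ⟨List.mem_range.1 h3, (hp Y hY).2 v hvY⟩
    · have h3 : (c.child r x X).core ⊆ (c.child r x X).pack.flatten := by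
        intro v hv
        have h4 := (List.mem_filter.1 hv).2
        simp only [decide_eq_true_eq] at h4
        obtain ⟨Y, hY, hvY⟩ := h4
        exact List.mem_flatten.2 ⟨Y, hY, hvY⟩
      have h4 := ((List.nodup_range.filter _).subperm h3).length_le
      have h5 : (c.child r x X).pack.flatten.length ≤ (c.child r x X).pack.length * r := by
        rw [List.length_flatten]
        refine (List.sum_le_card_nsmul _ r ?_).trans (by simp)
        intro m hm
        obtain ⟨Y, hY, rfl⟩ := List.mem_map.1 hm
        exact (mem_sets.1 (hp Y hY).1).1
      have h6 : (c.child r x X).pack.length ≤ c.k := by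
        simp only [Inst.child, List.length_append]; exact h2.2
      have h7 := Nat.mul_le_mul_right r h6
      rw [mul_comm c.k] at h7
      exact (Nat.add_le_add_right (h4.trans (h5.trans h7)) 1).trans (by simp [Inst.child])

lemma length_step₂_le {Z : List ℕ} {N : ℕ} (hN : ∀ W : Finset ℕ, (∀ v ∈ W, v < c.n ∧ v ∉ Z) →
      ∀ F : Finset (Finset ℕ), (∀ X ∈ F, X ⊆ W ∧ c.CliqueSet X ∧ X.card < r) →
        F.card ≤ N * (W.card + 1))
    {x : Node} (hx : c.Inv r Z N x) :
    (c.step₂ r x).length ≤ N * ((r * c.k + 1) * (1 + N * c.τ * r) ^ r) + 1 := by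
  classical
  rw [Inst.step₂]
  split_ifs with h
  · simp
  rw [List.length_cons, List.length_map]
  refine Nat.add_le_add_right ((length_active_le hN hx (nodup_sets.filter _) fun X hX => ?_).trans
    (Nat.mul_le_mul_left _ (hx.core_le.trans (Nat.mul_le_mul_left _
      (Nat.pow_le_pow_right (by omega) hx.stage_le))))) 1
  have := List.mem_filter.1 hX
  simp only [decide_eq_true_eq] at this
  exact ⟨this.1, List.length_pos_iff.1 (Nat.zero_lt_of_lt this.2.1)⟩

lemma consistent_step₂ {Z : List ℕ} {N : ℕ} {S : Finset ℕ} (hSk : S.card ≤ c.k) {i : ℕ} {x : Node}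
    (hx : c.Inv r Z N x) (hxS : c.Consistent r Z S i x) :
    ∃ y ∈ c.step₂ r x, c.Consistent r Z S (i + 1) y := by
  classical
  obtain ⟨g, hg, hgi⟩ := hxS.depth
  rw [Inst.step₂]
  split_ifs with h
  · exact ⟨x, List.mem_singleton_self x, hxS.hit, hxS.pairwise, hxS.pack, hxS.pack_core,
      hxS.targets, hxS.progress, g, hg, .inl (le_antisymm hx.stage_le h)⟩
  have hstage : i ≤ (r + 1) * g + x.stage := hgi.resolve_left (by omega)
  have hinter : ∀ t : List ℕ, ∀ v, v ∈ t → v ∈ t.filter (· ∈ x.core) ∨ v ∈ t.filter (· ∉ x.core) := by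
    intro t v hv
    by_cases h : v ∈ x.core <;> simp [hv, h]
  by_cases hbig : ∀ X ∈ c.sets r, c.τ < (petalPacking x.hit x.core X).length → ∃ v ∈ X, v ∈ S
  · refine ⟨_, List.mem_cons_self, ?_, hxS.pairwise, hxS.pack, ?_, ?_, ?_, g, hg, .inr ?_⟩
    · intro t ht
      obtain ⟨h1, h2⟩ := List.mem_filter.1 ht
      simp only [decide_eq_true_eq] at h2
      exact h2.elim (hxS.hit t) (hbig t h1)
    · intro t ht v hv
      have h1 := hxS.pack_core t ht v hv
      refine List.mem_filter.2 ⟨List.mem_range.2 (hx.core v h1).1, ?_⟩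
      simp only [decide_eq_true_eq]
      exact .inl h1
    · intro t ht
      obtain ⟨t', h1, h2⟩ := hxS.targets t ht
      refine ⟨t', List.mem_filter.2 ⟨(hx.hit t' h1).1, ?_⟩, h2⟩
      simp only [decide_eq_true_eq]
      exact .inl h1
    · have hcore : x.core ⊆ (c.next r x).core := fun v hv => by
        refine List.mem_filter.2 ⟨List.mem_range.2 (hx.core v hv).1, ?_⟩
        simp only [decide_eq_true_eq]
        exact .inl hv
      have hhit : ∀ t ∈ x.hit, t ∈ (c.next r x).hit := fun t ht => by
        refine List.mem_filter.2 ⟨(hx.hit t ht).1, ?_⟩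
        simp only [decide_eq_true_eq]
        exact .inl ht
      intro t ht
      obtain ⟨h1, h2⟩ := List.mem_filter.1 ht
      simp only [decide_eq_true_eq] at h2
      rcases h2 with h2 | h2
      · rcases hxS.progress t h2 with ⟨t', h3, h4, h5⟩ | ⟨X₀, h3, h4, h5⟩
        · exact .inl ⟨t', hhit t' h3, h4, fun v hv => hcore (h5 hv)⟩
        by_cases hne : t.filter (· ∉ x.core) = []
        · refine .inl ⟨t, ht, List.Subset.refl _, fun v hv => hcore ?_⟩
          rcases hinter t v hv with h6 | h6
          · simpa using (List.mem_filter.1 h6).2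
          · rw [hne] at h6; simp at h6
        -- the vertices of `t` outside the core form a petal of `t ∩ core`
        have hpet : t.filter (· ∉ x.core) ∈ petals x.hit x.core (t.filter (· ∈ x.core)) :=
          mem_petals.2 ⟨t, h2, rfl, rfl, hne⟩
        have hX : t.filter (· ∈ x.core) ∈ c.sets r := sets_sublist h1 List.filter_sublist
        by_cases hτ : c.τ < (petalPacking x.hit x.core (t.filter (· ∈ x.core))).length
        · refine .inl ⟨t.filter (· ∈ x.core), List.mem_filter.2 ⟨hX, ?_⟩, List.filter_sublist.subset, ?_⟩
          · simp only [decide_eq_true_eq]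
            exact .inr hτ
          · intro v hv
            exact hcore (by simpa using (List.mem_filter.1 hv).2)
        · have : ∃ v ∈ t, v ∉ x.core ∧ v ∈ (c.next r x).core := by
            obtain ⟨Y, hY, v, hvY, hvt⟩ : ∃ Y ∈ petalPacking x.hit x.core (t.filter (· ∈ x.core)),
                ∃ v ∈ Y, v ∈ t.filter (· ∉ x.core) := by
              rcases (greedy_spec Meets _).2.2 _ hpet with h6 | ⟨b, hb, v, h6, h7⟩
              · exact ⟨_, h6, _, List.head_mem hne, List.head_mem hne⟩
              · exact ⟨b, hb, v, h6, h7⟩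
            have hvt' := List.mem_filter.1 hvt
            refine ⟨v, hvt'.1, by simpa using hvt'.2, List.mem_filter.2 ⟨List.mem_range.2
              ((mem_sets.1 h1).2.1 v hvt'.1), ?_⟩⟩
            simp only [decide_eq_true_eq]
            exact .inr ⟨_, hX, not_lt.1 hτ, Y, hY, hvY⟩
          obtain ⟨v, hvt, hvc, hvn⟩ := this
          refine .inr ⟨t.filter (· ∈ (c.next r x).core), List.filter_sublist, fun u hu => by
            simpa using (List.mem_filter.1 hu).2, ?_⟩
          have htn : t.Nodup := (mem_sets.1 h1).2.2.nodup
          have h6 : (v :: X₀).Nodup :=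
            List.nodup_cons.2 ⟨fun hv => hvc (h4 hv), htn.sublist h3⟩
          have h7 : v :: X₀ ⊆ t.filter (· ∈ (c.next r x).core) := by
            intro u hu
            rw [List.mem_filter, decide_eq_true_eq]
            rcases List.mem_cons.1 hu with rfl | hu
            · exact ⟨hvt, hvn⟩
            · exact ⟨h3.subset hu, hcore (h4 hu)⟩
          have h8 := (h6.subperm h7).length_le
          rw [List.length_cons] at h8
          simp only [Inst.next] at h8 ⊢
          omega
      · obtain ⟨Y, hY⟩ := List.exists_mem_of_length_pos (Nat.zero_lt_of_lt h2)
        obtain ⟨t', ht', h3, -⟩ := mem_petals.1 (mem_of_mem_greedy hY)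
        refine .inl ⟨t, ht, List.Subset.refl _, fun v hv => hcore ?_⟩
        rw [← h3] at hv
        simpa using (List.mem_filter.1 hv).2
    · simp only [Inst.next]; omega
  · push Not at hbig
    obtain ⟨X, hX, hXτ, hXS⟩ := hbig
    have hpetS : ∀ Y ∈ petals x.hit x.core X, ∃ v ∈ Y, v ∈ S := by
      intro Y hY
      obtain ⟨t, ht, rfl, rfl, -⟩ := mem_petals.1 hY
      obtain ⟨v, hv, hvS⟩ := hxS.hit t ht
      exact ⟨v, (hinter t v hv).resolve_left fun h => hXS v h hvS, hvS⟩
    have hpS : ∀ Y ∈ (c.child r x X).pack, ∃ v ∈ Y, v ∈ S := by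
      intro Y hY
      rcases List.mem_append.1 hY with hY | hY
      · exact hxS.pack Y hY
      · exact hpetS Y (mem_of_mem_greedy hY)
    have hpp : (c.child r x X).pack.Pairwise fun a b => ¬Meets a b := by
      refine List.pairwise_append.2 ⟨hxS.pairwise, greedy_meets_pairwise _, ?_⟩
      rintro a ha b hb ⟨v, hva, hvb⟩
      exact (petals_avoid hx hb).2.2 v hvb (hxS.pack_core a ha v hva)
    have hpk := (length_le_card_of_pairwise hpp hpS).trans hSk
    have hhit : ∀ t ∈ x.hit, t ∈ (c.child r x X).hit := fun t ht => by
      refine List.mem_filter.2 ⟨(hx.hit t ht).1, ?_⟩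
      simp only [decide_eq_true_eq]
      exact .inl ht
    refine ⟨c.child r x X, List.mem_cons_of_mem _ (List.mem_map.2 ⟨X, List.mem_filter.2 ⟨hX, ?_⟩,
      rfl⟩), ?_, hpp, hpS, ?_, ?_, ?_, g + 1, ?_, .inr ?_⟩
    · simp only [decide_eq_true_eq]
      simp only [Inst.child, List.length_append] at hpk
      exact ⟨hXτ, hpk⟩
    · intro t ht
      have h2 := (List.mem_filter.1 ht).2
      simp only [decide_eq_true_eq] at h2
      exact h2.elim (hxS.hit t) (hpetS t)
    · intro t ht v hv
      refine List.mem_filter.2 ⟨List.mem_range.2 ?_, ?_⟩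
      · rcases List.mem_append.1 ht with ht | ht
        · exact (mem_sets.1 (hx.pack t ht).1).2.1 v hv
        · exact (mem_sets.1 (petals_avoid hx ht).1).2.1 v hv
      · simp only [decide_eq_true_eq]
        exact ⟨t, ht, hv⟩
    · intro t ht
      obtain ⟨t', h1, h2⟩ := hxS.targets t ht
      exact ⟨t', hhit t' h1, h2⟩
    · intro t _
      exact .inr ⟨[], List.nil_sublist _, by simp, by simp [Inst.child]⟩
    · simp only [Inst.child, List.length_append]
      rw [add_mul, one_mul]; omega
    · simp only [Inst.child]
      rw [mul_add, mul_one]; omega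

lemma exists_mem_phase₂ {Z : List ℕ} {N : ℕ} (hN : ∀ W : Finset ℕ, (∀ v ∈ W, v < c.n ∧ v ∉ Z) →
      ∀ F : Finset (Finset ℕ), (∀ X ∈ F, X ⊆ W ∧ c.CliqueSet X ∧ X.card < r) →
        F.card ≤ N * (W.card + 1))
    {S : Finset ℕ} (hSk : S.card ≤ c.k) (hS : ∀ t ∈ c.targets r [], ∃ v ∈ t, v ∈ S)
    (hfuel : (N * ((r * c.k + 1) * (1 + N * c.τ * r) ^ r) + 1) ^ c.T₂ ≤ c.fuel)
    (hT : (r + 1) * (c.k / (c.τ + 1) + 1) ≤ c.T₂) :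
    ∃ x ∈ c.phase₂ r Z, c.Inv r Z N x ∧ (∀ t ∈ x.hit, ∃ v ∈ t, v ∈ S) ∧
      ∀ t ∈ c.targets r Z, ∃ t' ∈ x.hit, t' ⊆ t ∧ t' ⊆ x.core := by
  classical
  have hroot : c.Inv r Z N (c.root r Z) := by
    refine ⟨Nat.zero_le _, fun t ht => ?_, by simp [Inst.root], by simp [Inst.root],
      by simp [Inst.root], by simp [Inst.root], by simp [Inst.root]⟩
    obtain ⟨h1, -, h2, h3⟩ := mem_targets.1 ht
    exact ⟨h1, h2, h3⟩
  have hrootS : c.Consistent r Z S 0 (c.root r Z) := by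
    refine ⟨fun t ht => hS t ?_, by simp [Inst.root], by simp [Inst.root], by simp [Inst.root],
      fun t ht => ⟨t, ht, List.Subset.refl _⟩,
      fun t _ => .inr ⟨[], List.nil_sublist _, by simp, by simp [Inst.root]⟩, 0, by simp, by simp⟩
    obtain ⟨h1, h2, h3, -⟩ := mem_targets.1 ht
    exact mem_targets.2 ⟨h1, h2, h3, by simp⟩
  obtain ⟨x, hx, hx1, hx2⟩ := exists_mem_grow (B := c.step₂ r) (fuel := c.fuel)
    (c.Inv r Z N) (fun i x => c.Inv r Z N x ∧ c.Consistent r Z S i x) hroot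
    (fun x hx y hy => inv_step₂ hN hx hy) (fun x hx => length_step₂_le hN hx) ⟨hroot, hrootS⟩
    (by omega) c.T₂ hfuel fun i _ x hx ⟨_, hxS⟩ => by
      obtain ⟨y, hy, hyS⟩ := consistent_step₂ hSk hx hxS
      exact ⟨y, hy, inv_step₂ hN hx hy, hyS⟩
  refine ⟨x, hx, hx1, hx2.hit, fun t ht => ?_⟩
  obtain ⟨g, hg, hgi⟩ := hx2.depth
  have hstage : x.stage = r := by
    refine hgi.resolve_right fun h => ?_
    have h1 : g ≤ c.k / (c.τ + 1) :=
      (Nat.le_div_iff_mul_le (by omega)).2 (hg.trans hx1.pack_le)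
    have h2 := Nat.mul_le_mul_left (r + 1) h1
    have h3 := hx1.stage_le
    rw [mul_add, mul_one] at hT
    omega
  obtain ⟨t', h1, h2⟩ := hx2.targets t ht
  rcases hx2.progress t' h1 with ⟨t'', h3, h4, h5⟩ | ⟨X, h3, h4, h5⟩
  · exact ⟨t'', h3, fun v hv => h2 (h4 hv), h5⟩
  · have h6 : X = t' := h3.eq_of_length_le (by
      have := (mem_sets.1 (hx1.hit t' h1).1).1; omega)
    exact ⟨t', h1, h2, h6 ▸ h4⟩

end PackingBranching

/-! ### Components and the linear order -/

section Order

variable {c : Inst}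

/-- Adjacency inside the set `W`. -/
def Inst.AdjIn (c : Inst) (W : ℕ → Prop) (u v : ℕ) : Prop := W u ∧ W v ∧ c.Adj u v

/-- The iteration in `Inst.component` computes the set of vertices that can be reached. -/
lemma component_eq {W : List ℕ} [DecidablePred (Relation.ReflTransGen (c.AdjIn (· ∈ W)) v)] (hv : v ∈ W) :
    c.component W v = W.filter (Relation.ReflTransGen (c.AdjIn (· ∈ W)) v) := by
  classical
  let F : List ℕ → List ℕ := fun A => W.filter fun u => u ∈ A ∨ ∃ a ∈ A, c.Adj a u
  have hF : ∀ A u, u ∈ F A ↔ u ∈ W ∧ (u ∈ A ∨ ∃ a ∈ A, c.Adj a u) := fun A u => by simp [F]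
  have h1 : ∀ i, (∀ u ∈ F^[i] [v], u ∈ W ∧ Relation.ReflTransGen (c.AdjIn (· ∈ W)) v u) ∧
      v ∈ F^[i] [v] ∧ ((∀ a ∈ F^[i] [v], ∀ u ∈ W, c.Adj a u → u ∈ F^[i] [v]) ∨
        i + 1 ≤ (F^[i] [v]).toFinset.card) := by
    intro i
    induction i with
    | zero => simp [hv, Relation.ReflTransGen.refl]
    | succ i ih =>
      obtain ⟨h2, h3, h4⟩ := ih
      rw [Function.iterate_succ_apply']
      set A := F^[i] [v] with hA
      have hsub : ∀ u ∈ A, u ∈ F A := fun u hu => (hF A u).2 ⟨(h2 u hu).1, .inl hu⟩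
      refine ⟨fun u hu => ?_, hsub v h3, ?_⟩
      · obtain ⟨hu1, hu2⟩ := (hF A u).1 hu
        rcases hu2 with hu2 | ⟨a, ha, hau⟩
        · exact h2 u hu2
        · exact ⟨hu1, (h2 a ha).2.tail ⟨(h2 a ha).1, hu1, hau⟩⟩
      · by_cases hcl : ∀ a ∈ A, ∀ u ∈ W, c.Adj a u → u ∈ A
        · left
          intro a ha u hu hau
          refine hsub u (hcl a ?_ u hu hau)
          obtain ⟨ha1, ha2 | ⟨b, hb, hba⟩⟩ := (hF A a).1 ha
          · exact ha2
          · exact hcl b hb a ha1 hba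
        · right
          have h5 := h4.resolve_left hcl
          push Not at hcl
          obtain ⟨a, ha, u, hu, hau, huA⟩ := hcl
          have h6 : insert u A.toFinset ⊆ (F A).toFinset := by
            intro w hw
            rw [List.mem_toFinset]
            rcases Finset.mem_insert.1 hw with rfl | hw
            · exact (hF A w).2 ⟨hu, .inr ⟨a, ha, hau⟩⟩
            · exact hsub w (List.mem_toFinset.1 hw)
          have h7 := Finset.card_le_card h6
          rw [Finset.card_insert_of_notMem (by simpa using huA)] at h7
          omega
  obtain ⟨h2, h3, h4⟩ := h1 W.length
  have hcl : ∀ a ∈ F^[W.length] [v], ∀ u ∈ W, c.Adj a u → u ∈ F^[W.length] [v] := by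
    refine h4.resolve_right fun h => ?_
    have h5 := Finset.card_le_card (fun u hu => List.mem_toFinset.2 (h2 u (List.mem_toFinset.1 hu)).1 :
      (F^[W.length] [v]).toFinset ⊆ W.toFinset)
    have := List.toFinset_card_le W
    omega
  have hmem : ∀ u, Relation.ReflTransGen (c.AdjIn (· ∈ W)) v u → u ∈ F^[W.length] [v] := by
    intro u hu
    induction hu with
    | refl => exact h3
    | tail _ hab ih => exact hcl _ ih _ hab.2.1 hab.2.2
  -- both sides filter `W`, so that it suffices to compare the elements
  obtain ⟨m, hm⟩ : ∃ m, W.length = m + 1 := Nat.exists_eq_succ_of_ne_zero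
    (List.length_pos_of_mem hv).ne'
  have h5 : c.component W v = F^[W.length] [v] := rfl
  have h6 : F^[W.length] [v] = W.filter fun u => u ∈ F^[m] [v] ∨ ∃ a ∈ F^[m] [v], c.Adj a u := by
    rw [hm, Function.iterate_succ_apply']
  rw [h5, h6]
  refine List.filter_congr fun u hu => ?_
  have h7 : u ∈ F^[W.length] [v] ↔ u ∈ F^[m] [v] ∨ ∃ a ∈ F^[m] [v], c.Adj a u := by
    rw [h6]; simp [hu]
  rw [decide_eq_decide, ← h7]
  exact ⟨fun h => (h2 u h).2, hmem u⟩

lemma mem_components {W K : List ℕ} : K ∈ c.components W ↔ ∃ v ∈ W, c.component W v = K := by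
  rw [← List.mem_map]
  constructor
  · exact mem_of_mem_greedy
  · intro h
    rcases (greedy_spec (· = ·) (W.map (c.component W))).2.2 K h with h1 | ⟨b, hb, rfl⟩
    · exact h1
    · exact hb

lemma reach_symm (hc : c.IsGraph) {W : List ℕ} (hW : ∀ v ∈ W, v < c.n)
    {u v : ℕ} (h : Relation.ReflTransGen (c.AdjIn (· ∈ W)) u v) :
    Relation.ReflTransGen (c.AdjIn (· ∈ W)) v u := by
  induction h with
  | refl => exact .refl
  | tail _ h ih => exact ih.head ⟨h.2.1, h.1, hc.symm _ (hW _ h.1) _ (hW _ h.2.1) h.2.2⟩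

/-- Two components with a common vertex, or with adjacent vertices, are equal. -/
lemma components_eq_of_reach (hc : c.IsGraph) {W : List ℕ} (hW : ∀ v ∈ W, v < c.n) {K K' : List ℕ}
    (hK : K ∈ c.components W) (hK' : K' ∈ c.components W) {u v : ℕ} (hu : u ∈ K) (hv : v ∈ K')
    (huv : Relation.ReflTransGen (c.AdjIn (· ∈ W)) u v) : K = K' := by
  classical
  obtain ⟨a, ha, rfl⟩ := mem_components.1 hK
  obtain ⟨b, hb, rfl⟩ := mem_components.1 hK'
  rw [component_eq ha] at hu ⊢
  rw [component_eq hb] at hv ⊢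
  simp only [List.mem_filter, decide_eq_true_eq] at hu hv
  have hab : Relation.ReflTransGen (c.AdjIn (· ∈ W)) a b := (hu.2.trans huv).trans (reach_symm hc hW hv.2)
  refine List.filter_congr fun w _ => ?_
  rw [decide_eq_decide]
  exact ⟨fun h => (reach_symm hc hW hab).trans h, fun h => hab.trans h⟩

lemma components_pairwise {W : List ℕ} : (c.components W).Pairwise (· ≠ ·) :=
  (List.pairwise_reverse.1 (greedy_spec (· = ·) (W.map (c.component W))).2.1).imp fun h => Ne.symm h

lemma flatten_components_perm (hc : c.IsGraph) {W : List ℕ} (hW : ∀ v ∈ W, v < c.n)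
    (hWn : W.Nodup) : (c.components W).flatten.Perm W := by
  classical
  refine (List.perm_ext_iff_of_nodup ?_ hWn).2 fun u => ?_
  · refine List.nodup_flatten.2 ⟨fun K hK => hWn.sublist (sublist_of_mem_components hK), ?_⟩
    refine components_pairwise.imp_of_mem fun {K K'} hK hK' hne u hu hu' => hne ?_
    exact components_eq_of_reach hc hW hK hK' hu hu' .refl
  · rw [List.mem_flatten]
    constructor
    · rintro ⟨K, hK, hu⟩
      exact (sublist_of_mem_components hK).subset hu
    · intro hu
      refine ⟨_, mem_components.2 ⟨u, hu, rfl⟩, ?_⟩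
      rw [component_eq hu, List.mem_filter]
      exact ⟨hu, by simpa using Relation.ReflTransGen.refl⟩

lemma pieces_perm (hc : c.IsGraph) {U S : List ℕ} (hU : ∀ v ∈ U, v < c.n) (hUn : U.Nodup) :
    (c.pieces U S).flatten.Perm U := by
  classical
  rw [Inst.pieces, List.flatten_append]
  have h1 : ∀ l : List ℕ, (l.map ([·])).flatten = l := fun l => by
    induction l with
    | nil => rfl
    | cons a l ih => rw [List.map_cons, List.flatten_cons, ih]; rfl
  rw [h1]
  have h2 := flatten_components_perm hc (W := U.filter (· ∉ S))
    (fun v hv => hU v (List.mem_filter.1 hv).1) (hUn.filter _)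
  refine (h2.append_left _).trans ?_
  simp only [decide_not]
  exact List.filter_append_perm _ _

lemma split_perm (hc : c.IsGraph) {Λ : List (List ℕ)} {U : List ℕ} (hU : ∀ v ∈ U, v < c.n)
    (hUn : U.Nodup) : (c.split Λ U).flatten.Perm U := by
  rw [Inst.split]
  split_ifs with h1 h2
  · simp [h1]
  · simp
  · exact pieces_perm hc hU hUn

lemma length_split_le {Λ : List (List ℕ)} {U : List ℕ} : (c.split Λ U).length ≤ U.length := by
  classical
  rw [Inst.split]
  split_ifs with h1 h2
  · simp
  · rw [List.length_singleton]
    exact Nat.pos_of_ne_zero fun h => h1 (List.length_eq_zero_iff.1 h)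
  · rw [Inst.pieces, List.length_append, List.length_map]
    have h3 : (c.components (U.filter (· ∉ ((Λ.filter (c.Balanced U)).headD [])))).length ≤ _ :=
      length_greedy_le _ _
    rw [List.length_map] at h3
    have h4 := List.length_eq_length_filter_add (l := U)
      (fun v => decide (v ∈ ((Λ.filter (c.Balanced U)).headD [])))
    simp only [decide_not] at h3
    simp only [decide_not]
    omega

/-- The number of elements of `P` with a neighbour in `Q`. -/
noncomputable def Inst.boundary (c : Inst) (P : Finset ℕ) (Q : List ℕ) : Finset ℕ :=
  open Classical in P.filter fun u => ∃ v ∈ Q, c.Adj u v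

/-- An ordered partition, preceded by the set `P`, in which at most `w` vertices before a part have
neighbours in or after that part, and in which parts with at least two elements have no neighbours
after them. -/
def Inst.Layout (c : Inst) (w : ℕ) : Finset ℕ → List (List ℕ) → Prop
  | _, [] => True
  | P, U :: B => (c.boundary P (U ++ B.flatten)).card ≤ w ∧
      (2 ≤ U.length → ∀ u ∈ U, ∀ v ∈ B.flatten, ¬c.Adj u v) ∧ c.Layout w (P ∪ U.toFinset) B

lemma mem_boundary {P : Finset ℕ} {Q : List ℕ} {u : ℕ} :
    u ∈ c.boundary P Q ↔ u ∈ P ∧ ∃ v ∈ Q, c.Adj u v := by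
  simp [Inst.boundary]

/-- Replacing a part without later neighbours by a list `F` of parts, where only the elements of `S`
have neighbours in later parts. -/
lemma Layout.prepend {w : ℕ} {S T : Finset ℕ} {B : List (List ℕ)} (hST : ∀ u ∈ S, u ∈ T)
    (hT : T.card ≤ w) : ∀ (F : List (List ℕ)) (P : Finset ℕ),
      F.Pairwise (fun K K' => ∀ u ∈ K, u ∉ S → ∀ v ∈ K', ¬c.Adj u v) →
      (∀ K ∈ F, 2 ≤ K.length → ∀ u ∈ K, u ∉ S) →
      (∀ K ∈ F, ∀ u ∈ K, ∀ v ∈ B.flatten, ¬c.Adj u v) →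
      (∀ u ∈ P, (∃ v ∈ F.flatten ++ B.flatten, c.Adj u v) → u ∈ T) →
      c.Layout w (P ∪ F.flatten.toFinset) B → c.Layout w P (F ++ B)
  | [], P, _, _, _, _, hB => by simpa using hB
  | K :: F, P, hF, hKS, hKB, hP, hB => by
    rw [List.pairwise_cons] at hF
    refine ⟨(Finset.card_le_card fun u hu => ?_).trans hT, ?_, ?_⟩
    · obtain ⟨h1, v, hv, huv⟩ := mem_boundary.1 hu
      refine hP u h1 ⟨v, ?_, huv⟩
      simpa [List.flatten_cons, or_assoc] using hv
    · intro hK u hu v hv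
      change v ∈ (F ++ B).flatten at hv
      rw [List.flatten_append] at hv
      rcases List.mem_append.1 hv with hv | hv
      · obtain ⟨K', hK', hv⟩ := List.mem_flatten.1 hv
        exact hF.1 K' hK' u hu (hKS K List.mem_cons_self hK u hu) v hv
      · exact hKB K List.mem_cons_self u hu v hv
    · refine Layout.prepend hST hT F _ hF.2 (fun K' h => hKS K' (List.mem_cons_of_mem _ h))
        (fun K' h => hKB K' (List.mem_cons_of_mem _ h)) ?_ ?_
      · rintro u hu ⟨v, hv, huv⟩
        rcases Finset.mem_union.1 hu with hu | hu
        · refine hP u hu ⟨v, ?_, huv⟩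
          rw [List.flatten_cons, List.append_assoc]
          exact List.mem_append_right _ hv
        · rw [List.mem_toFinset] at hu
          by_contra huT
          have huS : u ∉ S := fun h => huT (hST u h)
          rcases List.mem_append.1 hv with hv | hv
          · obtain ⟨K', hK', hv⟩ := List.mem_flatten.1 hv
            exact hF.1 K' hK' u hu huS v hv huv
          · exact hKB K List.mem_cons_self u hu v hv huv
      · rwa [List.flatten_cons, List.toFinset_append, ← Finset.union_assoc] at hB

lemma headD_eq_head {α : Type} {l : List α} {a : α} (h : l ≠ []) : l.headD a = l.head h := by
  cases l with
  | nil => exact absurd rfl h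
  | cons a l => rfl

/-- One round of splitting adds at most `s` vertices to the boundaries: after a part has been split, only
the elements of the separator have neighbours in the pieces that follow. -/
lemma Layout.flatMap_split (hc : c.IsGraph) {Λ : List (List ℕ)} {s : ℕ} (hΛs : ∀ S ∈ Λ, S.length ≤ s)
    {w : ℕ} : ∀ (L : List (List ℕ)) (P : Finset ℕ), (∀ U ∈ L, ∀ v ∈ U, v < c.n) →
      (∀ U ∈ L, U.Nodup) → (∀ U ∈ L, 2 ≤ U.length → ∃ S ∈ Λ, c.Balanced U S) →
      c.Layout w P L → c.Layout (w + s) P (L.flatMap (c.split Λ))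
  | [], _, _, _, _, _ => trivial
  | U :: L, P, hn, hnd, hbal, ⟨h1, h2, h3⟩ => by
    classical
    have hUn := hn U List.mem_cons_self
    have hUnd := hnd U List.mem_cons_self
    have ih := Layout.flatMap_split hc hΛs L _ (fun K h => hn K (List.mem_cons_of_mem _ h))
      (fun K h => hnd K (List.mem_cons_of_mem _ h)) (fun K h => hbal K (List.mem_cons_of_mem _ h)) h3
    have hflat : ∀ v, v ∈ (L.flatMap (c.split Λ)).flatten ↔ v ∈ L.flatten := by
      intro v
      simp only [List.mem_flatten, List.mem_flatMap]
      constructor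
      · rintro ⟨K, ⟨U', hU', hK⟩, hv⟩
        exact ⟨U', hU', (sublist_of_mem_split hK).subset hv⟩
      · rintro ⟨U', hU', hv⟩
        have := (split_perm hc (Λ := Λ) (hn U' (List.mem_cons_of_mem _ hU'))
          (hnd U' (List.mem_cons_of_mem _ hU'))).mem_iff.2 hv
        obtain ⟨K, hK, hv⟩ := List.mem_flatten.1 this
        exact ⟨K, ⟨U', hU', hK⟩, hv⟩
    have hperm := split_perm hc (Λ := Λ) hUn hUnd
    rw [List.flatMap_cons]
    have ih' : c.Layout (w + s) (P ∪ (c.split Λ U).flatten.toFinset) (L.flatMap (c.split Λ)) := by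
      rwa [List.toFinset_eq_of_perm _ _ hperm]
    rw [Inst.split] at hperm ih' ⊢
    split_ifs at hperm ih' ⊢ with h4 h5
    · simpa using ih'
    · -- a part that is not split has at most one element
      have hU1 : U.length ≤ 1 := by
        by_contra hU2
        obtain ⟨S, hS, hbS⟩ := hbal U List.mem_cons_self (by omega)
        have := h5.resolve_left hU2
        rw [List.filter_eq_nil_iff] at this
        exact this S hS (by simpa using hbS)
      refine ⟨le_trans (le_of_eq (congrArg _ ?_)) (h1.trans (Nat.le_add_right w s)),
        fun h => by omega, by simpa using ih'⟩
      ext u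
      simp only [List.append_eq, List.nil_append, mem_boundary, List.mem_append, hflat]
    · push Not at h5
      have hS := List.head_mem h5.2
      set S := (Λ.filter (c.Balanced U)).headD [] with hSdef
      have hSe : S = (Λ.filter (c.Balanced U)).head h5.2 := headD_eq_head _
      rw [← hSe, List.mem_filter] at hS
      have hW : ∀ v ∈ U.filter (· ∉ S), v < c.n := fun v hv => hUn v (List.mem_filter.1 hv).1
      have hsub : ∀ K ∈ c.pieces U S, ∀ u ∈ K, u ∈ U := fun K hK u hu =>
        hperm.mem_iff.1 (List.mem_flatten.2 ⟨K, hK, hu⟩)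
      refine Layout.prepend (S := S.toFinset) (T := c.boundary P (U ++ L.flatten) ∪ S.toFinset)
        (fun u hu => Finset.mem_union_right _ hu) ((Finset.card_union_le _ _).trans
          (Nat.add_le_add h1 ((List.toFinset_card_le S).trans (hΛs S hS.1)))) _ _ ?_ ?_ ?_ ?_ ih'
      · rw [Inst.pieces, List.pairwise_append]
        refine ⟨?_, ?_, ?_⟩
        · rw [List.pairwise_map]
          refine List.pairwise_of_forall_mem_list fun a ha b hb u hu huS => ?_
          rw [List.mem_singleton] at hu
          subst hu
          simp only [List.mem_filter, decide_eq_true_eq] at ha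
          exact absurd (List.mem_toFinset.2 ha.2) huS
        · refine components_pairwise.imp_of_mem fun {K K'} hK hK' hne u hu _ v hv huv => hne ?_
          refine components_eq_of_reach hc hW hK hK' hu hv (.single ⟨?_, ?_, huv⟩)
          · exact (sublist_of_mem_components hK).subset hu
          · exact (sublist_of_mem_components hK').subset hv
        · intro K hK K' _ u hu huS
          obtain ⟨a, ha, rfl⟩ := List.mem_map.1 hK
          rw [List.mem_singleton] at hu
          subst hu
          simp only [List.mem_filter, decide_eq_true_eq] at ha
          exact absurd (List.mem_toFinset.2 ha.2) huS
      · intro K hK hK2 u hu huS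
        rcases List.mem_append.1 hK with hK | hK
        · obtain ⟨a, -, rfl⟩ := List.mem_map.1 hK
          simp at hK2
        · have := (List.mem_filter.1 ((sublist_of_mem_components hK).subset hu)).2
          simp only [decide_eq_true_eq] at this
          exact this (List.mem_toFinset.1 huS)
      · intro K hK u hu v hv
        exact h2 (by omega) u (hsub K hK u hu) v ((hflat v).1 hv)
      · rintro u hu ⟨v, hv, huv⟩
        refine Finset.mem_union_left _ (mem_boundary.2 ⟨hu, v, ?_, huv⟩)
        rcases List.mem_append.1 hv with hv | hv
        · exact List.mem_append_left _ (hperm.mem_iff.1 hv)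
        · exact List.mem_append_right _ ((hflat v).1 hv)

/-- If all parts are small, then the layout bounds the boundary of every initial segment. -/
lemma Layout.boundary_le {w : ℕ} : ∀ (L : List (List ℕ)) (P : Finset ℕ), (∀ U ∈ L, U.length ≤ 1) →
    c.Layout w P L → ∀ l₁ v l₂, L.flatten = l₁ ++ v :: l₂ →
      (c.boundary (P ∪ l₁.toFinset) (v :: l₂)).card ≤ w
  | [], _, _, _, l₁, v, l₂, h => by simp at h
  | [] :: L, P, hL, ⟨_, _, h3⟩, l₁, v, l₂, h =>
    Layout.boundary_le L P (fun U hU => hL U (List.mem_cons_of_mem _ hU)) (by simpa using h3) l₁ v l₂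
      (by simpa using h)
  | (a :: b :: U) :: L, _, hL, _, _, _, _, _ => by
    have := hL _ List.mem_cons_self
    simp at this
  | [a] :: L, P, hL, ⟨h1, _, h3⟩, l₁, v, l₂, h => by
    cases l₁ with
    | nil =>
      simp only [List.flatten_cons, List.singleton_append, List.nil_append] at h h1
      rw [← h]
      simpa using h1
    | cons b l₁ =>
      simp only [List.flatten_cons, List.cons_append, List.cons.injEq] at h
      obtain ⟨rfl, h⟩ := h
      have := Layout.boundary_le L _ (fun U hU => hL U (List.mem_cons_of_mem _ hU)) h3 l₁ v l₂ h
      rw [Finset.union_assoc, ← List.toFinset_append] at this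
      exact this

lemma mem_words {M S : List ℕ} (hfuel : (M.length + 1) ^ c.s ≤ c.fuel) (hS : S.length = c.s)
    (hSM : ∀ v ∈ S, v ∈ M) : S ∈ c.words M := by
  obtain ⟨a, ha, hTa⟩ := exists_mem_grow (B := fun t => M.map (· :: t)) (fuel := c.fuel)
    (L := M.length + 1) (s := []) (fun _ => True) (fun i a => a = S.drop (c.s - i)) trivial
    (fun _ _ _ _ => trivial) (fun a _ => by simp) (by simp [← hS]) (by omega) c.s hfuel
    (fun i hi a _ ha => by
      have h1 : c.s - (i + 1) < S.length := by omega
      refine ⟨S[c.s - (i + 1)] :: a, List.mem_map.2 ⟨_, hSM _ (List.getElem_mem h1), rfl⟩, ?_⟩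
      rw [List.drop_eq_getElem_cons h1, ha, show c.s - (i + 1) + 1 = c.s - i by omega])
  simp at hTa
  exact hTa ▸ ha

lemma length_of_mem_words {M S : List ℕ} (hS : S ∈ c.words M) : S.length = c.s :=
  grow_invariant (fun i t => t.length = i) c.s rfl (fun i _ t ht t' ht' => by
    obtain ⟨v, -, rfl⟩ := List.mem_map.1 ht'
    rw [List.length_cons, ht]) S hS

/-- Every nonempty subset of `M` has a nonempty balanced separator with at most `s` elements. -/
def Inst.HasSeparators (c : Inst) (s : ℕ) (M : List ℕ) : Prop :=
  open Classical in
  ∀ U : Finset ℕ, (∀ v ∈ U, v ∈ M) → U.Nonempty → ∃ S ⊆ U, S.Nonempty ∧ S.card ≤ s ∧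
    ∀ v ∈ U \ S, 2 * ((U \ S).filter fun u =>
      Relation.ReflTransGen (c.AdjIn (· ∈ U \ S)) v u).card ≤ U.card

lemma exists_balanced {M U : List ℕ} (hfuel : (M.length + 1) ^ c.s ≤ c.fuel)
    (hsep : c.HasSeparators c.s M) (hUM : U.Sublist M) (hUn : U.Nodup) (hU : 2 ≤ U.length) :
    ∃ S ∈ c.words M, c.Balanced U S := by
  classical
  obtain ⟨S, hSU, ⟨x, hx⟩, hSs, hS⟩ := hsep U.toFinset
    (fun v hv => hUM.subset (List.mem_toFinset.1 hv))
    ⟨_, List.mem_toFinset.2 (List.getElem_mem (n := 0) (by omega : 0 < U.length))⟩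
  have hmem : ∀ v, v ∈ List.replicate (c.s - S.card) x ++ S.toList ↔ v ∈ S := by
    intro v
    simp only [List.mem_append, List.mem_replicate, Finset.mem_toList]
    exact ⟨fun h => h.elim (fun h => h.2 ▸ hx) id, .inr⟩
  refine ⟨List.replicate (c.s - S.card) x ++ S.toList, mem_words hfuel ?_ ?_, ?_⟩
  · simp; omega
  · intro v hv
    exact hUM.subset (List.mem_toFinset.1 (hSU ((hmem v).1 hv)))
  · intro K hK
    obtain ⟨v, hv, rfl⟩ := mem_components.1 hK
    have hW : ∀ u, u ∈ U.filter (· ∉ List.replicate (c.s - S.card) x ++ S.toList) ↔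
        u ∈ U.toFinset \ S := by
      intro u
      rw [List.mem_filter, decide_eq_true_eq, hmem, Finset.mem_sdiff, List.mem_toFinset]
    have h1 := hS v ((hW v).1 hv)
    rw [List.toFinset_card_of_nodup hUn] at h1
    rw [component_eq hv, ← List.toFinset_card_of_nodup ((hUn.filter _).filter _)]
    refine le_trans (Nat.mul_le_mul_left 2 (Finset.card_le_card fun u hu => ?_)) h1
    rw [List.mem_toFinset, List.mem_filter] at hu
    simp only [hW, decide_eq_true_eq] at hu
    exact Finset.mem_filter.2 hu

/-- The linear order is a permutation of `M` in which every initial segment has a small boundary. -/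
lemma order_spec (hc : c.IsGraph) {M : List ℕ} (hM : ∀ v ∈ M, v < c.n) (hMn : M.Nodup)
    (hfuel : (M.length + 1) ^ c.s ≤ c.fuel) (hfuel' : M.length ≤ c.fuel)
    (hsep : c.HasSeparators c.s M) (hR : M.length ≤ 2 ^ c.R) :
    (c.order M).Perm M ∧ ∀ l₁ v l₂, c.order M = l₁ ++ v :: l₂ →
      (c.boundary l₁.toFinset (v :: l₂)).card ≤ c.R * c.s := by
  have key : ∀ i, (grow (c.split (c.words M)) c.fuel i M).flatten.Perm M ∧
      (∀ U ∈ grow (c.split (c.words M)) c.fuel i M, U.Sublist M ∧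
        (U.length ≤ 1 ∨ 2 ^ i * U.length ≤ M.length)) ∧
      c.Layout (i * c.s) ∅ (grow (c.split (c.words M)) c.fuel i M) := by
    intro i
    induction i with
    | zero =>
      have h0 : grow (c.split (c.words M)) c.fuel 0 M = [M] := rfl
      rw [h0]
      refine ⟨by simp, by simp, ?_, by simp, trivial⟩
      simp [Inst.boundary]
    | succ i ih =>
      obtain ⟨h1, h2, h3⟩ := ih
      set L := grow (c.split (c.words M)) c.fuel i M with hL
      have hnd : ∀ U ∈ L, U.Nodup := fun U hU => hMn.sublist (h2 U hU).1
      have hn : ∀ U ∈ L, ∀ v ∈ U, v < c.n := fun U hU v hv => hM v ((h2 U hU).1.subset hv)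
      have h4 : (L.flatMap (c.split (c.words M))).length ≤ c.fuel := by
        refine le_trans ?_ hfuel'
        rw [← h1.length_eq, List.length_flatMap, List.length_flatten]
        exact List.sum_le_sum fun U _ => length_split_le
      have h5 : grow (c.split (c.words M)) c.fuel (i + 1) M = L.flatMap (c.split (c.words M)) := by
        rw [grow, Function.iterate_succ_apply']
        exact List.take_of_length_le h4
      rw [h5]
      have hbal : ∀ U ∈ L, 2 ≤ U.length → ∃ S ∈ c.words M, c.Balanced U S := fun U hU hU2 =>
        exists_balanced hfuel hsep (h2 U hU).1 (hnd U hU) hU2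
      refine ⟨?_, ?_, ?_⟩
      · refine List.Perm.trans ?_ h1
        rw [List.flatMap_def, List.flatten_flatten, List.map_map, ← List.flatMap_def]
        conv_rhs => rw [← List.flatMap_id]
        exact List.Perm.flatMap_left _ fun U hU => split_perm hc (hn U hU) (hnd U hU)
      · intro K hK
        obtain ⟨U, hU, hKU⟩ := List.mem_flatMap.1 hK
        refine ⟨(sublist_of_mem_split hKU).trans (h2 U hU).1, ?_⟩
        rcases (h2 U hU).2 with h6 | h6
        · exact .inl ((sublist_of_mem_split hKU).length_le.trans h6)
        rw [Inst.split] at hKU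
        split_ifs at hKU with h7 h8
        · simp at hKU
        · rw [List.mem_singleton] at hKU
          subst hKU
          by_contra hK
          push Not at hK
          obtain ⟨S, hS, hbS⟩ := hbal K hU (by omega)
          have h := h8.resolve_left (by omega)
          rw [List.filter_eq_nil_iff] at h
          exact h S hS (by simpa using hbS)
        · push Not at h8
          have hS := List.head_mem h8.2
          rw [← headD_eq_head (a := [])] at hS
          have hS := (List.mem_filter.1 hS).2
          simp only [decide_eq_true_eq] at hS
          rcases List.mem_append.1 hKU with hK | hK
          · obtain ⟨a, -, rfl⟩ := List.mem_map.1 hK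
            exact .inl le_rfl
          · right
            have h9 := hS K hK
            calc 2 ^ (i + 1) * K.length = 2 ^ i * (2 * K.length) := by ring
              _ ≤ 2 ^ i * U.length := Nat.mul_le_mul_left _ h9
              _ ≤ M.length := h6
      · rw [add_mul, one_mul]
        exact Layout.flatMap_split hc (fun S hS => (length_of_mem_words hS).le) L ∅ hn hnd hbal h3
  obtain ⟨h1, h2, h3⟩ := key c.R
  refine ⟨h1, fun l₁ v l₂ h => ?_⟩
  have := Layout.boundary_le _ ∅ (fun U hU => ?_) h3 l₁ v l₂ h
  · simpa using this
  · refine (h2 U hU).2.elim id fun h4 => ?_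
    have h5 := h4.trans hR
    by_contra h6
    have h7 := Nat.mul_le_mul_left (2 ^ c.R) (by omega : 2 ≤ U.length)
    have := Nat.one_le_two_pow (n := c.R)
    omega

end Order

/-! ### The dynamic program -/

section DynamicProgram

variable {c : Inst}

/-- Few partial solutions are pairwise distinguishable. -/
lemma length_greedy_sameKey_le {ord done : List ℕ} {L : List (List ℕ)} {m b : ℕ}
    (hL : ∀ D ∈ L, D.length ≤ m)
    (hb : (c.boundary done.toFinset (ord.filter (· ∉ done))).card ≤ b) :
    (greedy (c.SameKey ord done) L).length ≤ (m + 1) * 2 ^ b := by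
  classical
  set A := c.boundary done.toFinset (ord.filter (· ∉ done)) with hA
  let f : List ℕ → ℕ × Finset ℕ := fun D => (D.length, A.filter (· ∈ D))
  have h1 : ((greedy (c.SameKey ord done) L).reverse.map f).Nodup := by
    rw [List.Nodup, List.pairwise_map]
    refine (greedy_spec (c.SameKey ord done) L).2.1.imp fun {D D'} hDD' h => hDD' ?_
    obtain ⟨h2, h3⟩ := Prod.ext_iff.1 h
    refine ⟨h2, fun u hu ⟨v, hv, hvd, huv⟩ => ?_⟩
    have huA : u ∈ A := mem_boundary.2 ⟨List.mem_toFinset.2 hu, v,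
      List.mem_filter.2 ⟨hv, by simpa using hvd⟩, huv⟩
    have := Finset.ext_iff.1 h3 u
    simpa [f, huA] using this
  have h2 := List.toFinset_card_of_nodup h1
  rw [List.length_map, List.length_reverse] at h2
  rw [← h2]
  refine (Finset.card_le_card (t := Finset.range (m + 1) ×ˢ A.powerset) fun x hx => ?_).trans ?_
  · rw [List.mem_toFinset] at hx
    obtain ⟨D, hD, rfl⟩ := List.mem_map.1 hx
    have := hL D (mem_of_mem_greedy (List.mem_reverse.1 hD))
    simp only [Finset.mem_product, Finset.mem_range, Finset.mem_powerset, f]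
    exact ⟨by omega, Finset.filter_subset _ _⟩
  · rw [Finset.card_product, Finset.card_range, Finset.card_powerset]
    exact Nat.mul_le_mul_left _ (Nat.pow_le_pow_right (by norm_num) hb)

/-- The dynamic program finds a hitting set that is at most as large as any given one. The sets that
have to be hit are cliques, so that exchanging a partial solution for one with the same trace on the
boundary is harmless. -/
lemma exists_mem_dp {M : List ℕ} {b : ℕ} (hMn : M.Nodup) (hperm : (c.order M).Perm M)
    (hb : ∀ l₁ v l₂, c.order M = l₁ ++ v :: l₂ → (c.boundary l₁.toFinset (v :: l₂)).card ≤ b)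
    (hfuel : (M.length + 1) * 2 ^ b ≤ c.fuel) {H : List (List ℕ)} (hH : ∀ t ∈ H, c.Clique t)
    {S : Finset ℕ} (hS : ∀ t ∈ H, (∀ u ∈ t, u ∈ M) → ∃ u ∈ t, u ∈ S) :
    ∃ D ∈ c.dp H M, (∀ t ∈ H, (∀ u ∈ t, u ∈ M) → ∃ u ∈ t, u ∈ D) ∧
      D.length ≤ (M.toFinset ∩ S).card := by
  classical
  rw [Inst.dp]
  set ord := c.order M with hord
  have hnd : ord.Nodup := hperm.nodup_iff.2 hMn
  have key : ∀ l₁ l₂, ord = l₁ ++ l₂ → ∃ D ∈ (l₁.foldl (c.dpStep H ord) ([], [[]])).2,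
      D.length + (l₂.filter (· ∈ S)).length ≤ (ord.filter (· ∈ S)).length ∧
      ∀ t ∈ H, (∀ u ∈ t, u ∈ ord) → ∃ u ∈ t, u ∈ D ∨ u ∈ l₂ ∧ u ∈ S := by
    intro l₁
    induction l₁ using List.reverseRecOn with
    | nil =>
      intro l₂ h
      rw [List.nil_append] at h
      refine ⟨[], by simp, by rw [← h]; simp, fun t ht htM => ?_⟩
      obtain ⟨u, hu, huS⟩ := hS t ht fun u hu => hperm.mem_iff.1 (htM u hu)
      exact ⟨u, hu, .inr ⟨h ▸ htM u hu, huS⟩⟩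
    | append_singleton l₁ v ih =>
      intro l₂ h
      rw [List.append_assoc, List.singleton_append] at h
      obtain ⟨D, hD, hlen, hhit⟩ := ih _ h
      obtain ⟨hs1, -, hs3⟩ := foldl_dpStep_spec (c := c) (H := H) (ord := ord) (l := l₁)
      rw [List.foldl_append, List.foldl_cons, List.foldl_nil]
      set x := l₁.foldl (c.dpStep H ord) ([], [[]]) with hx
      have hdone : ∀ u, u ∈ v :: x.1 ↔ u ∈ l₁ ++ [v] := fun u => by rw [hs1]; simp [or_comm]
      have hord' : ∀ u, u ∈ ord ↔ u ∈ l₁ ++ [v] ∨ u ∈ l₂ := fun u => by rw [h]; simp [or_assoc]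
      have hdisj : ∀ u, u ∈ l₁ ++ [v] → u ∉ l₂ := by
        rw [show l₁ ++ v :: l₂ = (l₁ ++ [v]) ++ l₂ by simp] at h
        rw [h, List.nodup_append] at hnd
        exact fun u hu hu' => hnd.2.2 u hu u hu' rfl
      -- the candidate that follows the given hitting set
      let D₁ := if v ∈ S then v :: D else D
      have hD₁ : ∀ u, u ∈ D₁ ↔ (u = v ∧ v ∈ S) ∨ u ∈ D := by
        intro u
        by_cases hv : v ∈ S <;> simp [D₁, hv]
      have hlen₁ : D₁.length + (l₂.filter (· ∈ S)).length ≤ (ord.filter (· ∈ S)).length := by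
        by_cases hv : v ∈ S <;> simp [D₁, hv] at hlen ⊢ <;> omega
      have hhit₁ : ∀ t ∈ H, (∀ u ∈ t, u ∈ ord) → ∃ u ∈ t, u ∈ D₁ ∨ u ∈ l₂ ∧ u ∈ S := by
        intro t ht hto
        obtain ⟨u, hu, huD | ⟨hul, huS⟩⟩ := hhit t ht hto
        · exact ⟨u, hu, .inl ((hD₁ u).2 (.inr huD))⟩
        · rcases List.mem_cons.1 hul with rfl | hul
          · exact ⟨u, hu, .inl ((hD₁ u).2 (.inl ⟨rfl, huS⟩))⟩
          · exact ⟨u, hu, .inr ⟨hul, huS⟩⟩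
      have hcand : ∀ D' ∈ x.2.flatMap (fun D => [D, v :: D]), D'.length ≤ M.length ∧
          ∀ u ∈ D', u ∈ l₁ ++ [v] := by
        intro D' hD'
        obtain ⟨D₀, hD₀, h4⟩ := List.mem_flatMap.1 hD'
        have h5 := hs3 D₀ hD₀
        have h6 : D'.reverse.Sublist (l₁ ++ [v]) := by
          rcases List.mem_cons.1 h4 with rfl | h4
          · exact h5.trans (List.sublist_append_left _ _)
          · rw [List.mem_singleton] at h4
            rw [h4, List.reverse_cons]
            exact h5.append_right [v]
        refine ⟨?_, fun u hu => h6.subset (List.mem_reverse.2 hu)⟩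
        rw [← hperm.length_eq, ← List.length_reverse]
        refine h6.length_le.trans ?_
        rw [h]; simp
      have hmem₁ : D₁ ∈ (x.2.flatMap fun D => [D, v :: D]).filter (Ok H (v :: x.1)) := by
        refine List.mem_filter.2 ⟨List.mem_flatMap.2 ⟨D, hD, ?_⟩, decide_eq_true ?_⟩
        · by_cases hv : v ∈ S <;> simp [D₁, hv]
        · intro t ht htd
          obtain ⟨u, hu, huD | ⟨hul, -⟩⟩ := hhit₁ t ht fun u hu =>
            (hord' u).2 (.inl ((hdone u).1 (htd u hu)))
          · exact ⟨u, hu, huD⟩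
          · exact absurd hul (hdisj u ((hdone u).1 (htd u hu)))
      set G := greedy (c.SameKey ord (v :: x.1))
        ((x.2.flatMap fun D => [D, v :: D]).filter (Ok H (v :: x.1))) with hG
      have hGlen : G.length ≤ c.fuel := by
        refine le_trans (length_greedy_sameKey_le (m := M.length) (b := b) (fun D' hD' =>
          (hcand D' (List.mem_filter.1 hD').1).1) ?_) hfuel
        have h7 : ∀ u w, u ∈ c.boundary (v :: x.1).toFinset (ord.filter (· ∉ v :: x.1)) →
            w = l₂ → u ∈ c.boundary (l₁ ++ [v]).toFinset w := by
          rintro u w hu rfl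
          obtain ⟨h8, y, hy, huy⟩ := mem_boundary.1 hu
          simp only [List.mem_filter, decide_eq_true_eq, hdone, hord'] at hy
          exact mem_boundary.2 ⟨List.mem_toFinset.2 ((hdone u).1 (List.mem_toFinset.1 h8)), y,
            hy.1.resolve_left hy.2, huy⟩
        cases hl₂ : l₂ with
        | nil =>
          have : c.boundary (v :: x.1).toFinset (ord.filter (· ∉ v :: x.1)) = ∅ :=
            Finset.eq_empty_of_forall_notMem fun u hu => by
              simpa [mem_boundary] using h7 u _ hu hl₂.symm
          rw [this]; simp
        | cons w l₃ =>
          exact (Finset.card_le_card fun u hu => h7 u _ hu hl₂.symm).trans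
            (hb (l₁ ++ [v]) w l₃ (by rw [h, hl₂]; simp))
      obtain ⟨D', hD', hkey⟩ : ∃ D' ∈ G, c.SameKey ord (v :: x.1) D' D₁ := by
        rcases (greedy_spec (c.SameKey ord (v :: x.1)) _).2.2 D₁ hmem₁ with h8 | h8
        · exact ⟨D₁, h8, rfl, fun _ _ _ => Iff.rfl⟩
        · exact h8
      refine ⟨D', ?_, hkey.1 ▸ hlen₁, fun t ht hto => ?_⟩
      · change D' ∈ G.take c.fuel
        rwa [List.take_of_length_le hGlen]
      · have hOk : Ok H (v :: x.1) D' :=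
          of_decide_eq_true (List.mem_filter.1 (mem_of_mem_greedy hD')).2
        by_cases htd : ∀ u ∈ t, u ∈ v :: x.1
        · obtain ⟨u, hu, huD⟩ := hOk t ht htd
          exact ⟨u, hu, .inl huD⟩
        · push Not at htd
          obtain ⟨w, hw, hwd⟩ := htd
          obtain ⟨u, hu, huD | hul⟩ := hhit₁ t ht hto
          · have hud : u ∈ v :: x.1 :=
              (hdone u).2 ((hcand D₁ (List.mem_filter.1 hmem₁).1).2 u huD)
            have huw : c.Adj u w := (hH t ht u hu w hw).resolve_left fun e => hwd (e ▸ hud)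
            exact ⟨u, hu, .inl ((hkey.2 u hud ⟨w, hto w hw, hwd, huw⟩).2 huD)⟩
          · exact ⟨u, hu, .inr hul⟩
  obtain ⟨D, hD, h1, h2⟩ := key ord [] (by simp)
  refine ⟨D, hD, fun t ht htM => ?_, ?_⟩
  · obtain ⟨u, hu, huD | hul⟩ := h2 t ht fun u hu => hperm.mem_iff.2 (htM u hu)
    · exact ⟨u, hu, huD⟩
    · simp at hul
  · rw [List.filter_nil, List.length_nil, add_zero,
      ← List.toFinset_card_of_nodup (hnd.filter _)] at h1
    refine h1.trans (Finset.card_le_card fun u hu => ?_)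
    simp only [List.mem_toFinset, List.mem_filter, decide_eq_true_eq] at hu
    exact Finset.mem_inter.2 ⟨List.mem_toFinset.2 (hperm.mem_iff.1 hu.1), hu.2⟩

end DynamicProgram

/-! ### The algorithm finds a solution -/

section Completeness

variable {c : Inst} {r : ℕ}

/-- The bound on the size of the core if there are at most `N` small cliques per vertex. -/
def Inst.coreBound (r : ℕ) (c : Inst) (N : ℕ) : ℕ := (r * c.k + 1) * (1 + N * c.τ * r) ^ r

/-- The parameters of the algorithm suffice for graphs with at most `N` small cliques per vertex: the
branching processes are deep enough, and `fuel` is at least the number of cliques that are tested, of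
leaves of the two branching processes, of candidates for separators and of partial solutions. -/
structure Inst.Fits (r : ℕ) (c : Inst) (N : ℕ) : Prop where
  clique : (r * c.k + 1) ^ c.τ ≤ c.fuel
  branch : ((c.τ + 1) ^ r) ^ c.T₁ ≤ c.fuel
  depth₁ : c.k < c.T₁ * (c.τ - (r - 1))
  packing : (N * c.coreBound r N + 1) ^ c.T₂ ≤ c.fuel
  depth₂ : (r + 1) * (c.k / (c.τ + 1) + 1) ≤ c.T₂
  words : c.coreBound r N ^ c.s ≤ c.fuel
  dp : c.coreBound r N * 2 ^ (c.R * c.s) ≤ c.fuel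
  rounds : c.coreBound r N ≤ 2 ^ c.R

/-- The set `W` induces a graph with few small cliques and, if `W` is not larger than the core, with a
small balanced separator. -/
structure Inst.SparseOn (r : ℕ) (c : Inst) (N s : ℕ) (W : Finset ℕ) : Prop where
  cliques : ∀ F : Finset (Finset ℕ), (∀ X ∈ F, X ⊆ W ∧ c.CliqueSet X ∧ X.card < r) →
    F.card ≤ N * W.card
  separator : W.card ≤ c.coreBound r N → open Classical in ∃ S ⊆ W, S.Nonempty ∧ S.card ≤ s ∧
    ∀ v ∈ W \ S, 2 * ((W \ S).filter fun u =>
      Relation.ReflTransGen (c.AdjIn (· ∈ W \ S)) v u).card ≤ W.card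

/-- If there is a solution and all sets without large cliques are sparse, then the answer is
positive. -/
lemma Inst.Fits.answer {N : ℕ} (hf : c.Fits r N) (hN : 1 ≤ N) (hc : c.IsGraph) (hr : 1 ≤ r)
    (hsparse : ∀ W : Finset ℕ, W.Nonempty → (∀ v ∈ W, v < c.n) →
      (∀ K ⊆ W, c.CliqueSet K → K.card < c.τ + r) → c.SparseOn r N c.s W)
    {S : Finset ℕ} (hSk : S.card ≤ c.k) (hS : ∀ t ∈ c.targets r [], ∃ v ∈ t, v ∈ S) :
    c.Answer r := by
  classical
  obtain ⟨Z, hZ, hZn, hZS, hZK⟩ := exists_mem_phase₁ hc hr hSk hS hf.clique hf.branch hf.depth₁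
  have hsp : ∀ W : Finset ℕ, W.Nonempty → (∀ v ∈ W, v < c.n ∧ v ∉ Z) → c.SparseOn r N c.s W :=
    fun W hW hWZ => hsparse W hW (fun v hv => (hWZ v hv).1) fun K hK => hZK K fun v hv =>
      hWZ v (hK hv)
  obtain ⟨x, hx, hxI, hxS, hxt⟩ := exists_mem_phase₂ (r := r) (c := c) (Z := Z) (N := N)
    (fun W hW F hF => by
      rcases W.eq_empty_or_nonempty with rfl | hW'
      · have : F ⊆ {∅} := fun X hX => by simpa using (hF X hX).1
        have := Finset.card_le_card this
        simp only [Finset.card_singleton, Finset.card_empty] at this ⊢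
        omega
      · exact ((hsp W hW' hW).cliques F hF).trans (Nat.mul_le_mul_left _ (Nat.le_succ _)))
    hSk hS hf.packing hf.depth₂
  have hm : x.core.length + 1 ≤ c.coreBound r N := hxI.core_le.trans
    (Nat.mul_le_mul_left _ (Nat.pow_le_pow_right (by omega) hxI.stage_le))
  have hdp : (x.core.length + 1) * 2 ^ (c.R * c.s) ≤ c.fuel :=
    (Nat.mul_le_mul_right _ hm).trans hf.dp
  have hlen : x.core.length ≤ c.fuel := by
    have := Nat.le_mul_of_pos_right (x.core.length + 1) (Nat.two_pow_pos (c.R * c.s))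
    omega
  obtain ⟨hperm, hb⟩ := order_spec hc (fun v hv => (hxI.core v hv).1) hxI.nodup
    ((Nat.pow_le_pow_left hm _).trans hf.words) hlen
    (fun U hU hne => (hsp U hne fun v hv => hxI.core v (hU v hv)).separator <|
      (Finset.card_le_card fun v hv => List.mem_toFinset.2 (hU v hv)).trans <|
        (List.toFinset_card_le x.core).trans (by omega))
    (by have := hf.rounds; omega)
  obtain ⟨D, hD, hDh, hDl⟩ := exists_mem_dp hxI.nodup hperm hb hdp (fun t ht => (hxI.hit t ht).2.1)
    (fun t ht _ => hxS t ht)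
  refine ⟨Z, hZ, x, hx, D, hD, ?_, fun t ht => ?_⟩
  · rw [List.length_append, ← List.toFinset_card_of_nodup hZn]
    have hdisj : Disjoint Z.toFinset (x.core.toFinset ∩ S) := by
      rw [Finset.disjoint_left]
      intro v hv hv'
      exact (hxI.core v (List.mem_toFinset.1 (Finset.mem_inter.1 hv').1)).2 (List.mem_toFinset.1 hv)
    refine (Nat.add_le_add_left hDl _).trans ?_
    rw [← Finset.card_union_of_disjoint hdisj]
    refine (Finset.card_le_card fun v hv => ?_).trans hSk
    rcases Finset.mem_union.1 hv with hv | hv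
    · exact hZS v (List.mem_toFinset.1 hv)
    · exact (Finset.mem_inter.1 hv).2
  · by_cases htZ : ∀ v ∈ t, v ∉ Z
    · have ht := mem_targets.1 ht
      obtain ⟨t', ht', h1, h2⟩ := hxt t (mem_targets.2 ⟨ht.1, ht.2.1, ht.2.2.1, htZ⟩)
      obtain ⟨u, hu, huD⟩ := hDh t' ht' fun u hu => h2 hu
      exact ⟨u, h1 hu, List.mem_append_right _ huD⟩
    · push Not at htZ
      obtain ⟨v, hv, hvZ⟩ := htZ
      exact ⟨v, hv, List.mem_append_left _ hvZ⟩

end Completeness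

/-! ### Balanced separators from tree decompositions -/

section Separator

variable {V : Type*} {G : SimpleGraph V}

/-- Adjacency in the complement of the set `S`. -/
def AdjOff (G : SimpleGraph V) (S : Finset V) (u v : V) : Prop := u ∉ S ∧ v ∉ S ∧ G.Adj u v

/-- The bags that contain some vertex of a connected part of the complement of the bag `t` all lie in
the same branch at `t`. -/
lemma TreeDecomposition.exists_branch (D : TreeDecomposition G) (t : Fin D.nodes) {v : V}
    (hv : v ∉ D.bag t) : ∃ t', D.tree.Adj t t' ∧
      ∀ u, Relation.ReflTransGen (AdjOff G (D.bag t)) v u → ∀ x, u ∈ D.bag x →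
        (D.tree.deleteEdges {s(t, t')}).Reachable t' x := by
  obtain ⟨x₀, hx₀⟩ := D.exists_mem_bag v
  obtain ⟨p, hp⟩ := D.isTree.connected.exists_isPath t x₀
  cases p with
  | nil => exact absurd hx₀ hv
  | cons h q =>
    rename_i t'
    have htq : t ∉ q.support := (SimpleGraph.Walk.cons_isPath_iff h q).1 hp |>.2
    have hbase : (D.tree.deleteEdges {s(t, t')}).Reachable t' x₀ :=
      ⟨q.toDeleteEdges _ fun e he hee => htq <| by
        rw [Set.mem_singleton_iff] at hee
        exact q.fst_mem_support_of_mem_edges (hee ▸ he)⟩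
    -- the bags with a vertex outside the bag `t` are connected in the complement of `t`
    have hall : ∀ u ∉ D.bag t, ∀ x y, u ∈ D.bag x → u ∈ D.bag y →
        (D.tree.deleteEdges {s(t, t')}).Reachable x y := by
      intro u hu x y hx hy
      refine (D.connected_bags u ⟨x, hx⟩ ⟨y, hy⟩).map ⟨Subtype.val, fun {a b} hab => ?_⟩
      refine SimpleGraph.deleteEdges_adj.2 ⟨hab, fun he => ?_⟩
      rw [Set.mem_singleton_iff, Sym2.eq_iff] at he
      rcases he with ⟨h1, -⟩ | ⟨-, h1⟩
      · exact hu (h1 ▸ a.2)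
      · exact hu (h1 ▸ b.2)
    refine ⟨t', h, fun u hu => ?_⟩
    induction hu with
    | refl => exact fun x hx => hbase.trans (hall v hv x₀ x hx₀ hx)
    | tail _ hab ih =>
      intro x hx
      obtain ⟨y, hy1, hy2⟩ := D.exists_edge_bag _ _ hab.2.2
      exact (ih y hy1).trans (hall _ hab.2.1 y x hy2 hx)

/-- Some bag of a tree decomposition is a balanced separator. Otherwise every node has a neighbour in
the direction of the large component; by counting, two nodes choose the same edge of the tree, and
the two large components are disjoint. -/
lemma TreeDecomposition.exists_balanced_bag [Fintype V] (D : TreeDecomposition G) :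
    open Classical in ∃ t, ∀ v ∉ D.bag t,
      2 * (Finset.univ.filter fun u => Relation.ReflTransGen (AdjOff G (D.bag t)) v u).card ≤
        Fintype.card V := by
  classical
  by_contra! hcon
  choose v hv hbig using hcon
  choose f hf hreach using fun t => D.exists_branch t (hv t)
  have hcard := D.isTree.card_edgeFinset
  obtain ⟨t, -, t', -, hne, heq⟩ := Finset.exists_ne_map_eq_of_card_lt_of_maps_to
    (s := Finset.univ) (t := D.tree.edgeFinset) (f := fun t => s(t, f t))
    (by rw [Finset.card_univ]; omega) (fun t _ => by simpa using hf t)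
  obtain ⟨h1, h2⟩ := (Sym2.eq_iff.1 heq).resolve_left fun h => hne h.1
  -- the large components at `t` and at `t'` have a common vertex
  obtain ⟨u, hu⟩ : ∃ u, Relation.ReflTransGen (AdjOff G (D.bag t)) (v t) u ∧
      Relation.ReflTransGen (AdjOff G (D.bag t')) (v t') u := by
    by_contra! hno
    have hdisj : Disjoint
        (Finset.univ.filter fun u => Relation.ReflTransGen (AdjOff G (D.bag t)) (v t) u)
        (Finset.univ.filter fun u => Relation.ReflTransGen (AdjOff G (D.bag t')) (v t') u) :=
      Finset.disjoint_left.2 fun u hu hu' =>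
        hno u (Finset.mem_filter.1 hu).2 (Finset.mem_filter.1 hu').2
    have h3 := Finset.card_le_univ (Finset.disjUnion _ _ hdisj)
    rw [Finset.card_disjUnion] at h3
    have := hbig t
    have := hbig t'
    omega
  obtain ⟨x, hx⟩ := D.exists_mem_bag u
  have h3 := hreach t u hu.1 x hx
  have h4 := hreach t' u hu.2 x hx
  rw [h2] at h3
  rw [← h1, Sym2.eq_swap] at h4
  exact SimpleGraph.isAcyclic_iff_forall_adj_isBridge.1 D.isTree.isAcyclic (h2 ▸ hf t)
    (h4.trans h3.symm)

/-- The treewidth is attained. -/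
lemma exists_width_eq_treewidth [Fintype V] (G : SimpleGraph V) :
    ∃ D : TreeDecomposition G, D.width = treewidth G := by
  have h : (Set.range fun D : TreeDecomposition G => D.width).Nonempty :=
    ⟨_, { nodes := 1
          tree := ⊥
          isTree := by
            refine ⟨?_, by simp⟩
            rw [SimpleGraph.connected_iff]
            exact ⟨fun a b => by rw [Subsingleton.elim a b], inferInstance⟩
          bag := fun _ => Finset.univ
          exists_mem_bag := fun v => ⟨0, Finset.mem_univ v⟩
          exists_edge_bag := fun u v _ => ⟨0, Finset.mem_univ u, Finset.mem_univ v⟩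
          connected_bags := fun v a b => by rw [Subsingleton.elim a b] }, rfl⟩
  exact Nat.sInf_mem h

/-- A nonempty graph has a nonempty balanced separator of size at most its treewidth plus two. -/
lemma exists_separator [Fintype V] [Nonempty V] (G : SimpleGraph V) :
    open Classical in ∃ S : Finset V, S.Nonempty ∧ S.card ≤ treewidth G + 2 ∧ ∀ v ∉ S,
      2 * (Finset.univ.filter fun u => Relation.ReflTransGen (AdjOff G S) v u).card ≤
        Fintype.card V := by
  classical
  obtain ⟨D, hD⟩ := exists_width_eq_treewidth G
  obtain ⟨t, ht⟩ := D.exists_balanced_bag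
  obtain ⟨x⟩ := ‹Nonempty V›
  refine ⟨insert x (D.bag t), Finset.insert_nonempty _ _, ?_, fun v hv => ?_⟩
  · have h1 : (D.bag t).card ≤ Finset.univ.sup fun t => (D.bag t).card :=
      Finset.le_sup (f := fun t => (D.bag t).card) (Finset.mem_univ t)
    have h2 := Finset.card_insert_le x (D.bag t)
    rw [TreeDecomposition.width] at hD
    omega
  · refine le_trans (Nat.mul_le_mul_left 2 (Finset.card_le_card fun u hu => ?_))
      (ht v fun h => hv (Finset.mem_insert_of_mem h))
    rw [Finset.mem_filter] at hu ⊢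
    exact ⟨hu.1, Relation.ReflTransGen.mono (fun a b h =>
      ⟨fun h' => h.1 (Finset.mem_insert_of_mem h'),
        fun h' => h.2.1 (Finset.mem_insert_of_mem h'), h.2.2⟩) _ _ hu.2⟩

end Separator

/-! ### Graphs and instances -/

section Represents

variable {c : Inst} {r n : ℕ} {G : SimpleGraph (Fin n)}

/-- The instance `c` is about the graph `G`. -/
structure Inst.Represents (c : Inst) {n : ℕ} (G : SimpleGraph (Fin n)) : Prop where
  n_eq : c.n = n
  adj : ∀ i j : Fin n, c.Adj i j ↔ G.Adj i j

lemma Inst.Represents.isGraph (h : c.Represents G) : c.IsGraph where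
  symm u hu v hv huv := by
    have hu := h.n_eq ▸ hu
    have hv := h.n_eq ▸ hv
    exact (h.adj ⟨v, hv⟩ ⟨u, hu⟩).2 ((h.adj ⟨u, hu⟩ ⟨v, hv⟩).1 huv).symm
  irrefl u hu huu := by
    have hu := h.n_eq ▸ hu
    exact ((h.adj ⟨u, hu⟩ ⟨u, hu⟩).1 huu).ne rfl

/-- A set that meets all cliques on `r` vertices is a solution. -/
lemma Inst.Represents.hasCliqueCover (h : c.Represents G) (ha : c.Answer r) :
    HasCliqueCover r G c.k := by
  classical
  obtain ⟨Z, -, x, -, D, -, hk, hX⟩ := ha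
  set X := Z ++ D
  refine ⟨Finset.univ.filter fun i : Fin n => (i : ℕ) ∈ X, ?_, fun s hs => ?_⟩
  · refine le_trans ?_ ((List.toFinset_card_le X).trans hk)
    exact Finset.card_le_card_of_injOn (fun i : Fin n => (i : ℕ)) (fun i hi => by simpa using hi)
      (fun _ _ _ _ => Fin.val_injective.eq_iff.1)
  · let K : Finset ℕ := s.image fun i => i.1.1
    have hinj : Function.Injective fun i : {v // v ∈ {v : Fin n | v ∉
        Finset.univ.filter fun i : Fin n => (i : ℕ) ∈ X}} => i.1.1 :=
      Fin.val_injective.comp Subtype.val_injective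
    obtain ⟨t, ht, htK⟩ := exists_mem_targets (c := c) (r := r) (Z := []) (K := K)
      (fun v hv => by
        obtain ⟨i, -, rfl⟩ := Finset.mem_image.1 hv
        exact ⟨h.n_eq ▸ i.1.2, by simp⟩)
      (fun u hu v hv => by
        obtain ⟨i, hi, rfl⟩ := Finset.mem_image.1 hu
        obtain ⟨j, hj, rfl⟩ := Finset.mem_image.1 hv
        by_cases hij : i = j
        · exact .inl (by rw [hij])
        · exact .inr ((h.adj _ _).2 (hs.isClique hi hj hij)))
      (by rw [Finset.card_image_of_injective _ hinj, hs.card_eq])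
    obtain ⟨v, hv, hvX⟩ := hX t ht
    obtain ⟨i, -, rfl⟩ := Finset.mem_image.1 (htK v hv)
    exact i.2 (by simpa using hvX)

lemma Inst.Represents.exists_hitting (h : c.Represents G) (hG : HasCliqueCover r G c.k) :
    ∃ S : Finset ℕ, S.card ≤ c.k ∧ ∀ t ∈ c.targets r [], ∃ v ∈ t, v ∈ S := by
  classical
  obtain ⟨X, hX, hfree⟩ := hG
  refine ⟨X.map Fin.valEmbedding, by rwa [Finset.card_map], fun t ht => ?_⟩
  by_contra! hcon
  obtain ⟨h1, h2, h3, -⟩ := mem_targets.1 ht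
  obtain ⟨-, h4, h5⟩ := mem_sets.1 h1
  rw [h.n_eq] at h4
  let e : {v // v ∈ t.toFinset} → {v | v ∉ X} := fun v =>
    ⟨⟨v.1, h4 v.1 (List.mem_toFinset.1 v.2)⟩, fun hv => hcon v.1 (List.mem_toFinset.1 v.2)
      (Finset.mem_map.2 ⟨_, hv, rfl⟩)⟩
  have he : Function.Injective e := fun a b hab => Subtype.ext (by
    simpa [e] using hab)
  refine hfree (t.toFinset.attach.image e) ⟨?_, ?_⟩
  · intro a ha b hb hab
    simp only [Finset.coe_image, Set.mem_image] at ha hb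
    obtain ⟨u, -, rfl⟩ := ha
    obtain ⟨w, -, rfl⟩ := hb
    refine (h.adj _ _).1 ((h3 u.1 (List.mem_toFinset.1 u.2) w.1 (List.mem_toFinset.1 w.2)).resolve_left
      fun huw => hab ?_)
    rw [Subtype.ext huw]
  · rw [Finset.card_image_of_injective _ he, Finset.card_attach,
      List.toFinset_card_of_nodup h5.nodup, h2]

/-- The subgraph induced by a set `W` of vertices, as a graph on `Fin W.card`. -/
lemma Inst.Represents.exists_induced (h : c.Represents G) {W : Finset ℕ} (hW : W.Nonempty)
    (hWn : ∀ v ∈ W, v < c.n) {ω : ℕ} (hω : ∀ K ⊆ W, c.CliqueSet K → K.card < ω) :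
    ∃ H : SimpleGraph (Fin W.card), Nonempty (H ↪g G) ∧ H.cliqueNum < ω ∧ ∀ N s,
      numCliquesLT H r ≤ N * W.card → (W.card ≤ c.coreBound r N → treewidth H + 2 ≤ s) →
        c.SparseOn r N s W := by
  classical
  let e : Fin W.card ↪ ℕ := (W.orderEmbOfFin rfl).toEmbedding
  have heW : ∀ i, e i ∈ W := fun i => W.orderEmbOfFin_mem rfl i
  have heS : ∀ v ∈ W, ∃ i, e i = v := fun v hv => by
    have := W.range_orderEmbOfFin rfl
    have hv' : v ∈ Set.range (W.orderEmbOfFin rfl) := by rw [this]; exact hv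
    exact hv'
  let e' : Fin W.card ↪ Fin n := ⟨fun i => ⟨e i, h.n_eq ▸ hWn _ (heW i)⟩, fun i j hij =>
    e.injective (by simpa using hij)⟩
  let H := G.comap e'
  have hH : ∀ i j, H.Adj i j ↔ c.Adj (e i) (e j) := fun i j => (h.adj (e' i) (e' j)).symm
  have hmap : ∀ K : Finset (Fin W.card), K.map e ⊆ W := fun K v hv => by
    obtain ⟨i, -, rfl⟩ := Finset.mem_map.1 hv
    exact heW i
  have hpre : ∀ X ⊆ W, (Finset.univ.filter fun i => e i ∈ X).map e = X := fun X hX => by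
    ext v
    simp only [Finset.mem_map, Finset.mem_filter, Finset.mem_univ, true_and]
    constructor
    · rintro ⟨i, hi, rfl⟩; exact hi
    · intro hv
      obtain ⟨i, rfl⟩ := heS v (hX hv)
      exact ⟨i, hv, rfl⟩
  refine ⟨H, ⟨⟨e', Iff.rfl⟩⟩, ?_, fun N s hN hs => ⟨fun F hF => ?_, fun hWm => ?_⟩⟩
  · obtain ⟨K, hK⟩ := H.exists_isNClique_cliqueNum
    rw [← hK.card_eq, ← Finset.card_map e]
    refine hω _ (hmap K) fun u hu v hv => ?_
    obtain ⟨i, hi, rfl⟩ := Finset.mem_map.1 hu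
    obtain ⟨j, hj, rfl⟩ := Finset.mem_map.1 hv
    by_cases hij : i = j
    · exact .inl (by rw [hij])
    · exact .inr ((hH i j).1 (hK.isClique hi hj hij))
  · refine le_trans ?_ hN
    rw [numCliquesLT, ← Set.ncard_coe_finset]
    refine Set.ncard_le_ncard_of_injOn (fun X => Finset.univ.filter fun i => e i ∈ X) ?_ ?_
      (Set.toFinite _)
    · intro X hX
      obtain ⟨h1, h2, h3⟩ := hF X hX
      refine ⟨fun i hi j hj hij => ?_, ?_⟩
      · simp only [Finset.coe_filter, Finset.mem_univ, true_and, Set.mem_ofPred_eq] at hi hj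
        exact (hH i j).2 ((h2 _ hi _ hj).resolve_left fun hh => hij (e.injective hh))
      · rwa [← Finset.card_map e, hpre X h1]
    · intro X hX Y hY hXY
      rw [← hpre X (hF X hX).1, ← hpre Y (hF Y hY).1]
      exact congrArg _ hXY
  · have : Nonempty (Fin W.card) := ⟨⟨0, hW.card_pos⟩⟩
    have hs := hs hWm
    obtain ⟨S, hS1, hS2, hS3⟩ := exists_separator H
    refine ⟨S.map e, hmap S, hS1.map, by rw [Finset.card_map]; omega, fun v hv => ?_⟩
    obtain ⟨hvW, hvS⟩ := Finset.mem_sdiff.1 hv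
    obtain ⟨i, rfl⟩ := heS v hvW
    have h1 := hS3 i fun hi => hvS (Finset.mem_map_of_mem e hi)
    rw [Fintype.card_fin] at h1
    refine le_trans (Nat.mul_le_mul_left 2 ?_) h1
    rw [← Finset.card_map e]
    refine Finset.card_le_card fun u hu => ?_
    have hu' := (Finset.mem_filter.1 hu).2
    have hr : ∃ j, e j = u ∧ Relation.ReflTransGen (AdjOff H S) i j := by
      clear h1 hu
      induction hu' with
      | refl => exact ⟨i, rfl, .refl⟩
      | tail _ hab ih =>
        obtain ⟨j, rfl, hj⟩ := ih
        obtain ⟨hb1, hb2⟩ := Finset.mem_sdiff.1 hab.2.1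
        obtain ⟨l, rfl⟩ := heS _ hb1
        refine ⟨l, rfl, hj.tail ⟨fun hh => ?_, fun hh => ?_, (hH _ _).2 hab.2.2⟩⟩
        · exact (Finset.mem_sdiff.1 hab.1).2 (Finset.mem_map_of_mem e hh)
        · exact hb2 (Finset.mem_map_of_mem e hh)
    obtain ⟨j, rfl, hj⟩ := hr
    exact Finset.mem_map_of_mem e (Finset.mem_filter.2 ⟨Finset.mem_univ _, hj⟩)

end Represents

/-! ### Reading the input -/

namespace RAM

/-- The adjacency matrix of a graph as a list of truth values. -/
noncomputable def bits {n : ℕ} (G : SimpleGraph (Fin n)) : List Prop :=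
  (List.range (n * n)).map fun a => ∃ i j : Fin n, G.Adj i j ∧ a = (i : ℕ) * n + (j : ℕ)

lemma bits_adj {n : ℕ} (G : SimpleGraph (Fin n)) (i j : Fin n) :
    ((bits G).drop (i * n + j)).headD False ↔ G.Adj i j := by
  have h : (i : ℕ) * n + j < (bits G).length := by
    rw [bits, List.length_map, List.length_range]
    calc (i : ℕ) * n + j < i * n + n := by omega
      _ = (i + 1) * n := by ring
      _ ≤ n * n := Nat.mul_le_mul_right n i.2
  rw [List.drop_eq_getElem_cons h, List.headD_cons]
  simp only [bits, List.getElem_map, List.getElem_range]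
  constructor
  · rintro ⟨i', j', hadj, he⟩
    have hn : 0 < n := i.pos
    have h1 : i' = i := Fin.ext (by
      have := congrArg (· / n) he
      simpa [Nat.add_div_of_dvd_right, Nat.mul_div_cancel _ hn, Nat.div_eq_of_lt] using this.symm)
    have h2 : j' = j := Fin.ext (by rw [h1] at he; omega)
    rwa [← h1, ← h2]
  · exact fun h => ⟨i, j, h, rfl⟩

/-- Writes the unary encoding of the number in register `x` onto the heap. -/
def unaryProg (x : ℕ) : Prog :=
  .const 2 0 ;; .loop x (.const 5 1 ;; .sub x x 5 ;; .const 10 0 ;; consProg 2 10 2)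

lemma runs_unaryProg {x : ℕ} {s : State} (hx : x ≠ 2 ∧ x ≠ 3 ∧ x ≠ 5 ∧ x ≠ 10) (h3 : s.reg 3 ≠ 0)
    {Q : State → Prop}
    (hQ : ∀ s' : State, Rep s'.mem (s'.reg 3) (enc (s.reg x)) (s'.reg 2) → s.reg 3 ≤ s'.reg 3 →
      (∀ y, y ≠ 2 → y ≠ 3 → y ≠ 5 → y ≠ 10 → y ≠ x → s'.reg y = s.reg y) →
      (∀ i < s.reg 3, s'.mem i = s.mem i) → Q s') :
    Runs (unaryProg x) s (s.reg x * 11 + 2) Q := by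
  obtain ⟨hx2, hx3, hx5, hx10⟩ := hx
  refine Runs.mono (T := 1 + (s.reg x * (10 + 1) + 1)) (.seq (.const ?_)) (by omega) fun _ h => h
  set s₀ := s.setReg 2 0 with hs₀
  have e : ∀ y, y ≠ 2 → s₀.reg y = s.reg y := fun y hy => by simp [hs₀, State.setReg, hy]
  refine (Runs.loop_count (T := 10) (fun i s' => i ≤ s.reg x ∧
    Rep s'.mem (s'.reg 3) (enc (s.reg x - i)) (s'.reg 2) ∧ s.reg 3 ≤ s'.reg 3 ∧
      (∀ y, y ≠ 2 → y ≠ 3 → y ≠ 5 → y ≠ 10 → y ≠ x → s'.reg y = s.reg y) ∧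
      (∀ i < s.reg 3, s'.mem i = s.mem i)) ?_ (s.reg x) s₀ (e x hx2) ?_).mono le_rfl ?_
  · rintro i s₁ hxi ⟨hi, hrep, h4, h5, h6⟩
    refine Runs.mono (T := 1 + (1 + (1 + 7))) (.seq (.const (.seq (.sub (.seq (.const ?_))))))
      le_rfl fun _ h => h
    refine runs_consProg (by decide) (by decide) (by decide) ?_
    intro s₂ r2 r3 ro mo m0 m1
    simp only [State.setReg, Function.update_apply] at r2 r3 ro mo m0 m1
    simp only [Nat.reduceEqDiff, if_true, if_false, hx2.symm, hx3.symm] at r2 r3 ro mo m0 m1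
    refine ⟨?_, by omega, ?_, by omega, fun y y1 y2 y3 y4 y5 => ?_, fun a ha => ?_⟩
    · rw [ro x hx3 hx5 hx2]
      simp [hx10, hx5, hxi]
    · have e1 : s.reg x - i = (s.reg x - (i + 1)) + 1 := by omega
      rw [e1]
      refine ⟨by omega, by omega, ?_, ?_⟩
      · rw [r2, m0]; rfl
      · rw [r2, m1]
        exact hrep.mono (by omega) mo
    · rw [ro y y2 y3 y1]
      simp [y3, y4, y5, h5 y y1 y2 y3 y4 y5]
    · rw [mo a (by omega), h6 a ha]
  · refine ⟨le_rfl, ?_, (e 3 (by decide)).ge, fun y y1 _ _ _ _ => e y y1, fun _ _ => rfl⟩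
    rw [Nat.sub_self]
    simp [hs₀, State.setReg]
    rfl
  · rintro s' ⟨-, -, h4, h5, h6, h7⟩
    exact hQ s' h4 h5 h6 h7

/-- Puts the number in register `x` in front of the tree in register `11`. -/
def prependProg (x : ℕ) : Prog := unaryProg x ;; consProg 11 2 11

lemma runs_prependProg {x : ℕ} {s : State} {t : SExp}
    (hx : x ≠ 2 ∧ x ≠ 3 ∧ x ≠ 5 ∧ x ≠ 10 ∧ x ≠ 11) (h3 : s.reg 3 ≠ 0)
    (ht : Rep s.mem (s.reg 3) t (s.reg 11)) {Q : State → Prop}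
    (hQ : ∀ s' : State, Rep s'.mem (s'.reg 3) (.cons (enc (s.reg x)) t) (s'.reg 11) →
      s'.reg 3 ≠ 0 →
      (∀ y, y ≠ 2 → y ≠ 3 → y ≠ 5 → y ≠ 10 → y ≠ 11 → y ≠ x → s'.reg y = s.reg y) → Q s') :
    Runs (prependProg x) s (s.reg x * 11 + 9) Q := by
  refine Runs.mono (T := (s.reg x * 11 + 2) + 7) (.seq ?_) le_rfl fun _ h => h
  refine runs_unaryProg ⟨hx.1, hx.2.1, hx.2.2.1, hx.2.2.2.1⟩ h3 fun s₁ h4 h5 h6 h7 => ?_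
  refine runs_consProg (by decide) (by decide) (by decide) ?_
  intro s₂ r11 r3 ro mo m0 m1
  refine hQ s₂ ⟨by omega, by omega, ?_, ?_⟩ (by omega) fun y y1 y2 y3 y4 y5 y6 => ?_
  · rw [r11, m0]
    exact h4.mono (by omega) mo
  · rw [r11, m1, h6 11 (by decide) (by decide) (by decide) (by decide) hx.2.2.2.2.symm]
    exact ht.mono (by omega) fun a ha => by rw [mo a (by omega), h7 a ha]
  · rw [ro y y2 y3 y5, h6 y y1 y2 y3 y4 y6]

/-- Computes the square of the number in register `0` in register `6`. -/
def squareProg : Prog := .move 8 0 ;; .loop 8 (.add 6 6 0 ;; .const 5 1 ;; .sub 8 8 5)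

/-- Writes the list of the first entries of the memory, as many as register `6` says, onto the heap,
which starts behind these entries. Register `9` points to the encoding of the truth value `True`. -/
def bitsProg : Prog :=
  .const 5 1 ;; .add 9 6 5 ;; .const 5 2 ;; .add 3 9 5 ;;
  .loop 6 (.const 5 1 ;; .sub 6 6 5 ;; .load 10 6 ;; .ite 10 (.move 10 9) .skip ;;
    consProg 11 10 11)

/-- Brings the input into the form of a tree. -/
def readProg : Prog :=
  squareProg ;; bitsProg ;; prependProg 1 ;; prependProg 0 ;; .move 2 11

lemma runs_squareProg {s : State} (h6 : s.reg 6 = 0) {Q : State → Prop}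
    (hQ : ∀ s' : State, s'.reg 6 = s.reg 0 * s.reg 0 →
      (∀ y, y ≠ 5 → y ≠ 6 → y ≠ 8 → s'.reg y = s.reg y) → s'.mem = s.mem → Q s') :
    Runs squareProg s (s.reg 0 * 4 + 2) Q := by
  refine Runs.mono (T := 1 + (s.reg 0 * (3 + 1) + 1)) (.seq (.move ?_)) (by omega) fun _ h => h
  refine (Runs.loop_count (T := 3) (fun i s' => i ≤ s.reg 0 ∧
    s'.reg 6 = (s.reg 0 - i) * s.reg 0 ∧ (∀ y, y ≠ 5 → y ≠ 6 → y ≠ 8 → s'.reg y = s.reg y) ∧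
      s'.mem = s.mem) ?_ (s.reg 0) (s.setReg 8 (s.reg 0)) (by simp [State.setReg]) ?_).mono le_rfl ?_
  · rintro i s₁ h8 ⟨hi, h1, h2, h3⟩
    refine Runs.mono (T := 1 + (1 + 1)) (.seq (.add (.seq (.const (.sub ?_))))) le_rfl fun _ h => h
    refine ⟨by simp [State.setReg, h8], by omega, ?_, fun y y1 y2 y3 => ?_, h3⟩
    · have e1 : s.reg 0 - i = (s.reg 0 - (i + 1)) + 1 := by omega
      have e2 := h2 0 (by decide) (by decide) (by decide)
      simp [State.setReg, h1, e1, e2, add_mul]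
    · simp [State.setReg, y1, y2, y3, h2 y y1 y2 y3]
  · refine ⟨le_rfl, by simp [State.setReg, h6], fun y _ _ y3 => by simp [State.setReg, y3], rfl⟩
  · rintro s' ⟨-, -, h1, h2, h3⟩
    exact hQ s' (by rw [h1, Nat.sub_zero]) h2 h3

lemma runs_bitsProg {s : State} (l : List Prop) (hl : s.reg 6 = l.length) (h11 : s.reg 11 = 0)
    (hmem : ∀ i, (h : i < l.length) → (s.mem i ≠ 0 ↔ l[i]))
    (hmem' : ∀ i, l.length ≤ i → s.mem i = 0) {Q : State → Prop}
    (hQ : ∀ s' : State, Rep s'.mem (s'.reg 3) (enc l) (s'.reg 11) → s'.reg 3 ≠ 0 →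
      s'.reg 0 = s.reg 0 → s'.reg 1 = s.reg 1 → Q s') :
    Runs bitsProg s (l.length * 13 + 5) Q := by
  refine Runs.mono (T := 1 + (1 + (1 + (1 + (l.length * (12 + 1) + 1)))))
    (.seq (.const (.seq (.add (.seq (.const (.seq (.add ?_)))))))) (by omega) fun _ h => h
  set s₀ := (((s.setReg 5 1).setReg 9 _).setReg 5 2).setReg 3 _ with hs₀
  have e3 : s₀.reg 3 = l.length + 3 := by simp [hs₀, State.setReg, hl]
  have e9 : s₀.reg 9 = l.length + 1 := by simp [hs₀, State.setReg, hl]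
  have e6 : s₀.reg 6 = l.length := by simp [hs₀, State.setReg, hl]
  have em : s₀.mem = s.mem := rfl
  refine (Runs.loop_count (T := 12) (fun i s' => i ≤ l.length ∧
    Rep s'.mem (s'.reg 3) (enc (l.drop i)) (s'.reg 11) ∧ l.length + 3 ≤ s'.reg 3 ∧
      s'.reg 9 = l.length + 1 ∧ (∀ i < l.length + 3, s'.mem i = s.mem i) ∧
      s'.reg 0 = s.reg 0 ∧ s'.reg 1 = s.reg 1) ?_ l.length s₀ e6 ?_).mono le_rfl ?_
  · rintro i s₁ h6 ⟨hi, hrep, h3, h9, hm, h0, h1⟩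
    refine Runs.mono (T := 1 + (1 + (1 + ((1 + 1) + 7)))) (.seq (.const (.seq (.sub (.seq (.load
      (.seq ?_))))))) le_rfl fun _ h => h
    set s₂ := ((s₁.setReg 5 1).setReg 6 _).setReg 10 _ with hs₂
    have f6 : s₂.reg 6 = i := by simp [hs₂, State.setReg, h6]
    have f10 : s₂.reg 10 = s.mem i := by simp [hs₂, State.setReg, h6, hm i (by omega)]
    have f9 : s₂.reg 9 = l.length + 1 := by simp [hs₂, State.setReg, h9]
    have fo : ∀ y, y ≠ 5 → y ≠ 6 → y ≠ 10 → s₂.reg y = s₁.reg y := fun y y1 y2 y3 => by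
      simp [hs₂, State.setReg, y1, y2, y3]
    have fm : s₂.mem = s₁.mem := rfl
    -- after the conditional, register `10` points to the truth value
    have key : Runs (.ite 10 (.move 10 9) .skip) s₂ (1 + 1) fun s' =>
        s'.reg 10 = (if s.mem i ≠ 0 then l.length + 1 else 0) ∧
        (∀ y, y ≠ 10 → s'.reg y = s₂.reg y) ∧ s'.mem = s₁.mem := by
      refine .ite (fun h => .move ⟨?_, fun y hy => by simp [State.setReg, hy], rfl⟩)
        (fun h => .skip ⟨?_, fun _ _ => rfl, rfl⟩)
      · rw [if_pos (f10 ▸ h)]; simp [State.setReg, f9]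
      · rw [if_neg (by rw [← f10]; exact not_not.2 h), h]
    refine key.mono le_rfl ?_
    rintro s₃ ⟨g10, go, gm⟩
    refine runs_consProg (by decide) (by decide) (by decide) ?_
    intro s₄ r11 r3 ro mo m0 m1
    have g3 : s₃.reg 3 = s₁.reg 3 := by
      rw [go 3 (by decide), fo 3 (by decide) (by decide) (by decide)]
    have g11 : s₃.reg 11 = s₁.reg 11 := by
      rw [go 11 (by decide), fo 11 (by decide) (by decide) (by decide)]
    have hm₄ : ∀ a < s₁.reg 3, s₄.mem a = s₁.mem a := fun a ha => by
      rw [mo a (by omega), gm]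
    have hoth : ∀ y, y ≠ 3 → y ≠ 5 → y ≠ 6 → y ≠ 10 → y ≠ 11 → s₄.reg y = s₁.reg y :=
      fun y y1 y2 y3 y4 y5 => by rw [ro y y1 y2 y5, go y y4, fo y y2 y3 y4]
    refine ⟨?_, by omega, ?_, by omega, ?_, fun a ha => ?_, ?_, ?_⟩
    · rw [ro 6 (by decide) (by decide) (by decide), go 6 (by decide), f6]
    · rw [List.drop_eq_getElem_cons (by omega : i < l.length)]
      refine ⟨by omega, by omega, ?_, ?_⟩
      · rw [r11, m0, g10]
        have hiff := hmem i (by omega)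
        by_cases hb : s.mem i ≠ 0
        · rw [if_pos hb, enc_of (hiff.1 hb)]
          refine ⟨by omega, by omega, ?_, ?_⟩
          · rw [hm₄ _ (by omega), hm _ (by omega)]; exact hmem' _ (by omega)
          · rw [hm₄ _ (by omega), hm _ (by omega)]; exact hmem' _ (by omega)
        · rw [if_neg hb, enc_of_not fun h => hb (hiff.2 h)]
          rfl
      · rw [r11, m1, g11]
        exact hrep.mono (by omega) hm₄
    · rw [hoth 9 (by decide) (by decide) (by decide) (by decide) (by decide), h9]
    · rw [hm₄ a (by omega), hm a ha]
    · rw [hoth 0 (by decide) (by decide) (by decide) (by decide) (by decide), h0]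
    · rw [hoth 1 (by decide) (by decide) (by decide) (by decide) (by decide), h1]
  · refine ⟨le_rfl, ?_, e3.ge, e9, fun _ _ => rfl, by simp [hs₀, State.setReg],
      by simp [hs₀, State.setReg]⟩
    rw [List.drop_length]
    simp [hs₀, State.setReg, h11]
    rfl
  · rintro s' ⟨-, -, h1, h2, -, -, h5, h6⟩
    rw [List.drop_zero] at h1
    exact hQ s' h1 (by omega) h5 h6

lemma runs_readProg {n : ℕ} (G : SimpleGraph (Fin n)) (k : ℕ) {Q : State → Prop}
    (hQ : ∀ s' : State, Rep s'.mem (s'.reg 3) (enc (n, k, bits G)) (s'.reg 2) → s'.reg 3 ≠ 0 →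
      Q s') :
    Runs readProg (input G k) (n * n * 13 + n * 15 + k * 11 + 30) Q := by
  have hl : (bits G).length = n * n := by simp [bits]
  have h0 : (input G k).reg 0 = n := rfl
  have h1 : (input G k).reg 1 = k := rfl
  refine Runs.mono (T := (n * 4 + 2) + (((bits G).length * 13 + 5) + ((k * 11 + 9) +
    ((n * 11 + 9) + 1)))) (.seq ?_) (by rw [hl]; omega) fun _ h => h
  refine runs_squareProg rfl fun s₁ e6 eo em => ?_
  have f0 : s₁.reg 0 = n := eo 0 (by decide) (by decide) (by decide)
  have f1 : s₁.reg 1 = k := eo 1 (by decide) (by decide) (by decide)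
  refine .seq (runs_bitsProg (bits G) (by rw [e6, hl, h0])
    (eo 11 (by decide) (by decide) (by decide)) (fun i hi => ?_) (fun i hi => ?_)
    fun s₂ g1 g2 g3 g4 => ?_)
  · rw [em]
    simp only [input, bits, List.getElem_map, List.getElem_range]
    split_ifs with h <;> simp [h]
  · rw [em]
    simp only [input]
    rw [if_neg]
    rintro ⟨i', j', -, rfl⟩
    rw [hl] at hi
    have : (i' : ℕ) * n + j' < n * n := by
      calc (i' : ℕ) * n + j' < i' * n + n := by omega
        _ = (i' + 1) * n := by ring
        _ ≤ n * n := Nat.mul_le_mul_right n i'.2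
    omega
  · have g4' : s₂.reg 1 = k := by rw [g4, f1]
    rw [← g4']
    refine .seq (runs_prependProg (by decide) g2 g1 fun s₃ k1 k2 k3 => ?_)
    have k0 : s₃.reg 0 = n := by
      rw [k3 0 (by decide) (by decide) (by decide) (by decide) (by decide) (by decide), g3, f0]
    have : Runs (prependProg 0 ;; .move 2 11) s₃ ((s₃.reg 0 * 11 + 9) + 1) Q :=
      .seq (runs_prependProg (by decide) k2 k1 fun s₄ l1 l2 _ => .move (hQ _ (by
        rw [g4', k0] at l1
        have l1 : Rep s₄.mem (s₄.reg 3) (enc (n, k, bits G)) (s₄.reg 11) := l1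
        simpa [State.setReg] using l1) (by simpa [State.setReg] using l2)))
    rwa [k0] at this

/-- A program that decides a predicate of the input. -/
lemma exists_prog_of_realizes {p : Prog} {n k T : ℕ} {G : SimpleGraph (Fin n)} {P : Prop}
    (hp : Realizes p (enc (n, k, bits G)) (enc P) T) :
    Runs (readProg ;; p ;; .ite 2 (.const 0 1) (.const 0 0)) (input G k)
      (n * n * 13 + n * 15 + k * 11 + 30 + (T + 2)) fun s => s.reg 0 = 1 ↔ P := by
  refine .seq (runs_readProg G k fun s h1 h2 => .seq ((hp s h2 h1).mono le_rfl ?_))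
  rintro s' ⟨h3, -, -, -⟩
  refine .ite (fun h => .const ?_) (fun h => .const ?_)
  · have hP : P := by
      by_contra hP
      rw [enc_of_not hP] at h3
      exact h h3
    simp [State.setReg, hP]
  · have hP : ¬P := by
      intro hP
      rw [enc_of hP] at h3
      exact h3.1 h
    simp [State.setReg, hP]

end RAM

/-! ### The program -/

section Program

/-- The parameters of the algorithm as functions of the budget. The bound on the number of stored
objects is `2 ^ e`. The other components have the meaning explained at `Inst`. -/
structure Params where
  τ : ℕ → ℕ
  s : ℕ → ℕ
  R : ℕ → ℕ
  T₁ : ℕ → ℕ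
  T₂ : ℕ → ℕ
  e : ℕ → ℕ

/-- The parameters are computable in polynomial time, as functions of a number in unary. -/
structure Params.Poly (P : Params) : Prop where
  τ : PolyTime P.τ
  s : PolyTime P.s
  R : PolyTime P.R
  T₁ : PolyTime P.T₁
  T₂ : PolyTime P.T₂
  e : PolyTime P.e

/-- The input of the algorithm for the graph `G` and the budget `k`. -/
noncomputable def Params.inst (P : Params) {n : ℕ} (G : SimpleGraph (Fin n)) (k : ℕ) : Inst where
  n := n
  k := k
  bits := bits G
  τ := P.τ k
  s := P.s k
  R := P.R k
  T₁ := P.T₁ k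
  T₂ := P.T₂ k
  fuel := 2 ^ P.e k

lemma Params.represents (P : Params) {n : ℕ} (G : SimpleGraph (Fin n)) (k : ℕ) :
    (P.inst G k).Represents G := ⟨rfl, bits_adj G⟩

/-- Powers of two are computed in time polynomial in the result, by iterated doubling. -/
lemma exists_realizes_two_pow : ∃ (p : Prog) (c K : ℕ), ∀ e : ℕ,
    Realizes p (enc e) (enc (2 ^ e)) (e * ((8 * 2 ^ e) ^ c + 150) + K) := by
  have hd : PolyTime fun y : Unit × (ℕ × Unit) => y.2.1 + y.2.1 := by fun_prop
  obtain ⟨p, T, ⟨c, hT⟩, hp, -⟩ := hd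
  obtain ⟨q, U, hq⟩ := exists_realizes_const (enc ((), 1))
  have hfold : ∀ l : List Unit, l.foldl (fun a _ => a + a) 1 = 2 ^ l.length := by
    intro l
    induction l using List.reverseRecOn with
    | nil => rfl
    | append_singleton l a ih =>
      rw [List.foldl_append, List.foldl_cons, List.foldl_nil, ih, List.length_append,
        List.length_singleton, pow_succ, mul_two]
  refine ⟨pairProg .skip q ;; foldProg p, c, U + 51, fun e => ?_⟩
  have h := Realizes.foldl (p := p) (x := ()) (l := List.replicate e ()) (f := fun a _ => a + a)
    (b := 1) (T := (8 * 2 ^ e) ^ c) fun l₁ a l₂ hl => by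
      refine (hp ((), (l₁.foldl (fun a _ => a + a) 1, a))).mono ((hT _).trans
        (Nat.pow_le_pow_left ?_ c))
      have h1 := congrArg List.length hl
      rw [List.length_replicate, List.length_append, List.length_cons] at h1
      have h2 : 2 * 2 ^ l₁.length ≤ 2 ^ e := by
        rw [← pow_succ']; exact Nat.pow_le_pow_right (by norm_num) (by omega)
      have h3 := Nat.one_le_two_pow (n := l₁.length)
      have h4 : esize ((), (l₁.foldl (fun a _ => a + a) 1, a)) =
          1 + (esize (l₁.foldl (fun a _ => a + a) 1) + 1 + 1) + 1 := rfl
      rw [h4, esize_nat, hfold]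
      omega
  rw [hfold, List.length_replicate] at h
  exact (((realizes_skip (enc e)).pair (hq (enc e))).seq h).mono (by omega)

/-- `f n k` is bounded by a polynomial in `n`, `k` and `2 ^ e k`, whose degree in `n` and in `2 ^ e k`
is `c`. -/
def Dominated (e : ℕ → ℕ) (c : ℕ) (f : ℕ → ℕ → ℕ) : Prop :=
  ∃ C d, ∀ n k, f n k ≤ C * (n + 1) ^ c * (k + 1) ^ d * 2 ^ (c * e k)

section Dominated

variable {e : ℕ → ℕ} {a b c : ℕ} {f g : ℕ → ℕ → ℕ}

lemma Dominated.mono (hf : Dominated e a f) (hab : a ≤ b) (hgf : ∀ n k, g n k ≤ f n k) :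
    Dominated e b g := by
  obtain ⟨C, d, h⟩ := hf
  refine ⟨C, d, fun n k => (hgf n k).trans ((h n k).trans ?_)⟩
  gcongr <;> omega

lemma Dominated.add (hf : Dominated e a f) (hg : Dominated e a g) :
    Dominated e a fun n k => f n k + g n k := by
  obtain ⟨C, d, h⟩ := hf
  obtain ⟨C', d', h'⟩ := hg
  refine ⟨C + C', d + d', fun n k => (Nat.add_le_add (h n k) (h' n k)).trans ?_⟩
  rw [add_mul, add_mul, add_mul]
  gcongr <;> omega

lemma Dominated.mul (hf : Dominated e a f) (hg : Dominated e b g) :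
    Dominated e (a + b) fun n k => f n k * g n k := by
  obtain ⟨C, d, h⟩ := hf
  obtain ⟨C', d', h'⟩ := hg
  refine ⟨C * C', d + d', fun n k => (Nat.mul_le_mul (h n k) (h' n k)).trans (le_of_eq ?_)⟩
  ring

lemma Dominated.pow (hf : Dominated e a f) (m : ℕ) :
    Dominated e (a * m) fun n k => f n k ^ m := by
  obtain ⟨C, d, h⟩ := hf
  refine ⟨C ^ m, d * m, fun n k => (Nat.pow_le_pow_left (h n k) m).trans (le_of_eq ?_)⟩
  ring

lemma Dominated.const (K : ℕ) : Dominated e 0 fun _ _ => K := ⟨K, 0, fun n k => by simp⟩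

lemma Dominated.n : Dominated e 1 fun n _ => n :=
  ⟨1, 0, fun n k => by
    simp only [pow_one, pow_zero, one_mul, mul_one]
    exact (Nat.le_succ n).trans (Nat.le_mul_of_pos_right _ (Nat.two_pow_pos _))⟩

lemma Dominated.two_pow : Dominated e 1 fun _ k => 2 ^ e k :=
  ⟨1, 0, fun n k => by
    simp only [pow_one, pow_zero, one_mul, mul_one]
    exact Nat.le_mul_of_pos_left _ (by omega)⟩

lemma Dominated.of_polyBound {T : ℕ → ℕ} (hT : PolyBound T) : Dominated e 0 fun _ k => T k := by
  obtain ⟨d, h⟩ := hT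
  refine ⟨3 ^ d, d, fun n k => (h k).trans ?_⟩
  rw [esize_nat]
  simp only [pow_zero, mul_one, zero_mul]
  rw [← mul_pow]
  exact Nat.pow_le_pow_left (by omega) d

end Dominated

lemma polyTime_instMk (r : ℕ) : PolyTime fun y : (ℕ × ℕ × List Prop) × (ℕ × ℕ × ℕ × ℕ × ℕ × ℕ) =>
    (Inst.mk y.1.1 y.1.2.1 y.1.2.2 y.2.1 y.2.2.1 y.2.2.2.1 y.2.2.2.2.1 y.2.2.2.2.2.1
      y.2.2.2.2.2.2).Answer r := by
  refine (polyTime_answer r).comp ?_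
  have h : PolyTime fun y : (ℕ × ℕ × List Prop) × (ℕ × ℕ × ℕ × ℕ × ℕ × ℕ) =>
    (y.1.1, y.1.2.1, y.1.2.2, y.2.1, y.2.2.1, y.2.2.2.1, y.2.2.2.2.1, y.2.2.2.2.2.1,
      y.2.2.2.2.2.2) := by fun_prop
  obtain ⟨p, T, h1, h2, h3⟩ := h
  exact ⟨p, T, h1, h2, h3⟩

/-- The algorithm as a program. The degree in `n` and in `2 ^ e k` of its running time does not depend
on the parameters. -/
lemma exists_prog_answer (r : ℕ) : ∃ c : ℕ, ∀ P : Params, P.Poly → ∃ (p : Prog) (C d : ℕ),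
    ∀ (n : ℕ) (G : SimpleGraph (Fin n)) (k : ℕ),
      Runs p (input G k) (C * (n + 1) ^ c * (k + 1) ^ d * 2 ^ (c * P.e k)) fun s =>
        s.reg 0 = 1 ↔ (P.inst G k).Answer r := by
  obtain ⟨pA, TA, ⟨cA, hTA⟩, hpA, -⟩ := polyTime_instMk r
  obtain ⟨p₂, c₂, K₂, hp₂⟩ := exists_realizes_two_pow
  refine ⟨2 + c₂ + 2 * cA, fun P hP => ?_⟩
  obtain ⟨pτ, Tτ, hTτ, hpτ, hsτ⟩ := hP.τ
  obtain ⟨ps, Ts, hTs, hps, hss⟩ := hP.s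
  obtain ⟨pR, TR, hTR, hpR, hsR⟩ := hP.R
  obtain ⟨p1, T1, hT1, hp1, hs1⟩ := hP.T₁
  obtain ⟨p2, T2, hT2, hp2, hs2⟩ := hP.T₂
  obtain ⟨pe, Te, hTe, hpe, hse⟩ := hP.e
  let X : ℕ → ℕ → ℕ := fun n k => (2 * n + 1) + ((2 * k + 1) + (n * n * 4 + 1) + 1) + 1 +
    (esize (P.τ k) + (esize (P.s k) + (esize (P.R k) + (esize (P.T₁ k) + (esize (P.T₂ k) +
      (2 * 2 ^ P.e k + 1) + 1) + 1) + 1) + 1) + 1) + 1 + 2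
  let Y : ℕ → ℕ := fun k => Tτ k + (Ts k + (TR k + (T1 k + (T2 k + (Te k + K₂)))))
  have hY : PolyBound Y :=
    hTτ.add (hTs.add (hTR.add (hT1.add (hT2.add (hTe.add (.const K₂))))))
  have hdom : Dominated P.e (2 + c₂ + 2 * cA) fun n k =>
      n * n * 13 + n * 15 + k * 11 + 30 + (Y k + P.e k * ((8 * 2 ^ P.e k) ^ c₂ + 150) + 300 +
        X n k ^ cA + 2) := by
    have dk : ∀ m, Dominated P.e 0 fun _ k => k * m := fun m =>
      .of_polyBound ((PolyBound.esize.mono fun k => by rw [esize_nat]; omega).mul (.const m))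
    have dn : ∀ m, Dominated P.e 1 fun n _ => n * m := fun m => Dominated.n.mul (.const m)
    have dnn : ∀ m, Dominated P.e 2 fun n _ => n * n * m := fun m =>
      (Dominated.n.mul .n).mul (.const m)
    have de : Dominated P.e 0 fun _ k => P.e k :=
      .of_polyBound (hse.mono fun k => by rw [esize_nat]; omega)
    have dp : Dominated P.e c₂ fun _ k => P.e k * ((8 * 2 ^ P.e k) ^ c₂ + 150) :=
      (de.mul (((((Dominated.const 8).mul .two_pow).pow c₂).mono (b := c₂) (by omega)
        fun _ _ => le_rfl).add ((Dominated.const 150).mono (Nat.zero_le _) fun _ _ => le_rfl))).mono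
          (by omega) fun _ _ => le_rfl
    have dX : Dominated P.e 2 X := by
      have d2 : Dominated P.e 2 fun _ k => 2 ^ P.e k * 2 :=
        (Dominated.two_pow.mul (.const 2)).mono (by omega) fun _ _ => le_rfl
      have ds : Dominated P.e 2 fun _ k => esize (P.τ k) + esize (P.s k) + esize (P.R k) +
          esize (P.T₁ k) + esize (P.T₂ k) + 20 :=
        (Dominated.of_polyBound (((((hsτ.add hss).add hsR).add hs1).add hs2).add (.const 20))).mono
          (by omega) fun _ _ => le_rfl
      refine ((((((dn 2).mono (b := 2) (by omega) fun _ _ => le_rfl).add ((dk 2).mono (by omega)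
        fun _ _ => le_rfl)).add (dnn 4)).add ds).add d2).mono le_rfl fun n k => ?_
      simp only [X]
      omega
    have dXp : Dominated P.e (2 + c₂ + 2 * cA) fun n k => X n k ^ cA :=
      (dX.pow cA).mono (by omega) fun _ _ => le_rfl
    have dY : Dominated P.e (2 + c₂ + 2 * cA) fun _ k => Y k + 332 :=
      (Dominated.of_polyBound (hY.add (.const 332))).mono (by omega) fun _ _ => le_rfl
    refine (((((((dnn 13).mono (b := 2 + c₂ + 2 * cA) (by omega) fun _ _ => le_rfl).add
      ((dn 15).mono (by omega) fun _ _ => le_rfl)).add ((dk 11).mono (by omega)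
      fun _ _ => le_rfl)).add dY).add (dp.mono (by omega) fun _ _ => le_rfl)).add dXp).mono le_rfl
      fun n k => ?_
    omega
  obtain ⟨C, d, hCd⟩ := hdom
  refine ⟨readProg ;; (pairProg .skip ((sndProg ;; .load 2 2) ;; pairProg pτ (pairProg ps
    (pairProg pR (pairProg p1 (pairProg p2 (pe ;; p₂)))))) ;; pA) ;;
      .ite 2 (.const 0 1) (.const 0 0), C, d, fun n G k => ?_⟩
  refine (exists_prog_of_realizes (T := Y k + P.e k * ((8 * 2 ^ P.e k) ^ c₂ + 150) + 300 +
    X n k ^ cA) ?_).mono (hCd n k) fun _ h => h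
  have hpar : Realizes (pairProg pτ (pairProg ps (pairProg pR (pairProg p1 (pairProg p2
      (pe ;; p₂)))))) (enc k) (enc (P.τ k, P.s k, P.R k, P.T₁ k, P.T₂ k, 2 ^ P.e k)) _ :=
    (hpτ k).pair ((hps k).pair ((hpR k).pair ((hp1 k).pair ((hp2 k).pair
      ((hpe k).seq (hp₂ (P.e k)))))))
  have hall := ((realizes_skip (enc (n, k, bits G))).pair (((realizes_snd (enc n)
    (enc (k, bits G))).seq (realizes_fst (enc k) (enc (bits G)))).seq hpar)).seq
      (hpA ((n, k, bits G), (P.τ k, P.s k, P.R k, P.T₁ k, P.T₂ k, 2 ^ P.e k)))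
  refine hall.mono ?_
  have hX : TA ((n, k, bits G), (P.τ k, P.s k, P.R k, P.T₁ k, P.T₂ k, 2 ^ P.e k)) ≤
      X n k ^ cA := by
    refine (hTA _).trans (Nat.pow_le_pow_left ?_ _)
    have hb : esize (bits G) ≤ n * n * 4 + 1 := by
      refine (esize_list_le (B := 3) fun a _ => esize_prop a).trans (le_of_eq ?_)
      simp [bits]
    simp only [esize_pair, X]
    rw [esize_nat n, esize_nat k, esize_nat (2 ^ P.e k)]
    omega
  simp only [Y]
  omega

end Program

/-! ### The choice of the parameters -/

section Parameters

/-- One more than the integral part of the `q`-th root of `k`. -/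
noncomputable def rootSucc (q k : ℕ) : ℕ := ((List.range (k + 1)).filter fun i => i ^ q ≤ k).length

lemma rootSucc_spec {q : ℕ} (hq : 1 ≤ q) (k : ℕ) :
    1 ≤ rootSucc q k ∧ k < rootSucc q k ^ q ∧ (rootSucc q k - 1) ^ q ≤ k := by
  set ρ := Nat.findGreatest (fun i => i ^ q ≤ k) k with hρ
  have h0 : ρ ^ q ≤ k := Nat.findGreatest_spec (P := fun i => i ^ q ≤ k) (m := 0) (Nat.zero_le _)
    (by rw [Nat.zero_pow hq]; exact Nat.zero_le _)
  have h1 : k < (ρ + 1) ^ q := by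
    by_contra h
    push Not at h
    have h2 : ρ + 1 ≤ k := (Nat.le_self_pow (by omega) _).trans h
    exact Nat.findGreatest_is_greatest (P := fun i => i ^ q ≤ k) (Nat.lt_succ_self ρ) h2 h
  have h2 : rootSucc q k = ρ + 1 := by
    have hnd : ((List.range (k + 1)).filter fun i => i ^ q ≤ k).Nodup := List.nodup_range.filter _
    rw [rootSucc, ← List.toFinset_card_of_nodup hnd, ← Finset.card_range (ρ + 1)]
    congr 1
    ext i
    simp only [List.mem_toFinset, List.mem_filter, List.mem_range, decide_eq_true_eq,
      Finset.mem_range]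
    constructor
    · rintro ⟨-, h⟩
      exact lt_of_pow_lt_pow_left₀ q (Nat.zero_le _) (h.trans_lt h1)
    · intro h
      have h3 : i ^ q ≤ k := (Nat.pow_le_pow_left (by omega) q).trans h0
      exact ⟨by have := Nat.le_self_pow (by omega : q ≠ 0) i; omega, h3⟩
  rw [h2]
  exact ⟨by omega, h1, h0⟩

@[fun_prop]
lemma polyTime_rootSucc (q : ℕ) : PolyTime fun k => rootSucc q k := by
  unfold rootSucc; fun_prop

/-- The parameters in terms of `w = rootSucc q k`, where `w ^ q` is about `k`. -/
noncomputable def params (r q aS aR aE : ℕ) : Params where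
  τ k := rootSucc q k ^ 2 + r
  s k := aS * rootSucc q k ^ (q - 4)
  R k := aR * rootSucc q k
  T₁ k := rootSucc q k ^ (q - 2)
  T₂ k := (r + 1) * rootSucc q k ^ (q - 2)
  e k := aE * rootSucc q k ^ (q - 1)

lemma params_poly (r q aS aR aE : ℕ) : (params r q aS aR aE).Poly := by
  constructor <;> (simp only [params]; fun_prop)

lemma le_two_pow_of_le {x a b w : ℕ} (hw : 1 ≤ w) (hx : x ≤ a * w ^ b) : x ≤ 2 ^ ((a + b) * w) := by
  have h1 : a ≤ 2 ^ (a * w) := (Nat.le_mul_of_pos_right a hw).trans Nat.lt_two_pow_self.le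
  have h2 : w ^ b ≤ 2 ^ (b * w) := by
    rw [mul_comm, pow_mul]
    exact Nat.pow_le_pow_left Nat.lt_two_pow_self.le b
  rw [add_mul, pow_add]
  exact hx.trans (Nat.mul_le_mul h1 h2)

lemma pow_le_two_pow {x y a b d j w E m : ℕ} (hw : 1 ≤ w) (hx : x ≤ a * w ^ b) (hy : y ≤ d * w ^ j)
    (hj : j + 1 ≤ m) (hE : (a + b) * d ≤ E) : x ^ y ≤ 2 ^ (E * w ^ m) := by
  calc x ^ y ≤ (2 ^ ((a + b) * w)) ^ y := Nat.pow_le_pow_left (le_two_pow_of_le hw hx) y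
    _ = 2 ^ ((a + b) * w * y) := (pow_mul _ _ _).symm
    _ ≤ 2 ^ (E * w ^ m) := Nat.pow_le_pow_right (by norm_num) ?_
  calc (a + b) * w * y ≤ (a + b) * w * (d * w ^ j) := Nat.mul_le_mul_left _ hy
    _ = (a + b) * d * w ^ (j + 1) := by ring
    _ ≤ E * w ^ m := Nat.mul_le_mul hE (Nat.pow_le_pow_right hw hj)

/-- A bound for the size of the core in terms of `w`. -/
lemma exists_coreBound_le (r u M q : ℕ) (hq : 1 ≤ q) : ∃ aM, 1 ≤ aM ∧ ∀ k,
    (r * k + 1) * (1 + M * (rootSucc q k ^ 2 + 2 * r) ^ u * (rootSucc q k ^ 2 + r) * r) ^ r ≤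
      aM * rootSucc q k ^ (q + (2 * u + 2) * r) := by
  refine ⟨(r + 1) * (1 + M * (1 + 2 * r) ^ u * (1 + r) * r) ^ r,
    Nat.mul_pos (by omega) (Nat.pow_pos (by omega)), fun k => ?_⟩
  obtain ⟨hw, hk, -⟩ := rootSucc_spec hq k
  generalize rootSucc q k = w at hw hk
  have hw2 : 1 ≤ w ^ 2 := Nat.one_le_pow _ _ hw
  have h1 : w ^ 2 + 2 * r ≤ (1 + 2 * r) * w ^ 2 := by nlinarith
  have h2 : w ^ 2 + r ≤ (1 + r) * w ^ 2 := by nlinarith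
  have h3 : r * k + 1 ≤ (r + 1) * w ^ q := by nlinarith [Nat.mul_le_mul_left r hk.le]
  have h4 : 1 ≤ w ^ (2 * u + 2) := Nat.one_le_pow _ _ hw
  calc (r * k + 1) * (1 + M * (w ^ 2 + 2 * r) ^ u * (w ^ 2 + r) * r) ^ r
      ≤ ((r + 1) * w ^ q) * (w ^ (2 * u + 2) +
          M * ((1 + 2 * r) * w ^ 2) ^ u * ((1 + r) * w ^ 2) * r) ^ r := by gcongr
    _ = ((r + 1) * w ^ q) * ((1 + M * (1 + 2 * r) ^ u * (1 + r) * r) * w ^ (2 * u + 2)) ^ r := by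
        congr 2
        rw [mul_pow, ← pow_mul]
        ring
    _ = _ := by rw [mul_pow, ← pow_mul]; ring

/-- The parameters suffice if the constants are large. -/
lemma exists_fits {r u M q aM aS : ℕ} (hr : 1 ≤ r) (hq : 5 ≤ q)
    (haM : ∀ k, (r * k + 1) * (1 + M * (rootSucc q k ^ 2 + 2 * r) ^ u *
      (rootSucc q k ^ 2 + r) * r) ^ r ≤ aM * rootSucc q k ^ (q + (2 * u + 2) * r)) :
    ∃ aR aE, ∀ (n : ℕ) (G : SimpleGraph (Fin n)) (k : ℕ),
      ((params r q aS aR aE).inst G k).Fits r (M * (rootSucc q k ^ 2 + 2 * r) ^ u) := by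
  set b := q + (2 * u + 2) * r with hb
  set aN := M * (1 + 2 * r) ^ u with haN
  have hsum : ∀ x₁ x₂ x₃ x₄ x₅ : ℕ, ∃ E, x₁ ≤ E ∧ x₂ ≤ E ∧ x₃ ≤ E ∧ x₄ ≤ E ∧ x₅ ≤ E :=
    fun x₁ x₂ x₃ x₄ x₅ => ⟨x₁ + x₂ + x₃ + x₄ + x₅, by omega⟩
  obtain ⟨aE, hE₁, hE₂, hE₃, hE₄, hE₅⟩ := hsum ((r + 1 + q) * (r + 1)) ((r + 2 + 2) * r)
    ((aN * aM + 1 + (2 * u + b)) * (r + 1)) ((aM + b) * aS) ((aM + b) + (aM + b) * aS)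
  refine ⟨aM + b, aE, fun n G k => ?_⟩
  obtain ⟨hw, hk, -⟩ := rootSucc_spec (by omega : 1 ≤ q) k
  have hm := haM k
  set c := (params r q aS (aM + b) aE).inst G k with hc
  have eτ : c.τ = rootSucc q k ^ 2 + r := rfl
  have es : c.s = aS * rootSucc q k ^ (q - 4) := rfl
  have eR : c.R = (aM + b) * rootSucc q k := rfl
  have e1 : c.T₁ = rootSucc q k ^ (q - 2) := rfl
  have e2 : c.T₂ = (r + 1) * rootSucc q k ^ (q - 2) := rfl
  have ef : c.fuel = 2 ^ (aE * rootSucc q k ^ (q - 1)) := rfl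
  have ek : c.k = k := rfl
  have hcore : c.coreBound r (M * (rootSucc q k ^ 2 + 2 * r) ^ u) ≤ aM * rootSucc q k ^ b := hm
  obtain ⟨m, hcm⟩ : ∃ m, c.coreBound r (M * (rootSucc q k ^ 2 + 2 * r) ^ u) = m := ⟨_, rfl⟩
  rw [hcm] at hcore
  clear hm haM
  clear_value c aN b
  generalize rootSucc q k = w at *
  have hw2 : 1 ≤ w ^ 2 := Nat.one_le_pow _ _ hw
  have hw1 : 1 ≤ w ^ (q - 2) := Nat.one_le_pow _ _ hw
  have hkw : k < w ^ (q - 2) * w ^ 2 := by rwa [← pow_add, Nat.sub_add_cancel (by omega)]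
  have hN : M * (w ^ 2 + 2 * r) ^ u ≤ aN * w ^ (2 * u) := by
    rw [haN, mul_assoc, pow_mul, ← mul_pow]
    exact Nat.mul_le_mul_left _ (Nat.pow_le_pow_left (by
      have := Nat.le_mul_of_pos_right (2 * r) hw2
      rw [add_mul, one_mul]; omega) u)
  have hτ : w ^ 2 + r ≤ (r + 1) * w ^ 2 := by
    have := Nat.le_mul_of_pos_right r hw2
    rw [add_mul, one_mul]; omega
  have hrk : r * k + 1 ≤ (r + 1) * w ^ q := by
    have := Nat.mul_le_mul_left r hk.le
    rw [add_mul, one_mul]; omega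
  refine ⟨?_, ?_, ?_, ?_, ?_, ?_, ?_, ?_⟩
  · rw [ef]
    refine pow_le_two_pow (a := r + 1) (b := q) (d := r + 1) (j := 2) hw ?_ ?_ (by omega)
      hE₁
    · rw [ek]; exact hrk
    · rw [eτ]; exact hτ
  · rw [ef, ← pow_mul]
    refine pow_le_two_pow (a := r + 2) (b := 2) (d := r) (j := q - 2) hw ?_ (by rw [e1])
      (by omega) hE₂
    rw [eτ, show r + 2 = r + 1 + 1 by rfl, add_mul _ 1, one_mul]
    exact Nat.add_le_add hτ hw2
  · rw [ek, e1, eτ]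
    refine hkw.trans_le (Nat.mul_le_mul_left _ (by omega))
  · rw [ef, hcm]
    refine pow_le_two_pow (a := aN * aM + 1) (b := 2 * u + b) (d := r + 1) (j := q - 2) hw ?_
      (by rw [e2]) (by omega) hE₃
    calc M * (w ^ 2 + 2 * r) ^ u * m + 1 ≤ (aN * w ^ (2 * u)) * (aM * w ^ b) + w ^ (2 * u + b) :=
          Nat.add_le_add (Nat.mul_le_mul hN hcore) (Nat.one_le_pow _ _ hw)
      _ = (aN * aM + 1) * w ^ (2 * u + b) := by ring
  · rw [ek, eτ, e2]
    refine Nat.mul_le_mul_left _ (Nat.succ_le_of_lt (Nat.div_lt_of_lt_mul ?_))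
    rw [mul_comm] at hkw
    exact hkw.trans_le (Nat.mul_le_mul_right _ (by omega))
  · rw [ef, hcm]
    exact pow_le_two_pow (d := aS) (j := q - 4) hw hcore (by rw [es]) (by omega)
      hE₄
  · rw [ef, hcm]
    have h1 : c.R * c.s ≤ (aM + b) * aS * w ^ (q - 1) := by
      rw [eR, es]
      calc (aM + b) * w * (aS * w ^ (q - 4)) = (aM + b) * aS * w ^ (q - 4 + 1) := by ring
        _ ≤ _ := Nat.mul_le_mul_left _ (Nat.pow_le_pow_right hw (by omega))
    have h2 : m ≤ 2 ^ ((aM + b) * w ^ (q - 1)) := (le_two_pow_of_le hw hcore).trans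
      (Nat.pow_le_pow_right (by norm_num) (Nat.mul_le_mul_left _ (Nat.le_self_pow (by omega) w)))
    calc m * 2 ^ (c.R * c.s) ≤ 2 ^ ((aM + b) * w ^ (q - 1)) * 2 ^ ((aM + b) * aS * w ^ (q - 1)) :=
          Nat.mul_le_mul h2 (Nat.pow_le_pow_right (by norm_num) h1)
      _ = 2 ^ (((aM + b) + (aM + b) * aS) * w ^ (q - 1)) := by rw [← pow_add, ← add_mul]
      _ ≤ _ := Nat.pow_le_pow_right (by norm_num) (Nat.mul_le_mul_right _ hE₅)
  · rw [eR, hcm]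
    exact le_two_pow_of_le hw hcore

/-- The bound on the treewidth in terms of `w`. -/
lemma treewidth_bound {α μ B : ℝ} (hα : 0 < α) (hμ : 0 < μ) {u M q r b aM w x m t ω : ℕ}
    (hu : μ ≤ u) (hB : B ≤ M) (hw : 1 ≤ w) (hx : x = w ^ 2 + 2 * r) (hω : ω ≤ x)
    (hα1 : α ≤ 1) (hq : b * α + (2 * u + 4) ≤ q) (haM : 1 ≤ aM) (hm : m ≤ aM * w ^ b)
    (ht : (t : ℝ) ≤ B * ((ω : ℝ) ^ μ * (m : ℝ) ^ α)) :
    t + 2 ≤ (M * (1 + 2 * r) ^ u * aM + 2) * w ^ (q - 4) := by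
  have hw' : (1 : ℝ) ≤ w := by exact_mod_cast hw
  have hw2 : 1 ≤ w ^ 2 := Nat.one_le_pow _ _ hw
  have hx1 : (1 : ℝ) ≤ x := by
    have : 1 ≤ x := by omega
    exact_mod_cast this
  have h1 : (ω : ℝ) ^ μ ≤ (x : ℝ) ^ u := by
    rw [← Real.rpow_natCast]
    exact (Real.rpow_le_rpow (by positivity) (by exact_mod_cast hω) hμ.le).trans
      (Real.rpow_le_rpow_of_exponent_le hx1 hu)
  have h2 : (x : ℝ) ^ u ≤ (1 + 2 * r : ℝ) ^ u * (w : ℝ) ^ (2 * u) := by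
    rw [pow_mul, ← mul_pow]
    refine pow_le_pow_left₀ (by positivity) ?_ u
    have : x ≤ (1 + 2 * r) * w ^ 2 := by rw [hx]; nlinarith
    exact_mod_cast this
  have hq4 : 2 * u + 4 ≤ q := by
    have : ((2 * u + 4 : ℕ) : ℝ) ≤ q := by
      push_cast
      have : 0 ≤ b * α := by positivity
      linarith
    exact_mod_cast this
  have h3 : (m : ℝ) ^ α ≤ aM * (w : ℝ) ^ (q - 4 - 2 * u) := by
    calc (m : ℝ) ^ α ≤ ((aM : ℝ) * (w : ℝ) ^ b) ^ α :=
          Real.rpow_le_rpow (by positivity) (by exact_mod_cast hm) hα.le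
      _ = (aM : ℝ) ^ α * (w : ℝ) ^ (b * α) := by
          rw [Real.mul_rpow (by positivity) (by positivity), ← Real.rpow_natCast,
            ← Real.rpow_mul (by positivity)]
      _ ≤ (aM : ℝ) ^ (1 : ℝ) * (w : ℝ) ^ ((q - 4 - 2 * u : ℕ) : ℝ) := by
          refine mul_le_mul (Real.rpow_le_rpow_of_exponent_le (by exact_mod_cast haM) hα1)
            (Real.rpow_le_rpow_of_exponent_le hw' ?_) (by positivity) (by positivity)
          rw [Nat.cast_sub (by omega), Nat.cast_sub (by omega)]
          push_cast
          linarith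
      _ = _ := by rw [Real.rpow_one, Real.rpow_natCast]
  have h4 : (t : ℝ) ≤ M * ((1 + 2 * r : ℝ) ^ u * (w : ℝ) ^ (2 * u) *
      (aM * (w : ℝ) ^ (q - 4 - 2 * u))) :=
    ht.trans (mul_le_mul hB (mul_le_mul (h1.trans h2) h3 (by positivity) (by positivity))
      (by positivity) (by positivity))
  have h5 : (M : ℝ) * ((1 + 2 * r : ℝ) ^ u * (w : ℝ) ^ (2 * u) * (aM * (w : ℝ) ^ (q - 4 - 2 * u))) =
      ((M * (1 + 2 * r) ^ u * aM * w ^ (q - 4) : ℕ) : ℝ) := by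
    rw [show q - 4 = 2 * u + (q - 4 - 2 * u) by omega, pow_add]
    rw [show 2 * u + (q - 4 - 2 * u) - 2 * u = q - 4 - 2 * u by omega]
    push_cast
    ring
  rw [h5] at h4
  have h6 : t ≤ M * (1 + 2 * r) ^ u * aM * w ^ (q - 4) := by exact_mod_cast h4
  have h7 : 1 ≤ w ^ (q - 4) := Nat.one_le_pow _ _ hw
  rw [add_mul]
  omega

/-- Exponentials of `w ^ (q - 1)` are subexponential in `k`. -/
lemma exists_two_pow_le (q K : ℕ) (hq : 1 ≤ q) : ∃ K' : ℕ, ∀ k : ℕ,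
    (2 : ℝ) ^ (K * rootSucc q k ^ (q - 1)) ≤ 2 ^ K' * (2 : ℝ) ^ ((k : ℝ) ^ (1 - 1 / (2 * q : ℝ))) := by
  set L := (K * 2 ^ (q - 1)) ^ 2 with hL
  refine ⟨K * (L + 2) ^ (q - 1), fun k => ?_⟩
  obtain ⟨hw, -, hk⟩ := rootSucc_spec hq k
  obtain ⟨ρ, hρ⟩ : ∃ ρ, rootSucc q k = ρ + 1 := ⟨rootSucc q k - 1, by omega⟩
  rw [hρ] at hk ⊢
  rw [Nat.add_sub_cancel] at hk
  have hq' : (1 : ℝ) ≤ q := by exact_mod_cast hq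
  rcases Nat.lt_or_ge ρ (L + 1) with h | h
  · refine le_trans (pow_le_pow_right₀ (by norm_num) (Nat.mul_le_mul_left K
      (Nat.pow_le_pow_left (by omega : ρ + 1 ≤ L + 2) (q - 1)))) ?_
    refine le_mul_of_one_le_right (by positivity) (Real.one_le_rpow (by norm_num) (by positivity))
  · -- for large `k` the factor `K` is absorbed by the additional factor `√ρ`
    refine le_trans ?_ (le_mul_of_one_le_left (by positivity) (one_le_pow₀ (by norm_num)))
    rw [← Real.rpow_natCast]
    refine Real.rpow_le_rpow_of_exponent_le (by norm_num) ?_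
    have hρ1 : 1 ≤ ρ := by omega
    have h1 : (K * 2 ^ (q - 1) : ℝ) ≤ (ρ : ℝ) ^ (1 / 2 : ℝ) := by
      rw [← Real.sqrt_eq_rpow]
      refine Real.le_sqrt_of_sq_le ?_
      have : (K * 2 ^ (q - 1)) ^ 2 ≤ ρ := by omega
      exact_mod_cast this
    have h2 : ((K * (ρ + 1) ^ (q - 1) : ℕ) : ℝ) ≤ (K * 2 ^ (q - 1) : ℝ) * (ρ : ℝ) ^ (q - 1) := by
      have : K * (ρ + 1) ^ (q - 1) ≤ K * 2 ^ (q - 1) * ρ ^ (q - 1) := by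
        rw [mul_assoc, ← mul_pow]
        exact Nat.mul_le_mul_left K (Nat.pow_le_pow_left (by omega) _)
      exact_mod_cast this
    calc ((K * (ρ + 1) ^ (q - 1) : ℕ) : ℝ) ≤ (ρ : ℝ) ^ (1 / 2 : ℝ) * (ρ : ℝ) ^ (q - 1) :=
          h2.trans (mul_le_mul_of_nonneg_right h1 (by positivity))
      _ = ((ρ : ℝ) ^ q) ^ (1 - 1 / (2 * q : ℝ)) := by
          have hρ0 : (0 : ℝ) < ρ := by exact_mod_cast hρ1
          rw [← Real.rpow_natCast, ← Real.rpow_natCast, ← Real.rpow_mul hρ0.le,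
            ← Real.rpow_add hρ0]
          congr 1
          rw [Nat.cast_sub hq]
          field_simp
          push_cast
          ring
      _ ≤ (k : ℝ) ^ (1 - 1 / (2 * q : ℝ)) := by
          refine Real.rpow_le_rpow (by positivity) (by exact_mod_cast hk) ?_
          rw [sub_nonneg, div_le_one (by positivity)]
          linarith

end Parameters

/-! ### Running time -/

/-- With suitable parameters, the algorithm accepts all positive instances on graphs of the class. -/
lemma exists_params_answer (r : ℕ) {α μ : ℝ} (hα : 0 < α) (hα1 : α < 1) (hμ : 0 < μ)
    {𝒢 : GraphClass} (h𝒢 : 𝒢.Hereditary) {A B : ℝ}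
    (hA : ∀ n : ℕ, 1 ≤ n → ∀ G ∈ 𝒢 n,
      (numCliquesLT G r : ℝ) ≤ A * ((G.cliqueNum : ℝ) ^ μ * (n : ℝ)))
    (hB : ∀ n : ℕ, 1 ≤ n → ∀ G ∈ 𝒢 n,
      (treewidth G : ℝ) ≤ B * ((G.cliqueNum : ℝ) ^ μ * (n : ℝ) ^ α)) :
    ∃ q aS aR aE, 2 ≤ q ∧ ∀ (n : ℕ) (G : SimpleGraph (Fin n)), G ∈ 𝒢 n → ∀ k,
      HasCliqueCover r G k → ((params r q aS aR aE).inst G k).Answer r := by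
  rcases Nat.eq_zero_or_pos r with rfl | hr
  · refine ⟨2, 0, 0, 0, le_rfl, fun n G _ k ⟨X, _, hX⟩ => ?_⟩
    exact absurd (SimpleGraph.isNClique_empty.2 rfl) (hX ∅)
  set u := ⌈μ⌉₊ with hu
  set M := max ⌈A⌉₊ ⌈B⌉₊ + 1 with hM
  have hAM : A ≤ M := (Nat.le_ceil A).trans (by
    exact_mod_cast (le_max_left _ ⌈B⌉₊).trans (Nat.le_succ _))
  have hBM : B ≤ M := (Nat.le_ceil B).trans (by
    exact_mod_cast (le_max_right ⌈A⌉₊ _).trans (Nat.le_succ _))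
  -- `q` is so large that `α` times the exponent of the bound for the core is less than `q`
  set v := (2 * u + 2) * r with hv
  obtain ⟨q, hq5, hq⟩ : ∃ q : ℕ, 5 ≤ q ∧ ((q + v : ℕ) : ℝ) * α + (2 * u + 4) ≤ q := by
    refine ⟨⌈(v + 2 * u + 4) / (1 - α)⌉₊ + 5, by omega, ?_⟩
    set p := ⌈(v + 2 * u + 4) / (1 - α)⌉₊
    have h1 : (v + 2 * u + 4) / (1 - α) ≤ p := Nat.le_ceil _
    rw [div_le_iff₀ (by linarith)] at h1
    have h2 : (v : ℝ) * α ≤ v := mul_le_of_le_one_right (by positivity) hα1.le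
    push_cast
    nlinarith
  obtain ⟨aM, haM1, haM⟩ := exists_coreBound_le r u M q (by omega)
  obtain ⟨aR, aE, hfits⟩ := exists_fits (aS := M * (1 + 2 * r) ^ u * aM + 2) hr hq5 haM
  refine ⟨q, M * (1 + 2 * r) ^ u * aM + 2, aR, aE, by omega, fun n G hG k hcov => ?_⟩
  set P := params r q (M * (1 + 2 * r) ^ u * aM + 2) aR aE
  obtain ⟨hw, -, -⟩ := rootSucc_spec (by omega : 1 ≤ q) k
  have hrep := P.represents G k
  obtain ⟨S, hSk, hS⟩ := hrep.exists_hitting (r := r) hcov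
  have hx1 : 1 ≤ rootSucc q k ^ 2 + 2 * r := by omega
  refine (hfits n G k).answer (Nat.mul_pos (by omega) (Nat.pow_pos hx1)) hrep.isGraph hr ?_ hSk hS
  intro W hW hWn hcl
  obtain ⟨H, hHG, hω, hsp⟩ := hrep.exists_induced (r := r) hW hWn hcl
  have hH := h𝒢 H G hG hHG
  have hω' : H.cliqueNum ≤ rootSucc q k ^ 2 + 2 * r := by
    refine hω.le.trans (le_of_eq ?_)
    simp only [P, Params.inst, params]
    ring
  refine hsp _ _ ?_ fun hWm => ?_
  · have h1 : (H.cliqueNum : ℝ) ^ μ ≤ ((rootSucc q k ^ 2 + 2 * r : ℕ) : ℝ) ^ u := by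
      rw [← Real.rpow_natCast]
      exact (Real.rpow_le_rpow (by positivity) (by exact_mod_cast hω') hμ.le).trans
        (Real.rpow_le_rpow_of_exponent_le (by exact_mod_cast hx1) (Nat.le_ceil μ))
    have h2 : (numCliquesLT H r : ℝ) ≤
        M * (((rootSucc q k ^ 2 + 2 * r : ℕ) : ℝ) ^ u * (W.card : ℝ)) :=
      (hA _ hW.card_pos H hH).trans (mul_le_mul hAM (mul_le_mul_of_nonneg_right h1 (by positivity))
        (by positivity) (by positivity))
    rw [← mul_assoc] at h2
    exact_mod_cast h2
  · exact treewidth_bound hα hμ (Nat.le_ceil μ) hBM hw rfl hω' hα1.le hq haM1 (hWm.trans (haM k))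
      (hB _ hW.card_pos H hH)

theorem mainTheorem2 (r : ℕ) :
    ∃ c : ℕ, ∀ (α μ : ℝ), 0 < α → α < 1 → 0 < μ →
      ∀ 𝒢 : GraphClass, 𝒢.Hereditary →
        (∃ A : ℝ, ∀ n : ℕ, 1 ≤ n → ∀ G ∈ 𝒢 n,
          (numCliquesLT G r : ℝ) ≤ A * ((G.cliqueNum : ℝ) ^ μ * (n : ℝ))) →
        (∃ B : ℝ, ∀ n : ℕ, 1 ≤ n → ∀ G ∈ 𝒢 n,
          (treewidth G : ℝ) ≤ B * ((G.cliqueNum : ℝ) ^ μ * (n : ℝ) ^ α)) →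
        ∃ ε : ℝ, 0 < ε ∧ ε < 1 ∧ ∃ (C : ℝ) (p : RAM.Prog),
          RAM.SolvesInTime p (fun _ G k => HasCliqueCover r G k) 𝒢
            (fun n k => C * (2 : ℝ) ^ ((k : ℝ) ^ ε) * ((n : ℝ) + 1) ^ c) := by
  obtain ⟨c, hc⟩ := exists_prog_answer r
  refine ⟨c, fun α μ hα hα1 hμ 𝒢 h𝒢 ⟨A, hA⟩ ⟨B, hB⟩ => ?_⟩
  obtain ⟨q, aS, aR, aE, hq, hans⟩ := exists_params_answer r hα hα1 hμ h𝒢 hA hB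
  obtain ⟨p, C, d, hp⟩ := hc _ (params_poly r q aS aR aE)
  obtain ⟨K', hK'⟩ := exists_two_pow_le q ((1 + q) * d + c * aE) (by omega)
  have hq' : (2 : ℝ) ≤ q := by exact_mod_cast hq
  refine ⟨1 - 1 / (2 * q), ?_, ?_, C * 2 ^ K', p, fun n G hG k => ?_⟩
  · rw [sub_pos, div_lt_one (by positivity)]
    linarith
  · have : (0 : ℝ) < 1 / (2 * q) := by positivity
    linarith
  obtain ⟨t, s, hexec, ht, hs⟩ := hp n G k
  refine ⟨t, s, hexec, ?_, hs.trans ⟨((params r q aS aR aE).represents G k).hasCliqueCover,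
    hans n G hG k⟩⟩
  obtain ⟨hw, hk, -⟩ := rootSucc_spec (by omega : 1 ≤ q) k
  have he : (params r q aS aR aE).e k = aE * rootSucc q k ^ (q - 1) := rfl
  -- the factor that is polynomial in `k` is absorbed by the exponential one
  have h1 : (k + 1) ^ d ≤ 2 ^ ((1 + q) * d * rootSucc q k ^ (q - 1)) :=
    pow_le_two_pow (a := 1) (b := q) (d := d) (j := 0) hw (by omega) (by simp) (by omega) le_rfl
  have h2 : t ≤ C * (n + 1) ^ c * 2 ^ (((1 + q) * d + c * aE) * rootSucc q k ^ (q - 1)) := by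
    refine ht.trans ?_
    rw [add_mul, pow_add, ← mul_assoc, he, mul_assoc c]
    gcongr
  calc (t : ℝ) ≤ C * (n + 1) ^ c * 2 ^ (((1 + q) * d + c * aE) * rootSucc q k ^ (q - 1)) := by
        exact_mod_cast h2
    _ ≤ C * (n + 1) ^ c * (2 ^ K' * (2 : ℝ) ^ ((k : ℝ) ^ (1 - 1 / (2 * q : ℝ)))) := by
        gcongr
        exact hK' k
    _ = _ := by ring
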